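/- Fix a deterministic multitape oracle Turing machine $U$ taking a program and an input (for example, any universal oracle machine). For an oracle $A\subseteq\{0,1\}^*$ and a time bound $T:\mathbb N\to\mathbb R$, let $\mathrm{CD}^{T,A}(x)$ be the length of a shortest program $p\in\{0,1\}^*$ such that (1) $U^A(p,x)$ accepts, (2) $U^A(p,v)$ rejects for all $v\neq x$, and (3) $U^A(p,v)$ halts in at most $T(|v|)$ steps for all $v$ (and $\mathrm{CD}^{T,A}(x)=\infty$ if there is no such $p$). Let $A^{=n}$ be the set of strings of length $n$ in $A$, and let $\log=\log_2$. Theorem. Let $t:\mathbb N\to\mathbb N$ be superpolynomial (for every $d$, $t(n)>n^d$ for all sufficiently large $n$) and time-constructible (the binary expansion of $t(n)$ can be computed from $1^n$ in time $O(t(n))$). There exist a set $A\subseteq\{0,1\}^*$ computable in space $O(t(n))$ and a constant $c$ such that for all sufficiently large $n$ there exists $x\in A^{=n}$ such that (1) $\mathrm{CD}^{T,A}(x)\ \ge\ 2\log|A^{=n}|-c$ for every time bound $T$ with $T(n)\le\min\{t(n)^{1/2},\,2^{n/8}\}$, and (2) $|A^{=n}|\ \ge\ \min\{t(n)^{1/6},\,2^{n/24}\}$.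 In particular, for all sufficiently large $n$ with $t(n)\le 2^{n/4}$, there is $x\in A^{=n}$ with $\mathrm{CD}^{t(n)^{1/2},A}(x)\ge 2\log|A^{=n}|-c$ and $|A^{=n}|\ge t(n)^{1/6}$. -/

import Mathlib

open Filter

/-- The tapes of a machine: one tape for the program, one for the input, one for oracle queries,
one for the output, and one work tape for every `w : W`. -/
inductive TapeName (W : Type) : Type
  | program
  | input
  | query
  | output
  | work (w : W)

/-- Tape symbols: `none` is the blank, `some (Sum.inl b)` is the bit `b`, and
`some (Sum.inr a)` is an auxiliary symbol. -/
abbrev TapeSymbol (Aux : Type) : Type := Option (Bool ⊕ Aux)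

/-- A deterministic multitape oracle Turing machine with two-way infinite tapes. -/
structure OracleTM : Type 1 where
  /-- control states -/
  State : Type
  /-- auxiliary tape symbols (besides the bits and the blank) -/
  Aux : Type
  /-- names of the work tapes -/
  Work : Type
  finite_state : Finite State
  finite_aux : Finite Aux
  finite_work : Finite Work
  /-- the initial state -/
  start : State
  /-- `some true`: halting and accepting; `some false`: halting and rejecting; `none`: running -/
  verdict : State → Option Bool
  /-- `some (y, n)`: a query state, with successor `y` if the string on the query tape belongs to
  the oracle and successor `n` otherwise; `none`: an ordinary state -/
  ask : State → Option (State × State)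
  /-- in an ordinary running state: from the scanned symbols, the next state and, for every tape,
  the symbol to write and the direction (`-1`, `0` or `1`) in which the head then moves -/
  trans : State → (TapeName Work → TapeSymbol Aux) →
    State × (TapeName Work → TapeSymbol Aux × SignType)

namespace OracleTM

/-- A configuration: the state, the contents of all tapes, and the positions of all heads. -/
structure Config (M : OracleTM) : Type where
  state : M.State
  cells : TapeName M.Work → ℤ → TapeSymbol M.Aux
  head : TapeName M.Work → ℤ

/-- The tape that holds the word `w` in the cells `0, 1, …, |w| - 1` and blanks elsewhere. -/
def wordTape {Aux : Type} (w : List Bool) : ℤ → TapeSymbol Aux :=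
  fun z => if 0 ≤ z then (w[z.toNat]?).map Sum.inl else none

/-- The word on a tape, read from cell `0` up to the first cell without a bit, is `w`. -/
def Spells {Aux : Type} (tape : ℤ → TapeSymbol Aux) (w : List Bool) : Prop :=
  (∀ (i : ℕ) (h : i < w.length), tape (i : ℤ) = some (Sum.inl w[i])) ∧
    ∀ b : Bool, tape (w.length : ℤ) ≠ some (Sum.inl b)

/-- The initial configuration with program `p` and input `x`: all heads are on cell `0`, and all
tapes except the program tape and the input tape are blank. -/
def init (M : OracleTM) (p x : List Bool) : M.Config where
  state := M.start
  cells := fun i => match i with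
    | .program => wordTape p
    | .input => wordTape x
    | _ => fun _ => none
  head := fun _ => 0

open Classical in
/-- One step of computation with oracle `O`. Halting configurations do not change any more, and a
query is answered in one step. -/
noncomputable def step (M : OracleTM) (O : Set (List Bool)) (c : M.Config) : M.Config :=
  match M.verdict c.state with
  | some _ => c
  | none =>
    match M.ask c.state with
    | some (y, n) =>
      { c with state := if ∃ w ∈ O, Spells (c.cells .query) w then y else n }
    | none =>
      let a := M.trans c.state (fun i => c.cells i (c.head i))
      { state := a.1
        cells := fun i z => if z = c.head i then (a.2 i).1 else c.cells i z
        head := fun i => c.head i + ((a.2 i).2 : ℤ) }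

/-- The configuration after `s` steps on program `p` and input `x` with oracle `O`. -/
noncomputable def run (M : OracleTM) (O : Set (List Bool)) (p x : List Bool) (s : ℕ) : M.Config :=
  (M.step O)^[s] (M.init p x)

/-- The verdict after `s` steps (`none` as long as the machine has not halted). -/
noncomputable def verdictAt (M : OracleTM) (O : Set (List Bool)) (p x : List Bool) (s : ℕ) :
    Option Bool :=
  M.verdict (M.run O p x s).state

/-- `M` with oracle `O` accepts the input `x` under the program `p`. -/
def Accepts (M : OracleTM) (O : Set (List Bool)) (p x : List Bool) : Prop :=
  ∃ s : ℕ, M.verdictAt O p x s = some true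

/-- `M` with oracle `O` rejects the input `x` under the program `p`. -/
def Rejects (M : OracleTM) (O : Set (List Bool)) (p x : List Bool) : Prop :=
  ∃ s : ℕ, M.verdictAt O p x s = some false

/-- `M` with oracle `O` halts on `(p, x)` in at most `b` steps. -/
def HaltsWithin (M : OracleTM) (O : Set (List Bool)) (p x : List Bool) (b : ℝ) : Prop :=
  ∃ s : ℕ, (s : ℝ) ≤ b ∧ M.verdictAt O p x s ≠ none

/-- In the computation of `M` on `(p, x)` with oracle `O`, no head ever moves farther than `b`
cells from its initial position. -/
def SpaceWithin (M : OracleTM) (O : Set (List Bool)) (p x : List Bool) (b : ℕ) : Prop :=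
  ∀ (s : ℕ) (i : TapeName M.Work), ((M.run O p x s).head i).natAbs ≤ b

end OracleTM

/-- The program `p` distinguishes `x` on the machine `U` with oracle `A` in time `T`: it accepts
`x`, rejects every other string, and halts on every string `v` in at most `T |v|` steps. -/
def Distinguishes (U : OracleTM) (A : Set (List Bool)) (T : ℕ → ℝ) (p x : List Bool) : Prop :=
  U.Accepts A p x ∧ (∀ v : List Bool, v ≠ x → U.Rejects A p v) ∧
    ∀ v : List Bool, U.HaltsWithin A p v (T v.length)

/-- The `T`-time bounded distinguishing complexity of `x` with oracle `A`, with respect to the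
machine `U`: the least length of a distinguishing program (`⊤` if there is none). -/
noncomputable def distComplexity (U : OracleTM) (T : ℕ → ℝ) (A : Set (List Bool))
    (x : List Bool) : ℕ∞ :=
  sInf {l : ℕ∞ | ∃ p : List Bool, Distinguishes U A T p x ∧ l = (p.length : ℕ∞)}

/-- The strings of length `n` in `A`. -/
def slice (A : Set (List Bool)) (n : ℕ) : Set (List Bool) := {x | x ∈ A ∧ x.length = n}

/-- `A` is decided by a Turing machine (without oracle and without program) that uses space
`O(t(n))` on inputs of length `n`. -/
def ComputableInSpace (A : Set (List Bool)) (t : ℕ → ℕ) : Prop :=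
  ∃ (M : OracleTM) (c : ℕ), ∀ x : List Bool,
    (x ∈ A → M.Accepts ∅ [] x) ∧ (x ∉ A → M.Rejects ∅ [] x) ∧
      M.SpaceWithin ∅ [] x (c * t x.length + c)

/-- Some Turing machine (without oracle and without program), on input `1ⁿ`, halts in `O(t(n))`
steps with the binary expansion of `t(n)` (least significant bit first) on its output tape. -/
def TimeConstructible (t : ℕ → ℕ) : Prop :=
  ∃ (M : OracleTM) (c : ℕ), ∀ n : ℕ, ∃ s : ℕ, s ≤ c * t n + c ∧
    M.verdictAt ∅ [] (List.replicate n true) s ≠ none ∧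
    OracleTM.Spells ((M.run ∅ [] (List.replicate n true) s).cells .output) (Nat.bits (t n))

/-- `t` eventually exceeds every polynomial. -/
def Superpolynomial (t : ℕ → ℕ) : Prop := ∀ d : ℕ, ∀ᶠ n in atTop, n ^ d < t n

/-! The oracle is built slice by slice. For length `n` let `N` be the least size with `t n ≤ N ^ 6`
or `2 ^ n ≤ N ^ 24`. For large `n` it exceeds `n`, because `t` is superpolynomial. The slice
receives exactly `N` words, and every admissible time bound at `n` is at most `N ^ 3`. Put `P = N ^
2 / 2` and identify programs with numbers by `wordNum`. If no program with number below `P`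
distinguishes some word `x` of the slice from the other words of the slice within `N ^ 3` steps,
then a distinguishing program for `x` has length at least `2 * log N - 2`.

Such a slice exists by two combinatorial facts (`exists_goodSlice`). Let `O` be the part of the
oracle built so far. Join `x` to `y` if some program below `P`, run on `x` with oracle `O ∪ {x}`,
has `y` on its query tape in time. Outdegrees are at most `P * N ^ 3`, so among the `2 ^ n` words
there is an independent set of `P + N` words (`exists_independent`), even after removing all words
queried on inputs from `O`. For any slice `D` inside this set, the verdict of a small program on `z
∈ D` with oracle `O ∪ D` is the one with oracle `O ∪ {z}`. Hence the set `S x` of small programs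
accepting `x` is known before `D` is chosen. Since `2 * P < N * (N + 1)`, some `S x` is covered by
fewer than `N` other sets `S y` (`exists_covered`). Put `x` and these `y` into `D`: every small
program accepting `x` accepts another word of `D`. The factor 2 in front of the logarithm is due to
this lemma, by which `N` words defeat about `N ^ 2 / 2` programs.

The slices must not disturb each other. Sizes need not increase with the length, so stages are
ordered by size: `Nat.pair m N` with `m < N` is `N ^ 2 + m`. New words avoid everything that
programs below the current bound query on old inputs, and later bounds are at least as large as
earlier ones (`le_of_pair_lt`). So verdicts fixed at one stage survive in the final oracle
(`verdictAt_oracle`).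

For the space bound, the first half of the file provides a calculus. Counter programs whose
registers are polynomially bounded in the input numbers run on a Turing machine in space linear in
the bit length (`computableInSpace_of_prog`). The functions they compute (`LS`) are closed under
composition, bounded recursion, bounded quantifiers and bounded search. Simulated runs of oracle
machines are of this kind when tapes are coded as numbers and the oracle as a table of digits
(`LS.simRun`, `simVerdict_eq`). To decide the oracle, search for the least number `K = 2 ^ (C * (N ^
6 + 1))` for which `N` is large enough for the input length. All stages up to that size can be
replayed with numbers polynomial in `K` (`stagesNum_eq`). By the choice of `N` these have `O(N ^ 6)
= O(t n)` bits. The comparison `t m ≤ N ^ 6` is made by running the machine that constructs `t` for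
`c * N ^ 6 + c` steps, so no larger value of `t` is ever needed. -/

section

/-! ### A counter language and its implementation on Turing machines -/

/-- Programs over registers that hold natural numbers. -/
inductive Prog : Type
  | skip
  | inc (r : ℕ)
  | dec (r : ℕ)
  | seq (p q : Prog)
  | loop (r : ℕ) (p : Prog)

/-- Execution of a program in which no register is ever increased beyond `b`. A decrement requires
a nonzero register; `loop r p` repeats `p` as long as register `r` is nonzero. -/
inductive Exec (b : ℕ) : Prog → (ℕ → ℕ) → (ℕ → ℕ) → Prop
  | skip (σ) : Exec b .skip σ σ
  | inc (r σ) : σ r + 1 ≤ b → Exec b (.inc r) σ (Function.update σ r (σ r + 1))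
  | dec (r σ) : σ r ≠ 0 → Exec b (.dec r) σ (Function.update σ r (σ r - 1))
  | seq {p q σ τ ρ} : Exec b p σ τ → Exec b q τ ρ → Exec b (.seq p q) σ ρ
  | loop_zero {r p σ} : σ r = 0 → Exec b (.loop r p) σ σ
  | loop_succ {r p σ τ ρ} : σ r ≠ 0 → Exec b p σ τ → Exec b (.loop r p) τ ρ →
      Exec b (.loop r p) σ ρ

theorem Exec.mono {b b' : ℕ} (h : b ≤ b') {p σ τ} (he : Exec b p σ τ) : Exec b' p σ τ := by
  induction he with
  | skip => exact .skip _
  | inc r σ h' => exact .inc r σ (h'.trans h)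
  | dec r σ h' => exact .dec r σ h'
  | seq _ _ h1 h2 => exact .seq h1 h2
  | loop_zero h' => exact .loop_zero h'
  | loop_succ h' _ _ h1 h2 => exact .loop_succ h' h1 h2

namespace Prog

/-- An upper bound for the registers that occur in a program. -/
def top : Prog → ℕ
  | skip => 0
  | inc r => r + 1
  | dec r => r + 1
  | seq p q => max p.top q.top
  | loop r p => max (r + 1) p.top

/-- The nodes of the flow chart of a program. -/
def St : Prog → Type
  | skip => Unit
  | inc _ => Unit
  | dec _ => Unit
  | seq p q => p.St ⊕ q.St
  | loop _ p => Option p.St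

theorem finite_St (p : Prog) : Finite p.St := by
  induction p with
  | skip => exact inferInstanceAs (Finite Unit)
  | inc => exact inferInstanceAs (Finite Unit)
  | dec => exact inferInstanceAs (Finite Unit)
  | seq p q hp hq => exact inferInstanceAs (Finite (p.St ⊕ q.St))
  | loop r p hp => exact inferInstanceAs (Finite (Option p.St))

/-- The first node of a program. -/
def entry : (p : Prog) → p.St
  | skip => ()
  | inc _ => ()
  | dec _ => ()
  | seq p _ => Sum.inl p.entry
  | loop _ _ => none

end Prog

/-- Instructions of a flow chart with nodes `S`. -/
inductive Node (S : Type) : Type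
  | inc (r : ℕ) (s : S)
  | dec (r : ℕ) (s : S)
  | test (r : ℕ) (z s : S)
  | extend (r : ℕ) (s : S)
  | halt (v : Bool)

namespace Node

def map {S S' : Type} (f : S → S') : Node S → Node S'
  | inc r s => inc r (f s)
  | dec r s => dec r (f s)
  | test r z s => test r (f z) (f s)
  | extend r s => extend r (f s)
  | halt v => halt v

theorem map_map {S S' S'' : Type} (f : S → S') (g : S' → S'') (n : Node S) :
    (n.map f).map g = n.map (fun s => g (f s)) := by cases n <;> rfl

/-- The register of an instruction. -/
def reg {S : Type} : Node S → ℕ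
  | inc r _ => r
  | dec r _ => r
  | test r _ _ => r
  | extend r _ => r
  | halt _ => 0

@[simp] theorem reg_map {S S' : Type} (f : S → S') (n : Node S) : (n.map f).reg = n.reg := by
  cases n <;> rfl

/-- The verdict of an instruction. -/
def verdict {S : Type} : Node S → Option Bool
  | halt v => some v
  | _ => none

end Node

namespace Prog

/-- Continue with `q` after leaving `p`. -/
def seqExit {S S' : Type} (e : S') : Option S → Option (S ⊕ S')
  | some s => some (Sum.inl s)
  | none => some (Sum.inr e)

/-- The flow chart of a program; `none` is its exit. -/
def node : (p : Prog) → p.St → Node (Option p.St)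
  | skip, _ => .test 0 none none
  | inc r, _ => .inc r none
  | dec r, _ => .dec r none
  | seq p q, s => Sum.rec (motive := fun _ => Node (Option (p.St ⊕ q.St)))
      (fun s => (p.node s).map (seqExit q.entry)) (fun s => (q.node s).map (Option.map Sum.inr)) s
  | loop r p, s => Option.rec (motive := fun _ => Node (Option (Option p.St)))
      (.test r none (some (some p.entry))) (fun s => (p.node s).map some) s

theorem reg_node_lt (p : Prog) (s : p.St) : (p.node s).reg < p.top + 1 := by
  induction p with
  | skip => simp [node, Node.reg]
  | inc r => simp [node, Node.reg, top]
  | dec r => simp [node, Node.reg, top]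
  | seq p q hp hq =>
    cases s with
    | inl s =>
      have h1 := hp s
      have h2 : ((seq p q).node (Sum.inl s)).reg = (p.node s).reg := Node.reg_map _ _
      simp only [top]; omega
    | inr s =>
      have h1 := hq s
      have h2 : ((seq p q).node (Sum.inr s)).reg = (q.node s).reg := Node.reg_map _ _
      simp only [top]; omega
  | loop r p hp =>
    cases s with
    | none =>
      have h2 : ((loop r p).node none).reg = r := rfl
      simp only [top]; omega
    | some s =>
      have h1 := hp s
      have h2 : ((loop r p).node (some s)).reg = (p.node s).reg := Node.reg_map _ _
      simp only [top]; omega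

end Prog

/-- One step of a flow chart, in which no register is increased beyond `b`. -/
inductive FlowStep {T : Type} (nd : T → Node T) (b : ℕ) : T × (ℕ → ℕ) → T × (ℕ → ℕ) → Prop
  | inc {s r s'} (σ : ℕ → ℕ) : nd s = .inc r s' → σ r + 1 ≤ b →
      FlowStep nd b (s, σ) (s', Function.update σ r (σ r + 1))
  | dec {s r s'} (σ : ℕ → ℕ) : nd s = .dec r s' → σ r ≠ 0 →
      FlowStep nd b (s, σ) (s', Function.update σ r (σ r - 1))
  | test_zero {s r z s'} (σ : ℕ → ℕ) : nd s = .test r z s' → σ r = 0 → FlowStep nd b (s, σ) (z, σ)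
  | test_succ {s r z s'} (σ : ℕ → ℕ) : nd s = .test r z s' → σ r ≠ 0 →
      FlowStep nd b (s, σ) (s', σ)

-- The chart of `p` is embedded into an arbitrary larger chart along `f`. This generality lets the
-- induction pass to subprograms, whose exits are glued to different nodes of the surrounding chart.
open Relation in
theorem Exec.flow {b : ℕ} {p σ σ'} (he : Exec b p σ σ') :
    ∀ {T : Type} (nd : T → Node T) (f : Option p.St → T),
      (∀ s, nd (f (some s)) = (p.node s).map f) →
      ReflTransGen (FlowStep nd b) (f (some p.entry), σ) (f none, σ') := by
  induction he with
  | skip σ =>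
    intro T nd f hf
    have h := hf ()
    by_cases h0 : σ 0 = 0
    · exact .single (.test_zero σ h h0)
    · exact .single (.test_succ σ h h0)
  | inc r σ h' => intro T nd f hf; exact .single (.inc σ (hf ()) h')
  | dec r σ h' => intro T nd f hf; exact .single (.dec σ (hf ()) h')
  | @seq p q σ τ ρ _ _ h1 h2 =>
    intro T nd f hf
    refine (h1 nd (fun o => f (Prog.seqExit q.entry o)) fun s => ?_).trans
      (h2 nd (fun o => f (o.map Sum.inr)) fun s => ?_)
    · exact (hf (Sum.inl s)).trans (Node.map_map _ _ _)
    · exact (hf (Sum.inr s)).trans (Node.map_map _ _ _)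
  | loop_zero h' => intro T nd f hf; exact .single (.test_zero _ (hf none) h')
  | @loop_succ r p σ τ ρ h' _ _ h1 h2 =>
    intro T nd f hf
    refine .head (.test_succ _ (hf none) h') ((h1 nd (fun o => f (some o)) fun s => ?_).trans
      (h2 nd f hf))
    exact (hf (some s)).trans (Node.map_map _ _ _)

/-! ### Binary counters -/

/-- The number with the given binary digits, least significant first. -/
def bitsVal : List Bool → ℕ
  | [] => 0
  | b :: l => b.toNat + 2 * bitsVal l

/-- Increment a binary counter. -/
def incBits : List Bool → List Bool
  | [] => [true]
  | true :: l => false :: incBits l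
  | false :: l => true :: l

/-- Decrement a nonzero binary counter, keeping its length. -/
def decBits : List Bool → List Bool
  | [] => []
  | true :: l => false :: l
  | false :: l => true :: decBits l

theorem bitsVal_incBits (l : List Bool) : bitsVal (incBits l) = bitsVal l + 1 := by
  induction l with
  | nil => rfl
  | cons b l ih => cases b <;> simp [incBits, bitsVal, ih] <;> ring

theorem bitsVal_decBits (l : List Bool) (h : bitsVal l ≠ 0) :
    bitsVal (decBits l) = bitsVal l - 1 := by
  induction l with
  | nil => exact absurd rfl h
  | cons b l ih =>
    cases b
    · simp [decBits, bitsVal] at h ⊢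
      rw [ih h]; omega
    · simp [decBits, bitsVal]

theorem length_decBits (l : List Bool) : (decBits l).length = l.length := by
  induction l with
  | nil => rfl
  | cons b l ih => cases b <;> simp [decBits, ih]

/-- A counter grows only when all its bits are 1. So a counter that never exceeds `b` never needs
more than `Nat.size b` cells, even though decrements keep leading zeros. -/
theorem length_incBits (l : List Bool) : (incBits l).length = l.length ∨
    (incBits l).length = l.length + 1 ∧ bitsVal l + 1 = 2 ^ l.length := by
  induction l with
  | nil => right; simp [incBits, bitsVal]
  | cons b l ih =>
    cases b
    · left; simp [incBits]
    · rcases ih with h | ⟨h, h'⟩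
      · left; simp [incBits, h]
      · right; simp [incBits, h, bitsVal, pow_succ, ← h']; ring

theorem length_incBits_le {l : List Bool} {b L : ℕ} (hL : Nat.size b ≤ L) (hl : l.length ≤ L)
    (h : bitsVal l + 1 ≤ b) : (incBits l).length ≤ L := by
  rcases length_incBits l with h1 | ⟨h1, h2⟩
  · omega
  · have : l.length < Nat.size b := Nat.lt_size.2 (by omega)
    omega

theorem bitsVal_append_true (l : List Bool) :
    bitsVal (l ++ [true]) = bitsVal l + 2 ^ l.length := by
  induction l with
  | nil => rfl
  | cons b l ih => simp [bitsVal, ih, pow_succ]; ring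

/-! ### The machine of a flow chart -/

open OracleTM in
theorem wordTape_append_cons {Aux : Type} (l l' : List Bool) (b c : Bool) (z : ℤ) :
    (if z = (l.length : ℤ) then some (Sum.inl c) else wordTape (Aux := Aux) (l ++ b :: l') z)
      = wordTape (l ++ c :: l') z := by
  unfold wordTape
  split_ifs with h h0 h0
  · subst h; simp
  · omega
  · have : z.toNat ≠ l.length := by omega
    rcases lt_or_gt_of_ne this with h1 | h1
    · rw [List.getElem?_append_left h1, List.getElem?_append_left h1]
    · rw [List.getElem?_append_right h1.le, List.getElem?_append_right h1.le]
      obtain ⟨k, hk⟩ : ∃ k, z.toNat - l.length = k + 1 := ⟨z.toNat - l.length - 1, by omega⟩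
      simp [hk]
  · rfl

open OracleTM in
theorem wordTape_append_singleton {Aux : Type} (l : List Bool) (c : Bool) (z : ℤ) :
    (if z = (l.length : ℤ) then some (Sum.inl c) else wordTape (Aux := Aux) l z)
      = wordTape (l ++ [c]) z := by
  unfold wordTape
  split_ifs with h h0 h0
  · subst h; simp
  · omega
  · have : z.toNat ≠ l.length := by omega
    rcases lt_or_gt_of_ne this with h1 | h1
    · rw [List.getElem?_append_left h1]
    · rw [List.getElem?_eq_none h1.le, List.getElem?_eq_none (by simp; omega)]
  · rfl

theorem wordTape_length_append {Aux : Type} (l l' : List Bool) (b : Bool) :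
    OracleTM.wordTape (Aux := Aux) (l ++ b :: l') (l.length : ℤ) = some (Sum.inl b) := by
  simp [OracleTM.wordTape]

theorem wordTape_length {Aux : Type} (l : List Bool) :
    OracleTM.wordTape (Aux := Aux) l (l.length : ℤ) = none := by
  simp [OracleTM.wordTape]

noncomputable instance {W : Type} : DecidableEq (TapeName W) := Classical.decEq _

/-- The tape that holds register `r`: the input tape for register `0`. -/
def regTape (R : ℕ) (r : ℕ) : TapeName (Fin (R + 1)) :=
  if r = 0 then .input else .work (Fin.ofNat (R + 1) r)

theorem regTape_inj {R r r' : ℕ} (h : r < R + 1) (h' : r' < R + 1)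
    (he : regTape R r = regTape R r') : r = r' := by
  unfold regTape at he
  split_ifs at he with h1 h2 h2
  · omega
  · injection he with he
    simpa [Fin.ext_iff, Fin.ofNat, Nat.mod_eq_of_lt h, Nat.mod_eq_of_lt h'] using he

/-- What the machine of a flow chart does at an instruction: the next state, the symbol to write
and the move of the head. The state `(s, none)` works on the counter from its first cell on, the
state `(s, some s')` returns to the first cell and goes to `s'`. -/
def Node.act {T : Type} (s : T) (n : Node T) (ph : Option T) (a : TapeSymbol Empty) :
    (T × Option T) × TapeSymbol Empty × SignType :=
  match ph, a with
  | some s', none => ((s', none), none, 1)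
  | some s', some a => ((s, some s'), some a, -1)
  | none, a =>
    match n, a with
    | .inc _ _, some (.inl true) => ((s, none), some (.inl false), 1)
    -- This covers the bit 0 and also the blank behind the word, where the carry creates a new
    -- leading bit.
    | .inc _ s', _ => ((s, some s'), some (.inl true), 0)
    | .dec _ _, some (.inl false) => ((s, none), some (.inl true), 1)
    | .dec _ s', _ => ((s, some s'), some (.inl false), 0)
    | .test _ _ _, some (.inl false) => ((s, none), some (.inl false), 1)
    -- The head stands on the blank behind the word and must move left first; otherwise the return
    -- phase would take this blank for the one before cell 0.
    | .test _ z _, none => ((s, some z), none, -1)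
    | .test _ _ s', a => ((s, some s'), a, 0)
    | .extend _ s', none => ((s, some s'), some (.inl true), 0)
    | .extend _ _, a => ((s, none), a, 1)
    | .halt _, a => ((s, none), a, 0)

/-- The machine that implements a flow chart with binary counters. -/
noncomputable def flowTM {T : Type} [Finite T] (nd : T → Node T) (start : T) (R : ℕ) : OracleTM where
  State := T × Option T
  Aux := Empty
  Work := Fin (R + 1)
  finite_state := inferInstance
  finite_aux := inferInstance
  finite_work := inferInstance
  start := (start, none)
  verdict := fun s => match s.2 with
    | none => (nd s.1).verdict
    | some _ => none
  ask := fun _ => none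
  trans := fun s a =>
    let r := regTape R (nd s.1).reg
    let x := (nd s.1).act s.1 s.2 (a r)
    (x.1, fun (j : TapeName (Fin (R + 1))) => if j = r then x.2 else (a j, 0))

/-! ### Space-bounded execution of flow charts on tapes -/

section FlowTM

variable {T : Type} [Finite T] (nd : T → Node T) (start : T) (R : ℕ)

/-- The configuration in which every tape holds a word, and all heads except that of tape `i` are
on their first cells. -/
noncomputable def flowCfg (s : T × Option T) (W : TapeName (Fin (R + 1)) → List Bool)
    (i : TapeName (Fin (R + 1))) (z : ℤ) : (flowTM nd start R).Config where
  state := s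
  cells := fun (j : TapeName (Fin (R + 1))) => OracleTM.wordTape (W j)
  head := fun (j : TapeName (Fin (R + 1))) => if j = i then z else 0

/-- All tapes other than that of the current register rewrite the symbol they scan and stay, so a
step is described by a single symbol and a single move. -/
theorem flowTM_step (s : T) (ph : Option T) (W : TapeName (Fin (R + 1)) → List Bool) (z : ℤ)
    (l' : List Bool)
    (hv : ph = none → (nd s).verdict = none)
    (x : (T × Option T) × TapeSymbol Empty × SignType)
    (hx : (nd s).act s ph (OracleTM.wordTape (W (regTape R (nd s).reg)) z) = x)
    (h : ∀ y, (if y = z then x.2.1 else OracleTM.wordTape (W (regTape R (nd s).reg)) y)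
      = OracleTM.wordTape l' y) :
    (flowTM nd start R).step ∅ (flowCfg nd start R (s, ph) W (regTape R (nd s).reg) z) =
      flowCfg nd start R x.1 (Function.update W (regTape R (nd s).reg) l')
        (regTape R (nd s).reg) (z + (x.2.2 : ℤ)) := by
  have hverd : (flowTM nd start R).verdict (s, ph) = none := by
    cases ph with
    | none => exact hv rfl
    | some _ => rfl
  unfold OracleTM.step
  have h1 : (flowCfg nd start R (s, ph) W (regTape R (nd s).reg) z).state = (s, ph) := rfl
  rw [h1, hverd]
  have h2 : (flowTM nd start R).ask (s, ph) = none := rfl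
  simp only [h2]
  set r := regTape R (nd s).reg with hr
  have h3 : (flowTM nd start R).trans (s, ph) (fun i =>
      (flowCfg nd start R (s, ph) W r z).cells i ((flowCfg nd start R (s, ph) W r z).head i)) =
      (x.1, fun (j : TapeName (Fin (R + 1))) => if j = r then x.2 else (OracleTM.wordTape (W j) 0, 0)) := by
    have h4 : OracleTM.wordTape (Aux := Empty) (W r) (if r = r then z else 0)
        = OracleTM.wordTape (W r) z := by rw [if_pos rfl]
    change (((nd s).act s ph (OracleTM.wordTape (W r) (if r = r then z else 0))).1,
      fun (j : TapeName (Fin (R + 1))) => if j = r then (nd s).act s ph (OracleTM.wordTape (W r) (if r = r then z else 0))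
        |>.2 else (OracleTM.wordTape (W j) (if j = r then z else 0), 0)) = _
    rw [h4, hx]
    congr 1
    refine funext fun (j : TapeName (Fin (R + 1))) => ?_
    by_cases hj : j = r
    · rw [if_pos hj, if_pos hj]
    · rw [if_neg hj, if_neg hj, if_neg hj]
  rw [h3]
  unfold flowCfg
  congr 1
  · refine funext fun (j : TapeName (Fin (R + 1))) => funext fun y => ?_
    change (if y = (if j = r then z else 0) then
      (if j = r then x.2 else (OracleTM.wordTape (W j) 0, 0)).1 else OracleTM.wordTape (W j) y) =
      OracleTM.wordTape (Function.update W r l' j) y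
    by_cases hj : j = r
    · subst hj
      rw [if_pos rfl, if_pos rfl, Function.update_self]
      exact h y
    · rw [if_neg hj, if_neg hj, Function.update_of_ne hj]
      split_ifs with hy
      · rw [hy]
      · rfl
  · refine funext fun (j : TapeName (Fin (R + 1))) => ?_
    change (if j = r then z else 0) +
      (((if j = r then x.2 else (OracleTM.wordTape (W j) 0, 0)).2 : SignType) : ℤ) =
      if j = r then z + (x.2.2 : ℤ) else 0
    by_cases hj : j = r
    · rw [if_pos hj, if_pos hj, if_pos hj]
    · rw [if_neg hj, if_neg hj, if_neg hj]; simp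

/-- `c` leads to `c'` with all heads staying within distance `b` of their first cells. -/
def SpacePath (M : OracleTM) (b : ℕ) (c c' : M.Config) : Prop :=
  ∃ n, (M.step ∅)^[n] c = c' ∧ ∀ k ≤ n, ∀ i, (((M.step ∅)^[k] c).head i).natAbs ≤ b

variable {M : OracleTM} {b : ℕ}

theorem SpacePath.refl {c : M.Config} (h : ∀ i, (c.head i).natAbs ≤ b) : SpacePath M b c c :=
  ⟨0, rfl, fun k hk i => by obtain rfl : k = 0 := by omega
                            exact h i⟩

theorem SpacePath.trans {c c' c'' : M.Config} (h : SpacePath M b c c') (h' : SpacePath M b c' c'') :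
    SpacePath M b c c'' := by
  obtain ⟨n, hn, hs⟩ := h
  obtain ⟨n', hn', hs'⟩ := h'
  refine ⟨n' + n, by rw [Function.iterate_add_apply, hn, hn'], fun k hk i => ?_⟩
  rcases le_total k n with h1 | h1
  · exact hs k h1 i
  · obtain ⟨m, rfl⟩ := Nat.exists_eq_add_of_le h1
    rw [add_comm, Function.iterate_add_apply, hn]
    exact hs' m (by omega) i

theorem SpacePath.head {c c' c'' : M.Config} (h0 : ∀ i, (c.head i).natAbs ≤ b)
    (h : M.step ∅ c = c') (h' : SpacePath M b c' c'') : SpacePath M b c c'' := by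
  obtain ⟨n, hn, hs⟩ := h'
  refine ⟨n + 1, by rw [Function.iterate_succ_apply, h, hn], fun k hk i => ?_⟩
  cases k with
  | zero => exact h0 i
  | succ k => rw [Function.iterate_succ_apply, h]; exact hs k (by omega) i

theorem flowCfg_head_le {s : T × Option T} {W : TapeName (Fin (R + 1)) → List Bool}
    {i : TapeName (Fin (R + 1))} {z : ℤ} {b : ℕ} (hz : z.natAbs ≤ b)
    (j : TapeName (Fin (R + 1))) :
    ((flowCfg nd start R s W i z).head j).natAbs ≤ b := by
  unfold flowCfg
  dsimp only
  split_ifs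
  · exact hz
  · simp

theorem flowCfg_zero {s : T × Option T} {W : TapeName (Fin (R + 1)) → List Bool}
    (i i' : TapeName (Fin (R + 1))) :
    flowCfg nd start R s W i 0 = flowCfg nd start R s W i' 0 := by
  unfold flowCfg
  simp

/-- The return phase walks left over bits until the blank in cell -1, then steps right onto cell 0.
-/
theorem flowTM_back (s s' : T) (W : TapeName (Fin (R + 1)) → List Bool) (k b : ℕ)
    (hk : k ≤ (W (regTape R (nd s).reg)).length) (hb : k < b) (hb0 : 0 < b) :
    SpacePath (flowTM nd start R) b
      (flowCfg nd start R (s, some s') W (regTape R (nd s).reg) ((k : ℤ) - 1))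
      (flowCfg nd start R (s', none) W (regTape R (nd s).reg) 0) := by
  induction k with
  | zero =>
    refine .head (flowCfg_head_le _ _ _ (by simp; omega))
      ((flowTM_step nd start R s (some s') W _ (W (regTape R (nd s).reg)) (by simp)
        ((s', none), none, 1) ?_ ?_).trans ?_)
      (SpacePath.refl (flowCfg_head_le _ _ _ (by simp)))
    · simp [OracleTM.wordTape, Node.act]
    · intro y
      dsimp only
      split_ifs with h
      · subst h; simp [OracleTM.wordTape]
      · rfl
    · simp
  | succ k ih =>
    obtain ⟨a, ha⟩ : ∃ a, OracleTM.wordTape (Aux := Empty) (W (regTape R (nd s).reg)) (k : ℤ)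
        = some a := by
      have hk' : k < (W (regTape R (nd s).reg)).length := by omega
      exact ⟨_, by simp [OracleTM.wordTape, List.getElem?_eq_getElem hk']; rfl⟩
    refine .head (flowCfg_head_le _ _ _ (by omega))
      ((flowTM_step nd start R s (some s') W _ (W (regTape R (nd s).reg)) (by simp)
        ((s, some s'), some a, -1) ?_ ?_).trans ?_)
      (ih (by omega) (by omega))
    · simp [Node.act, ha]
    · intro y
      dsimp only
      split_ifs with h
      · subst h; simp [ha]
      · rfl
    · simp [sub_eq_add_neg]

/-- The word is split as `l ++ l'` at the head, so that the propagation of the carry becomes an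
induction on `l'` with `l` generalized. The other three instructions follow the same scheme. -/
theorem flowTM_inc {s : T} {r : ℕ} {s' : T} (hs : nd s = .inc r s') (b : ℕ) (l l' : List Bool)
    (W : TapeName (Fin (R + 1)) → List Bool) (hW : W (regTape R r) = l ++ l')
    (hb : (l ++ l').length + 1 < b) :
    SpacePath (flowTM nd start R) b
      (flowCfg nd start R (s, none) W (regTape R r) l.length)
      (flowCfg nd start R (s', none) (Function.update W (regTape R r) (l ++ incBits l'))
        (regTape R r) 0) := by
  have hr : (nd s).reg = r := by rw [hs]; rfl
  have hv : (nd s).verdict = none := by rw [hs]; rfl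
  have hlen : l.length + l'.length + 1 < b := by simpa using hb
  clear hb
  subst hr
  induction l' generalizing l W with
  | nil =>
    refine .head (flowCfg_head_le _ _ _ (by simp; omega))
      (flowTM_step nd start R s none W _ (l ++ [true]) (fun _ => hv)
        ((s, some s'), some (.inl true), 0) ?_ ?_) ?_
    · rw [hW, List.append_nil, wordTape_length, hs]; rfl
    · intro y; rw [hW, List.append_nil]; exact wordTape_append_singleton l true y
    · have := flowTM_back nd start R s s' (Function.update W (regTape R (nd s).reg) (l ++ [true]))
        (l.length + 1) b (by simp) (by simp at hlen; omega) (by omega)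
      simpa [incBits] using this
  | cons a l' ih =>
    cases a with
    | false =>
      refine .head (flowCfg_head_le _ _ _ (by simp; omega))
        (flowTM_step nd start R s none W _ (l ++ true :: l') (fun _ => hv)
          ((s, some s'), some (.inl true), 0) ?_ ?_) ?_
      · rw [hW, wordTape_length_append, hs]; rfl
      · intro y; rw [hW]; exact wordTape_append_cons l l' false true y
      · have := flowTM_back nd start R s s'
          (Function.update W (regTape R (nd s).reg) (l ++ true :: l'))
          (l.length + 1) b (by simp) (by simp at hlen; omega) (by omega)
        simpa [incBits] using this
    | true =>
      refine .head (flowCfg_head_le _ _ _ (by simp; omega))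
        (flowTM_step nd start R s none W _ (l ++ false :: l') (fun _ => hv)
          ((s, none), some (.inl false), 1) ?_ ?_) ?_
      · rw [hW, wordTape_length_append, hs]; rfl
      · intro y; rw [hW]; exact wordTape_append_cons l l' true false y
      · have := ih (l ++ [false])
          (Function.update W (regTape R (nd s).reg) (l ++ false :: l')) 
          (by simp at hlen ⊢; omega) (by simp)
        simpa [incBits] using this

theorem flowTM_dec {s : T} {r : ℕ} {s' : T} (hs : nd s = .dec r s') (b : ℕ) (l l' : List Bool)
    (W : TapeName (Fin (R + 1)) → List Bool) (hW : W (regTape R r) = l ++ l')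
    (hb : (l ++ l').length + 1 < b) (hne : bitsVal l' ≠ 0) :
    SpacePath (flowTM nd start R) b
      (flowCfg nd start R (s, none) W (regTape R r) l.length)
      (flowCfg nd start R (s', none) (Function.update W (regTape R r) (l ++ decBits l'))
        (regTape R r) 0) := by
  have hr : (nd s).reg = r := by rw [hs]; rfl
  have hv : (nd s).verdict = none := by rw [hs]; rfl
  have hlen : l.length + l'.length + 1 < b := by simpa using hb
  clear hb
  subst hr
  induction l' generalizing l W with
  | nil => exact absurd rfl hne
  | cons a l' ih =>
    cases a with
    | true =>
      refine .head (flowCfg_head_le _ _ _ (by simp; omega))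
        (flowTM_step nd start R s none W _ (l ++ false :: l') (fun _ => hv)
          ((s, some s'), some (.inl false), 0) ?_ ?_) ?_
      · rw [hW, wordTape_length_append, hs]; rfl
      · intro y; rw [hW]; exact wordTape_append_cons l l' true false y
      · have := flowTM_back nd start R s s'
          (Function.update W (regTape R (nd s).reg) (l ++ false :: l'))
          (l.length + 1) b (by simp) (by simp at hlen; omega) (by omega)
        simpa [decBits] using this
    | false =>
      refine .head (flowCfg_head_le _ _ _ (by simp; omega))
        (flowTM_step nd start R s none W _ (l ++ true :: l') (fun _ => hv)
          ((s, none), some (.inl true), 1) ?_ ?_) ?_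
      · rw [hW, wordTape_length_append, hs]; rfl
      · intro y; rw [hW]; exact wordTape_append_cons l l' false true y
      · have := ih (l ++ [true])
          (Function.update W (regTape R (nd s).reg) (l ++ true :: l')) 
          (by simpa [bitsVal] using hne) (by simp at hlen ⊢; omega) (by simp)
        simpa [decBits] using this

theorem flowTM_test {s : T} {r : ℕ} {z s' : T} (hs : nd s = .test r z s') (b : ℕ)
    (l l' : List Bool)
    (W : TapeName (Fin (R + 1)) → List Bool) (hW : W (regTape R r) = l ++ l')
    (hb : (l ++ l').length + 1 < b) :
    SpacePath (flowTM nd start R) b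
      (flowCfg nd start R (s, none) W (regTape R r) l.length)
      (flowCfg nd start R (if bitsVal l' = 0 then z else s', none) W (regTape R r) 0) := by
  have hr : (nd s).reg = r := by rw [hs]; rfl
  have hv : (nd s).verdict = none := by rw [hs]; rfl
  have hlen : l.length + l'.length + 1 < b := by simpa using hb
  clear hb
  subst hr
  have same : ∀ (y y' : ℤ) (a), OracleTM.wordTape (W (regTape R (nd s).reg)) y' = a →
      (if y = y' then a else OracleTM.wordTape (Aux := Empty) (W (regTape R (nd s).reg)) y)
      = OracleTM.wordTape (W (regTape R (nd s).reg)) y := by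
    intro y y' a h
    split_ifs with h'
    · rw [h', h]
    · rfl
  induction l' generalizing l with
  | nil =>
    have h0 : OracleTM.wordTape (Aux := Empty) (W (regTape R (nd s).reg)) l.length = none := by
      rw [hW, List.append_nil, wordTape_length]
    refine .head (flowCfg_head_le _ _ _ (by simp; omega))
      (flowTM_step nd start R s none W _ (W (regTape R (nd s).reg)) (fun _ => hv)
        ((s, some z), none, -1) ?_ (fun y => same y _ _ h0)) ?_
    · rw [h0, hs]; rfl
    · have := flowTM_back nd start R s z W l.length b (by simp [hW]) (by simp at hlen; omega)
        (by omega)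
      simpa [bitsVal, sub_eq_add_neg] using this
  | cons a l' ih =>
    have h0 : OracleTM.wordTape (Aux := Empty) (W (regTape R (nd s).reg)) l.length
        = some (.inl a) := by
      rw [hW, wordTape_length_append]
    cases a with
    | true =>
      refine .head (flowCfg_head_le _ _ _ (by simp; omega))
        (flowTM_step nd start R s none W _ (W (regTape R (nd s).reg)) (fun _ => hv)
          ((s, some s'), some (.inl true), 0) ?_ (fun y => same y _ _ h0)) ?_
      · rw [h0, hs]; rfl
      · have := flowTM_back nd start R s s' W (l.length + 1) b (by simp [hW]) (by omega)
          (by omega)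
        simpa [bitsVal] using this
    | false =>
      refine .head (flowCfg_head_le _ _ _ (by simp; omega))
        (flowTM_step nd start R s none W _ (W (regTape R (nd s).reg)) (fun _ => hv)
          ((s, none), some (.inl false), 1) ?_ (fun y => same y _ _ h0)) ?_
      · rw [h0, hs]; rfl
      · have := ih (l ++ [false]) (by simp at hlen ⊢; omega) (by simp [hW])
        simpa [bitsVal] using this

theorem flowTM_extend {s : T} {r : ℕ} {s' : T} (hs : nd s = .extend r s') (b : ℕ)
    (l l' : List Bool)
    (W : TapeName (Fin (R + 1)) → List Bool) (hW : W (regTape R r) = l ++ l')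
    (hb : (l ++ l').length + 1 < b) :
    SpacePath (flowTM nd start R) b
      (flowCfg nd start R (s, none) W (regTape R r) l.length)
      (flowCfg nd start R (s', none) (Function.update W (regTape R r) (l ++ l' ++ [true]))
        (regTape R r) 0) := by
  have hr : (nd s).reg = r := by rw [hs]; rfl
  have hv : (nd s).verdict = none := by rw [hs]; rfl
  have hlen : l.length + l'.length + 1 < b := by simpa using hb
  clear hb
  subst hr
  induction l' generalizing l with
  | nil =>
    refine .head (flowCfg_head_le _ _ _ (by simp; omega))
      (flowTM_step nd start R s none W _ (l ++ [true]) (fun _ => hv)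
        ((s, some s'), some (.inl true), 0) ?_ ?_) ?_
    · rw [hW, List.append_nil, wordTape_length, hs]; rfl
    · intro y; rw [hW, List.append_nil]; exact wordTape_append_singleton l true y
    · have := flowTM_back nd start R s s' (Function.update W (regTape R (nd s).reg) (l ++ [true]))
        (l.length + 1) b (by simp) (by simp at hlen; omega) (by omega)
      simpa using this
  | cons a l' ih =>
    have h0 : OracleTM.wordTape (Aux := Empty) (W (regTape R (nd s).reg)) l.length
        = some (.inl a) := by
      rw [hW, wordTape_length_append]
    refine .head (flowCfg_head_le _ _ _ (by simp; omega))
      (flowTM_step nd start R s none W _ (W (regTape R (nd s).reg)) (fun _ => hv)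
        ((s, none), some (.inl a), 1) ?_ ?_) ?_
    · rw [h0, hs]; rfl
    · intro y
      dsimp only
      split_ifs with h'
      · rw [h', h0]
      · rfl
    · have := ih (l ++ [a]) (by simp at hlen ⊢; omega) (by simp [hW])
      simpa using this

/-- The tapes hold the registers, in at most `L` cells each. -/
def Holds (L : ℕ) (W : TapeName (Fin (R + 1)) → List Bool) (σ : ℕ → ℕ) : Prop :=
  (∀ r < R + 1, bitsVal (W (regTape R r)) = σ r) ∧ ∀ i, (W i).length ≤ L

variable {nd start R}

theorem Holds.update {L : ℕ} {W : TapeName (Fin (R + 1)) → List Bool} {σ : ℕ → ℕ}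
    (h : Holds R L W σ) {r : ℕ} (hr : r < R + 1) (l : List Bool) (hl : l.length ≤ L) :
    Holds R L (Function.update W (regTape R r) l) (Function.update σ r (bitsVal l)) := by
  refine ⟨fun r' hr' => ?_, fun i => ?_⟩
  · by_cases h1 : r' = r
    · subst h1; simp
    · rw [Function.update_of_ne h1, Function.update_of_ne (fun h' => h1 (regTape_inj hr' hr h'))]
      exact h.1 r' hr'
  · by_cases h1 : i = regTape R r
    · subst h1; simpa using hl
    · rw [Function.update_of_ne h1]; exact h.2 i

/-- All counters fit into `L` cells because values stay at most `b`; the two extra cells leave room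
for the head beyond the ends of the word. -/
theorem FlowStep.spacePath {L b : ℕ} (hL : Nat.size b ≤ L) (hreg : ∀ s, (nd s).reg < R + 1)
    {c c' : T × (ℕ → ℕ)} (h : FlowStep nd b c c') {W : TapeName (Fin (R + 1)) → List Bool}
    (hW : Holds R L W c.2) :
    ∃ W', Holds R L W' c'.2 ∧ SpacePath (flowTM nd start R) (L + 2)
      (flowCfg nd start R (c.1, none) W .input 0) (flowCfg nd start R (c'.1, none) W' .input 0) := by
  have hlen : ∀ r, ([] ++ W (regTape R r)).length + 1 < L + 2 := fun r => by
    have := hW.2 (regTape R r)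
    simp; omega
  cases h with
  | @inc s r s' σ hs hb =>
    have hr : r < R + 1 := by have := hreg s; rwa [hs] at this
    have hv := hW.1 r hr
    have h1 := flowTM_inc nd start R hs (L + 2) [] _ W rfl (hlen r)
    have h2 := hW.update hr (incBits (W (regTape R r)))
      (length_incBits_le hL (hW.2 _) (by rw [hv]; exact hb))
    rw [bitsVal_incBits, hv] at h2
    refine ⟨_, h2, ?_⟩
    rw [flowCfg_zero _ _ _ _ (regTape R r), flowCfg_zero nd start R (s := (s', none)) _ (regTape R r)]
    simpa using h1
  | @dec s r s' σ hs hb =>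
    have hr : r < R + 1 := by have := hreg s; rwa [hs] at this
    have hv := hW.1 r hr
    have h1 := flowTM_dec nd start R hs (L + 2) [] _ W rfl (hlen r) (by rw [hv]; exact hb)
    have h2 := hW.update hr (decBits (W (regTape R r))) (by rw [length_decBits]; exact hW.2 _)
    rw [bitsVal_decBits _ (by rw [hv]; exact hb), hv] at h2
    refine ⟨_, h2, ?_⟩
    rw [flowCfg_zero _ _ _ _ (regTape R r), flowCfg_zero nd start R (s := (s', none)) _ (regTape R r)]
    simpa using h1
  | @test_zero s r z s' σ hs hb =>
    have hr : r < R + 1 := by have := hreg s; rwa [hs] at this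
    have hv := hW.1 r hr
    have h1 := flowTM_test nd start R hs (L + 2) [] _ W rfl (hlen r)
    rw [if_pos (hv.trans hb)] at h1
    refine ⟨_, hW, ?_⟩
    rw [flowCfg_zero _ _ _ _ (regTape R r), flowCfg_zero nd start R (s := (z, none)) _ (regTape R r)]
    simpa using h1
  | @test_succ s r z s' σ hs hb =>
    have hr : r < R + 1 := by have := hreg s; rwa [hs] at this
    have hv := hW.1 r hr
    have h1 := flowTM_test nd start R hs (L + 2) [] _ W rfl (hlen r)
    rw [if_neg (by rw [hv]; exact hb)] at h1
    refine ⟨_, hW, ?_⟩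
    rw [flowCfg_zero _ _ _ _ (regTape R r), flowCfg_zero nd start R (s := (s', none)) _ (regTape R r)]
    simpa using h1

open Relation in
theorem spacePath_of_reflTransGen {L b : ℕ} (hL : Nat.size b ≤ L)
    (hreg : ∀ s, (nd s).reg < R + 1)
    {c c' : T × (ℕ → ℕ)} (h : ReflTransGen (FlowStep nd b) c c')
    {W : TapeName (Fin (R + 1)) → List Bool} (hW : Holds R L W c.2) :
    ∃ W', Holds R L W' c'.2 ∧ SpacePath (flowTM nd start R) (L + 2)
      (flowCfg nd start R (c.1, none) W .input 0) (flowCfg nd start R (c'.1, none) W' .input 0) := by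
  induction h with
  | refl => exact ⟨W, hW, .refl (flowCfg_head_le _ _ _ (by simp))⟩
  | tail _ h2 ih =>
    obtain ⟨W1, hW1, h1⟩ := ih
    obtain ⟨W2, hW2, h3⟩ := h2.spacePath (start := start) hL hreg hW1
    exact ⟨W2, hW2, h1.trans h3⟩

end FlowTM

/-- The flow chart of a decision program: it first completes the input tape, and finally inspects
register `o`. -/
def decider (p : Prog) (o : ℕ) : Option p.St ⊕ Option Bool → Node (Option p.St ⊕ Option Bool)
  | .inl (some s) => (p.node s).map Sum.inl
  | .inl none => .test o (.inr (some false)) (.inr (some true))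
  | .inr none => .extend 0 (.inl (some p.entry))
  | .inr (some v) => .halt v

/-- The number of a word: its bits followed by `1`, least significant bit first. -/
def wordNum (x : List Bool) : ℕ := bitsVal (x ++ [true])

/-- A set of words that is decided by a program within register bounds of `O(t(n))` bits is
computable in space `O(t(n))`. -/
theorem computableInSpace_of_prog {A : Set (List Bool)} {t : ℕ → ℕ} (p : Prog) (o : ℕ)
    (b : List Bool → ℕ) (c : ℕ) (hb : ∀ x, Nat.size (b x) ≤ c * t x.length + c)
    (hlen : ∀ x : List Bool, x.length ≤ c * t x.length + c)
    (h : ∀ x, ∃ σ', Exec (b x) p (Function.update 0 0 (wordNum x)) σ' ∧ (x ∈ A ↔ σ' o ≠ 0)) :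
    ComputableInSpace A t := by
  have := p.finite_St
  set R := max p.top o with hR
  set M := flowTM (decider p o) (.inr none) R with hM
  have hreg : ∀ s, ((decider p o) s).reg < R + 1 := by
    rintro ((_ | s) | (_ | v))
    · simp [decider, Node.reg]; omega
    · have := p.reg_node_lt s; simp [decider]; omega
    · simp [decider, Node.reg]
    · simp [decider, Node.reg]
  have main : ∀ x : List Bool, ∃ v W, SpacePath M (c * t x.length + c + 1 + 2) (M.init [] x)
      (flowCfg (decider p o) (.inr none) R (.inr (some v), none) W .input 0) ∧
        (x ∈ A ↔ v = true) := by
    intro x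
    obtain ⟨σ', he, hA⟩ := h x
    have he' := he.flow (decider p o) Sum.inl (fun s => rfl)
    have hinit : M.init [] x = flowCfg (decider p o) (.inr none) R (.inr none, none)
        (Function.update (fun _ => []) .input x) .input 0 := by
      unfold OracleTM.init flowCfg
      congr 1
      · refine funext fun (i : TapeName (Fin (R + 1))) => funext fun z => ?_
        have hblank : ∀ i : TapeName (Fin (R + 1)), i ≠ .input → (none : TapeSymbol Empty) =
            OracleTM.wordTape (Function.update (fun _ => []) TapeName.input x i) z := by
          intro i hi
          simp [Function.update_of_ne hi, OracleTM.wordTape]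
        cases i with
        | program => exact (by simp [OracleTM.wordTape] :
            OracleTM.wordTape (Aux := Empty) [] z = none).trans (hblank .program (by simp))
        | input => exact (by simp : OracleTM.wordTape (Aux := Empty) x z =
            OracleTM.wordTape (Function.update (fun _ => []) TapeName.input x .input) z)
        | query => exact hblank .query (by simp)
        | output => exact hblank .output (by simp)
        | work w => exact hblank (.work w) (by simp)
      · refine funext fun (i : TapeName (Fin (R + 1))) => ?_
        simp
    have h0 : regTape R 0 = .input := rfl
    -- Appending a leading 1 to the input makes the word recoverable from its number, including its
    -- length and its trailing zeros.
    have h1 := flowTM_extend (decider p o) (.inr none) R (s := .inr none) rfl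
      (c * t x.length + c + 1 + 2) [] x (Function.update (fun _ => []) .input x)
      (by simp [h0]) (by have := hlen x; simp; omega)
    rw [h0] at h1
    have hH : Holds R (c * t x.length + c + 1)
        (Function.update (Function.update (fun _ => []) .input x) .input ([] ++ x ++ [true]))
        (Function.update (0 : ℕ → ℕ) 0 (wordNum x)) := by
      have h2 : Holds R (c * t x.length + c + 1) (Function.update (fun _ => []) .input x)
          (Function.update (0 : ℕ → ℕ) 0 (bitsVal x)) := by
        have h3 : Holds R (c * t x.length + c + 1) (fun _ => []) (0 : ℕ → ℕ) :=
          ⟨fun _ _ => rfl, fun _ => by simp⟩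
        exact h3.update (r := 0) (by omega) x (by have := hlen x; omega)
      have := h2.update (r := 0) (by omega) ([] ++ x ++ [true]) (by have := hlen x; simp; omega)
      simpa [wordNum, h0] using this
    have htest : Relation.ReflTransGen (FlowStep (decider p o) (b x))
        (.inl (some p.entry), Function.update 0 0 (wordNum x))
        (.inr (some (if σ' o = 0 then false else true)), σ') := by
      refine he'.tail ?_
      by_cases h3 : σ' o = 0
      · rw [if_pos h3]; exact .test_zero _ rfl h3
      · rw [if_neg h3]; exact .test_succ _ rfl h3
    obtain ⟨W', -, h4⟩ := spacePath_of_reflTransGen (L := c * t x.length + c + 1)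
      (start := .inr none) (by have := hb x; omega) hreg htest hH
    refine ⟨if σ' o = 0 then false else true, W', ?_, ?_⟩
    · rw [hinit]
      refine SpacePath.trans ?_ h4
      simpa using h1
    · rw [hA]; split_ifs <;> simp_all
  refine ⟨M, c + 3, fun x => ?_⟩
  obtain ⟨v, W, ⟨n, hn, hs⟩, hA⟩ := main x
  have hv : M.verdictAt ∅ [] x n = some v := by
    unfold OracleTM.verdictAt OracleTM.run
    rw [hn]; rfl
  refine ⟨fun hx => ⟨n, by rw [hv, hA.1 hx]⟩, fun hx => ⟨n, ?_⟩, fun s i => ?_⟩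
  · rw [hv]
    cases v
    · rfl
    · exact absurd (hA.2 rfl) hx
  · have hbd : c * t x.length + c + 1 + 2 ≤ (c + 3) * t x.length + (c + 3) := by
      have : c * t x.length ≤ (c + 3) * t x.length := Nat.mul_le_mul_right _ (by omega)
      omega
    refine le_trans ?_ hbd
    rcases le_total s n with h1 | h1
    · exact hs s h1 i
    · obtain ⟨m, rfl⟩ := Nat.exists_eq_add_of_le h1
      unfold OracleTM.run
      rw [add_comm, Function.iterate_add_apply, hn]
      -- A halted configuration is a fixed point, so the space bound extends to all later times.
      have hfix : ∀ m, (M.step ∅)^[m]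
          (flowCfg (decider p o) (.inr none) R (.inr (some v), none) W .input 0) =
          flowCfg (decider p o) (.inr none) R (.inr (some v), none) W .input 0 := by
        intro m
        induction m with
        | zero => rfl
        | succ m ih =>
          rw [Function.iterate_succ_apply', ih]
          rfl
      rw [hfix]
      exact flowCfg_head_le _ _ _ (by simp) i

/-! ### Functions computable in linear space -/

/-- A coding of a type by finitely many registers. -/
class Coded (α : Type) : Type 1 where
  /-- the registers -/
  Reg : Type
  [fin : Finite Reg]
  /-- the contents of the registers -/
  code : α → Reg → ℕ
  inj : Function.Injective code

open Coded

attribute [instance] Coded.fin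

instance : Coded ℕ where
  Reg := Unit
  code n _ := n
  inj _ _ h := congrFun h ()

instance {α β : Type} [Coded α] [Coded β] : Coded (α × β) where
  Reg := Reg α ⊕ Reg β
  code x := Sum.elim (code x.1) (code x.2)
  inj x y h := by
    refine Prod.ext (inj ?_) (inj ?_)
    · funext r; exact congrFun h (Sum.inl r)
    · funext r; exact congrFun h (Sum.inr r)

instance {ι β : Type} [Finite ι] [Coded β] : Coded (ι → β) where
  Reg := ι × Reg β
  code f r := code (f r.1) r.2
  inj f g h := by
    funext i
    refine inj ?_
    funext r
    exact congrFun h (i, r)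

variable {α β γ : Type} [Coded α] [Coded β] [Coded γ]

/-- All registers of `a` are at most `B`. -/
def Below (a : α) (B : ℕ) : Prop := ∀ r, code a r ≤ B

theorem Below.mono {a : α} {B B' : ℕ} (h : Below a B) (hB : B ≤ B') : Below a B' :=
  fun r => (h r).trans hB

@[simp] theorem below_nat {n B : ℕ} : Below n B ↔ n ≤ B :=
  ⟨fun h => h (), fun h _ => h⟩

@[simp] theorem below_prod {x : α × β} {B : ℕ} : Below x B ↔ Below x.1 B ∧ Below x.2 B :=
  ⟨fun h => ⟨fun r => h (.inl r), fun r => h (.inr r)⟩, fun h r => by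
    cases r with
    | inl r => exact h.1 r
    | inr r => exact h.2 r⟩

theorem below_pi {ι : Type} [Finite ι] {f : ι → β} {B : ℕ} :
    Below f B ↔ ∀ i, Below (f i) B :=
  ⟨fun h i r => h (i, r), fun h r => h r.1 r.2⟩

/-- The program `p` computes `f` from the registers `src` to the registers `dst`, with the
registers from `m` on as work space that is empty before and after, and with all registers
polynomially bounded. -/
def Computes (f : α → β) (src : Reg α → ℕ) (dst : Reg β → ℕ) (m : ℕ) (p : Prog) (c : ℕ) : Prop :=
  ∀ (a : α) (σ : ℕ → ℕ) (B : ℕ), (∀ r, σ (src r) = code a r) → (∀ r, m ≤ r → σ r = 0) →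
    Below a B → ∃ σ', Exec ((B + 2) ^ c) p σ σ' ∧ (∀ r, σ' (dst r) = code (f a) r) ∧
      ∀ x, x ∉ Set.range dst → σ' x = σ x

/-- Functions that are computed by programs with polynomially bounded registers, that is, in
linear space. -/
@[fun_prop]
def LS (f : α → β) : Prop :=
  (∃ c, ∀ a B, Below a B → Below (f a) ((B + 2) ^ c)) ∧
    ∀ (src : Reg α → ℕ) (dst : Reg β → ℕ) (m : ℕ), (∀ r, src r < m) → (∀ r, dst r < m) →
      Function.Injective dst → (∀ r r', src r ≠ dst r') → ∃ p c, Computes f src dst m p c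

/-- Bounds have the base `B + 2` rather than `B` so that constants and sums are absorbed by a larger
exponent. This makes polynomial bounds stable under composition without side conditions. -/
theorem pow_bound_comp (B c d : ℕ) : ((B + 2) ^ c + 2) ^ d ≤ (B + 2) ^ ((c + 2) * d) := by
  rw [pow_mul]
  refine Nat.pow_le_pow_left ?_ d
  have h1 : 1 ≤ (B + 2) ^ c := Nat.one_le_pow _ _ (by omega)
  have h2 : (B + 2) ^ (c + 2) = (B + 2) ^ c * ((B + 2) * (B + 2)) := by ring
  have h3 : 2 * 2 ≤ (B + 2) * (B + 2) := Nat.mul_le_mul (by omega) (by omega)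
  rw [h2]
  nlinarith

theorem pow_bound_mono (B : ℕ) {c d : ℕ} (h : c ≤ d) : (B + 2) ^ c ≤ (B + 2) ^ d :=
  Nat.pow_le_pow_right (by omega) h

theorem le_pow_bound (B : ℕ) {c : ℕ} (h : 1 ≤ c) : B ≤ (B + 2) ^ c :=
  (show B ≤ (B + 2) ^ 1 by rw [pow_one]; omega).trans (pow_bound_mono B h)

theorem Exec.clear {b r : ℕ} (σ : ℕ → ℕ) :
    Exec b (.loop r (.dec r)) σ (Function.update σ r 0) := by
  obtain ⟨n, hn⟩ : ∃ n, σ r = n := ⟨_, rfl⟩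
  induction n generalizing σ with
  | zero =>
    have : Function.update σ r 0 = σ := by rw [← hn]; simp
    rw [this]
    exact .loop_zero hn
  | succ n ih =>
    refine .loop_succ (by omega) (.dec r σ (by omega)) ?_
    have := ih (Function.update σ r (σ r - 1)) (by simp [hn])
    simpa using this

/-- A program that clears all registers of a list. -/
def clearAll (l : List ℕ) : Prog := l.foldr (fun r p => .seq (.loop r (.dec r)) p) .skip

theorem Exec.clearAll {b : ℕ} (l : List ℕ) (σ : ℕ → ℕ) :
    Exec b (clearAll l) σ (fun x => if x ∈ l then 0 else σ x) := by
  induction l generalizing σ with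
  | nil => exact Exec.skip σ
  | cons r l ih =>
    refine .seq (.clear σ) ?_
    have h := ih (Function.update σ r 0)
    have h' : (fun x => if x ∈ l then 0 else Function.update σ r 0 x) =
        fun x => if x ∈ r :: l then 0 else σ x := ?_
    · rw [← h']; exact h
    funext x
    by_cases h1 : x ∈ l <;> by_cases h2 : x = r <;> simp [h1, h2]

/-- A program that moves register `s` to `d` and `t`. -/
theorem Exec.move {b s d t : ℕ} (hsd : s ≠ d) (hst : s ≠ t) (hdt : d ≠ t) (σ : ℕ → ℕ)
    (hd : σ d + σ s ≤ b) (ht : σ t + σ s ≤ b) :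
    Exec b (.loop s (.seq (.dec s) (.seq (.inc d) (.inc t)))) σ
      (Function.update (Function.update (Function.update σ d (σ d + σ s)) t (σ t + σ s)) s 0) := by
  obtain ⟨n, hn⟩ : ∃ n, σ s = n := ⟨_, rfl⟩
  induction n generalizing σ with
  | zero =>
    have : Function.update (Function.update (Function.update σ d (σ d + σ s)) t (σ t + σ s)) s 0
        = σ := by
      funext x
      by_cases h1 : x = s
      · subst h1; simp [hn]
      · by_cases h2 : x = t
        · subst h2; simp [hn, h1]
        · by_cases h3 : x = d
          · subst h3; simp [hn, h1, h2]
          · simp [h1, h2, h3]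
    rw [this]
    exact .loop_zero hn
  | succ n ih =>
    set τ := Function.update (Function.update (Function.update σ s (σ s - 1)) d (σ d + 1)) t
      (σ t + 1) with hτ
    have e1 : Exec b (.seq (.dec s) (.seq (.inc d) (.inc t))) σ τ := by
      refine .seq (.dec s σ (by omega)) (.seq (.inc d _ ?_) ?_)
      · simp [hsd.symm]; omega
      · have := Exec.inc (b := b) t (Function.update (Function.update σ s (σ s - 1)) d
          (Function.update σ s (σ s - 1) d + 1)) (by simp [hst.symm, hdt.symm]; omega)
        simpa [hτ, hsd.symm, hst.symm, hdt.symm] using this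
    refine .loop_succ (by omega) e1 ?_
    have hs' : τ s = n := by simp [hτ, hst, hsd, hn]
    have hd' : τ d = σ d + 1 := by simp [hτ, hdt]
    have ht' : τ t = σ t + 1 := by simp [hτ]
    have := ih τ (by rw [hd', hs']; omega) (by rw [ht', hs']; omega) hs'
    convert this using 1
    funext x
    by_cases h1 : x = s
    · subst h1; simp
    · by_cases h2 : x = t
      · subst h2; simp [h1, ht', hs', hn]; omega
      · by_cases h3 : x = d
        · subst h3; simp [h1, h2, hd', hs', hn]; omega
        · simp [h1, h2, h3, hτ]

/-- A program that copies register `s` to `d`, using the empty register `t`. -/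
def copyProg (s d t : ℕ) : Prog :=
  .seq (.loop d (.dec d)) (.seq (.loop s (.seq (.dec s) (.seq (.inc d) (.inc t))))
    (.loop t (.seq (.dec t) (.inc s))))

theorem Exec.transfer {b s t : ℕ} (hst : s ≠ t) (σ : ℕ → ℕ) (ht : σ t + σ s ≤ b) :
    Exec b (.loop s (.seq (.dec s) (.inc t))) σ
      (Function.update (Function.update σ t (σ t + σ s)) s 0) := by
  obtain ⟨n, hn⟩ : ∃ n, σ s = n := ⟨_, rfl⟩
  induction n generalizing σ with
  | zero =>
    have : Function.update (Function.update σ t (σ t + σ s)) s 0 = σ := by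
      funext x
      by_cases h1 : x = s
      · subst h1; simp [hn]
      · by_cases h2 : x = t
        · subst h2; simp [hn, h1]
        · simp [h1, h2]
    rw [this]
    exact .loop_zero hn
  | succ n ih =>
    set τ := Function.update (Function.update σ s (σ s - 1)) t (σ t + 1) with hτ
    have e1 : Exec b (.seq (.dec s) (.inc t)) σ τ := by
      refine .seq (.dec s σ (by omega)) ?_
      have := Exec.inc (b := b) t (Function.update σ s (σ s - 1)) (by simp [hst.symm]; omega)
      simpa [hτ, hst.symm] using this
    refine .loop_succ (by omega) e1 ?_
    have hs' : τ s = n := by simp [hτ, hst, hn]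
    have ht' : τ t = σ t + 1 := by simp [hτ]
    have := ih τ (by rw [ht', hs']; omega) hs'
    convert this using 1
    funext x
    by_cases h1 : x = s
    · subst h1; simp
    · by_cases h2 : x = t
      · subst h2; simp [h1, ht', hs', hn]; omega
      · simp [h1, h2, hτ]

theorem Exec.copy {b s d t : ℕ} (hsd : s ≠ d) (hst : s ≠ t) (hdt : d ≠ t) (σ : ℕ → ℕ)
    (ht : σ t = 0) (hb : σ s ≤ b) : Exec b (copyProg s d t) σ (Function.update σ d (σ s)) := by
  set τ := Function.update σ d 0 with hτ
  have hs1 : τ s = σ s := by simp [hτ, hsd]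
  have hd1 : τ d = 0 := by simp [hτ]
  have ht1 : τ t = 0 := by simp [hτ, hdt.symm, ht]
  refine .seq (.clear σ) (.seq (.move hsd hst hdt τ (by omega) (by omega)) ?_)
  convert Exec.transfer (b := b) hst.symm _ ?_ using 1
  · funext x
    by_cases h1 : x = s
    · subst h1; simp [hst, hst.symm, hsd, hs1, ht1]
    · by_cases h2 : x = t
      · subst h2; simp [h1, hdt.symm, ht]
      · by_cases h3 : x = d
        · subst h3; simp [h1, h2, hs1, hd1]
        · simp [h1, h2, h3, hτ]
  · simp [hst.symm, hs1, ht1, hb]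

/-- A program that copies a list of registers. -/
theorem exists_copies (l : List (ℕ × ℕ)) (t : ℕ) (hd : (l.map Prod.snd).Nodup)
    (hsd : ∀ x ∈ l, ∀ y ∈ l, x.1 ≠ y.2) (ht : ∀ x ∈ l, x.1 ≠ t ∧ x.2 ≠ t) :
    ∃ p, ∀ (σ : ℕ → ℕ) (b : ℕ), σ t = 0 → (∀ x ∈ l, σ x.1 ≤ b) →
      ∃ σ', Exec b p σ σ' ∧ (∀ x ∈ l, σ' x.2 = σ x.1) ∧ ∀ y, y ∉ l.map Prod.snd → σ' y = σ y := by
  induction l with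
  | nil => exact ⟨.skip, fun σ b _ _ => ⟨σ, .skip σ, by simp, by simp⟩⟩
  | cons x l ih =>
    obtain ⟨p, hp⟩ := ih (List.Nodup.of_cons (by simpa using hd))
      (fun y hy z hz => hsd y (by simp [hy]) z (by simp [hz])) (fun y hy => ht y (by simp [hy]))
    have hx := ht x (by simp)
    refine ⟨.seq (copyProg x.1 x.2 t) p, fun σ b h0 hb => ?_⟩
    have e1 := Exec.copy (b := b) (hsd x (by simp) x (by simp)) hx.1 hx.2 σ h0 (hb x (by simp))
    have hkeep : ∀ y ∈ l, Function.update σ x.2 (σ x.1) y.1 = σ y.1 := fun y hy =>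
      Function.update_of_ne (hsd y (by simp [hy]) x (by simp)) _ _
    obtain ⟨σ', e2, h1, h2⟩ := hp (Function.update σ x.2 (σ x.1)) b
      (by rw [Function.update_of_ne hx.2.symm]; exact h0)
      (fun y hy => by rw [hkeep y hy]; exact hb y (by simp [hy]))
    have hnd : x.2 ∉ l.map Prod.snd := by
      have := List.nodup_cons.1 (by simpa using hd : (x.2 :: l.map Prod.snd).Nodup)
      exact this.1
    refine ⟨σ', .seq e1 e2, fun y hy => ?_, fun y hy => ?_⟩
    · rcases List.mem_cons.1 hy with rfl | hy
      · rw [h2 _ hnd, Function.update_self]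
      · rw [h1 y hy, hkeep y hy]
    · have hy' : y ≠ x.2 ∧ y ∉ l.map Prod.snd := by
        constructor
        · rintro rfl; exact hy (by simp)
        · intro h; exact hy (by simp only [List.map_cons, List.mem_cons]; exact Or.inr h)
      rw [h2 y hy'.2, Function.update_of_ne hy'.1]

/-- Selecting registers is computable. -/
theorem LS.of_reg {f : α → β} (φ : Reg β → Reg α) (h : ∀ a r, code (f a) r = code a (φ r)) :
    LS f := by
  refine ⟨⟨1, fun a B hB r => ?_⟩, fun src dst m hs hd hinj hne => ?_⟩
  · rw [h]; exact (hB _).trans (le_pow_bound B le_rfl)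
  have : Fintype (Reg β) := Fintype.ofFinite _
  let l := (Finset.univ : Finset (Reg β)).toList.map fun r => (src (φ r), dst r)
  have hl : ∀ x, x ∈ l ↔ ∃ r, (src (φ r), dst r) = x := by simp [l]
  have hsnd : l.map Prod.snd = (Finset.univ : Finset (Reg β)).toList.map dst := by
    simp [l, Function.comp_def]
  obtain ⟨p, hp⟩ := exists_copies l m
    (by rw [hsnd]; exact (Finset.nodup_toList _).map hinj)
    (by
      intro x hx y hy
      obtain ⟨r, rfl⟩ := (hl x).1 hx
      obtain ⟨r', rfl⟩ := (hl y).1 hy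
      exact hne _ _)
    (by
      intro x hx
      obtain ⟨r, rfl⟩ := (hl x).1 hx
      exact ⟨(hs _).ne, (hd _).ne⟩)
  refine ⟨p, 1, fun a σ B h1 h2 h3 => ?_⟩
  obtain ⟨σ', e, h4, h5⟩ := hp σ ((B + 2) ^ 1) (h2 m le_rfl) (by
    intro x hx
    obtain ⟨r, rfl⟩ := (hl x).1 hx
    rw [h1]
    exact (h3 _).trans (le_pow_bound B le_rfl))
  refine ⟨σ', e, fun r => ?_, fun y hy => h5 y ?_⟩
  · rw [h4 _ ((hl _).2 ⟨r, rfl⟩), h1, h]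
  · rw [hsnd]
    simpa using hy

@[fun_prop] theorem LS.id : LS (fun a : α => a) := .of_reg (fun r => r) fun _ _ => rfl

theorem LS.fst' : LS (fun x : α × β => x.1) := .of_reg Sum.inl fun _ _ => rfl

theorem LS.snd' : LS (fun x : α × β => x.2) := .of_reg Sum.inr fun _ _ => rfl

@[fun_prop] theorem LS.eval {ι : Type} [Finite ι] (i : ι) : LS (fun f : ι → β => f i) :=
  .of_reg (fun r => (i, r)) fun _ _ => rfl

theorem LS.reg (r : Reg α) : LS (fun a : α => code a r) := .of_reg (fun _ => r) fun _ _ => rfl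

/-- A program that adds `n` to a register. -/
def addConst (r : ℕ) : ℕ → Prog
  | 0 => .skip
  | n + 1 => .seq (addConst r n) (.inc r)

theorem Exec.addConst {b r : ℕ} (n : ℕ) (σ : ℕ → ℕ) (h : σ r + n ≤ b) :
    Exec b (addConst r n) σ (Function.update σ r (σ r + n)) := by
  induction n with
  | zero =>
    have h0 : Function.update σ r (σ r + 0) = σ := by simp
    rw [h0]
    exact .skip σ
  | succ n ih =>
    refine .seq (ih (by omega)) ?_
    have := Exec.inc (b := b) r (Function.update σ r (σ r + n)) (by simp; omega)
    simpa [add_assoc] using this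

/-- Running a list of programs that write to disjoint sets of registers. -/
theorem exists_seqAll {ι : Type} (l : List ι) (pr : ι → Prog) (out : ι → Set ℕ) (hl : l.Nodup)
    (hdisj : ∀ i j, i ≠ j → Disjoint (out i) (out j)) :
    ∃ p, ∀ (Inv : (ℕ → ℕ) → Prop) (Post : ι → (ℕ → ℕ) → Prop) (b : ℕ),
      (∀ i ∈ l, ∀ σ, Inv σ → ∃ σ', Exec b (pr i) σ σ' ∧ Post i σ' ∧
        ∀ x, x ∉ out i → σ' x = σ x) →
      (∀ (i : ι) σ σ', Inv σ → (∀ x, (∀ j, x ∉ out j) → σ' x = σ x) → Inv σ') →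
      (∀ (i : ι) σ σ', Post i σ → (∀ x ∈ out i, σ' x = σ x) → Post i σ') →
      ∀ σ, Inv σ → ∃ σ', Exec b p σ σ' ∧ (∀ i ∈ l, Post i σ') ∧
        ∀ x, (∀ i ∈ l, x ∉ out i) → σ' x = σ x := by
  induction l with
  | nil => exact ⟨.skip, fun _ _ _ _ _ _ σ _ => ⟨σ, .skip σ, by simp, by simp⟩⟩
  | cons i l ih =>
    obtain ⟨p, hp⟩ := ih (List.Nodup.of_cons hl)
    have hi := (List.nodup_cons.1 hl).1
    refine ⟨.seq (pr i) p, fun Inv Post b h1 h2 h3 σ hσ => ?_⟩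
    obtain ⟨τ, e1, k1, k2⟩ := h1 i (by simp) σ hσ
    obtain ⟨ρ, e2, k3, k4⟩ := hp Inv Post b (fun j hj => h1 j (by simp [hj])) h2 h3 τ
      (h2 i σ τ hσ fun x hx => k2 x (hx i))
    refine ⟨ρ, .seq e1 e2, fun j hj => ?_, fun x hx => ?_⟩
    · rcases List.mem_cons.1 hj with rfl | hj
      · refine h3 _ τ ρ k1 fun x hx => k4 x fun j' hj' hx' => ?_
        have hne : j ≠ j' := by rintro rfl; exact hi hj'
        exact (Set.disjoint_left.1 (hdisj _ _ hne)) hx hx'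
      · exact k3 j hj
    · rw [k4 x fun j hj => hx j (by simp [hj]), k2 x (hx i (by simp))]

/-- The programs of the components run one after the other. Each writes only to its own registers,
so the input and the empty work space persist. -/
theorem LS.pi {ι : Type} [Finite ι] {f : α → ι → β} (h : ∀ i, LS (fun a => f a i)) : LS f := by
  have : Fintype ι := Fintype.ofFinite _
  refine ⟨?_, fun src dst m hs hd hinj hne => ?_⟩
  · choose c hc using fun i => (h i).1
    refine ⟨∑ i, c i, fun a B hB => below_pi.2 fun i => (hc i a B hB).mono (pow_bound_mono B ?_)⟩
    exact Finset.single_le_sum (f := c) (fun _ _ => Nat.zero_le _) (Finset.mem_univ i)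
  choose p c hp using fun i => (h i).2 src (fun r => dst (i, r)) m hs (fun r => hd _)
    (fun r r' hr => congrArg Prod.snd (hinj hr)) (fun r r' => hne _ _)
  obtain ⟨q, hq⟩ := exists_seqAll (Finset.univ : Finset ι).toList p
    (fun i => Set.range fun r => dst (i, r)) (Finset.nodup_toList _) (by
      intro i j hij
      rw [Set.disjoint_left]
      rintro _ ⟨r, rfl⟩ ⟨r', hr'⟩
      exact hij (congrArg Prod.fst (hinj hr')).symm)
  refine ⟨q, ∑ i, c i, fun a σ B h1 h2 h3 => ?_⟩
  obtain ⟨σ', e, k1, k2⟩ := hq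
    (fun σ => (∀ r, σ (src r) = code a r) ∧ ∀ r, m ≤ r → σ r = 0)
    (fun i σ => ∀ r, σ (dst (i, r)) = code (f a i) r) ((B + 2) ^ ∑ i, c i)
    (by
      rintro i - σ ⟨h1, h2⟩
      obtain ⟨σ', e, k⟩ := hp i a σ B h1 h2 h3
      exact ⟨σ', e.mono (pow_bound_mono B
        (Finset.single_le_sum (f := c) (fun _ _ => Nat.zero_le _) (Finset.mem_univ i))), k⟩)
    (by
      rintro i σ σ' ⟨h1, h2⟩ h4
      refine ⟨fun r => ?_, fun r hr => ?_⟩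
      · rw [h4 _ ?_, h1]
        rintro j ⟨r', hr'⟩
        exact hne _ _ hr'.symm
      · rw [h4 _ ?_, h2 r hr]
        rintro j ⟨r', rfl⟩
        exact absurd hr (not_le.2 (hd _)))
    (by
      intro i σ σ' h4 h5 r
      rw [h5 _ ⟨r, rfl⟩, h4])
    σ ⟨h1, h2⟩
  refine ⟨σ', e, fun r => k1 r.1 (by simp) r.2, fun x hx => k2 x ?_⟩
  rintro i - ⟨r, rfl⟩
  exact hx ⟨_, rfl⟩

@[fun_prop] theorem LS.mk {f : α → β} {g : α → γ} (hf : LS f) (hg : LS g) :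
    LS (fun a => (f a, g a)) := by
  refine ⟨?_, fun src dst m hs hd hinj hne => ?_⟩
  · obtain ⟨c, hc⟩ := hf.1
    obtain ⟨c', hc'⟩ := hg.1
    refine ⟨max c c', fun a B hB => below_prod.2 ⟨?_, ?_⟩⟩
    · exact (hc a B hB).mono (pow_bound_mono B (le_max_left _ _))
    · exact (hc' a B hB).mono (pow_bound_mono B (le_max_right _ _))
  obtain ⟨p, c, hp⟩ := hf.2 src (fun r => dst (.inl r)) m hs (fun _ => hd _)
    (fun r r' h => Sum.inl_injective (hinj h)) (fun _ _ => hne _ _)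
  obtain ⟨p', c', hp'⟩ := hg.2 src (fun r => dst (.inr r)) m hs (fun _ => hd _)
    (fun r r' h => Sum.inr_injective (hinj h)) (fun _ _ => hne _ _)
  refine ⟨.seq p p', max c c', fun a σ B h1 h2 h3 => ?_⟩
  obtain ⟨τ, e1, k1, k2⟩ := hp a σ B h1 h2 h3
  have h1' : ∀ r, τ (src r) = code a r := fun r => by
    rw [k2 _ ?_, h1]
    rintro ⟨r', hr'⟩
    exact hne _ _ hr'.symm
  have h2' : ∀ r, m ≤ r → τ r = 0 := fun r hr => by
    rw [k2 _ ?_, h2 r hr]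
    rintro ⟨r', rfl⟩
    exact absurd hr (not_le.2 (hd _))
  obtain ⟨ρ, e2, k3, k4⟩ := hp' a τ B h1' h2' h3
  refine ⟨ρ, .seq (e1.mono (pow_bound_mono B (le_max_left _ _)))
    (e2.mono (pow_bound_mono B (le_max_right _ _))), fun r => ?_, fun x hx => ?_⟩
  · cases r with
    | inl r =>
      rw [k4 _ ?_, k1]; · rfl
      rintro ⟨r', hr'⟩
      exact absurd (hinj hr') (by simp)
    | inr r => rw [k3]; rfl
  · rw [k4 _ ?_, k2 _ ?_]
    · rintro ⟨r, rfl⟩; exact hx ⟨_, rfl⟩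
    · rintro ⟨r, rfl⟩; exact hx ⟨_, rfl⟩

theorem LS.succ' : LS (fun n : ℕ => n + 1) := by
  refine ⟨⟨1, fun n B h => by simp at h ⊢; omega⟩, fun src dst m hs hd hinj hne => ?_⟩
  refine ⟨.seq (copyProg (src ()) (dst ()) m) (.inc (dst ())), 1, fun n σ B h1 h2 h3 => ?_⟩
  have e1 := Exec.copy (b := (B + 2) ^ 1) (hne () ()) (hs ()).ne (hd ()).ne σ (h2 m le_rfl)
    (by rw [h1]; exact (h3 _).trans (le_pow_bound B le_rfl))
  have hn : σ (src ()) = n := h1 ()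
  have h3' : n ≤ B := h3 ()
  refine ⟨_, .seq e1 (.inc _ _ (by simp [hn]; omega)), fun r => ?_, fun x hx => ?_⟩
  · change Function.update (β := fun _ => ℕ) _ (dst ()) _ (dst ()) = n + 1
    simp [hn]
  · have : x ≠ dst () := by rintro rfl; exact hx ⟨_, rfl⟩
    simp [this]

theorem LS.constNat (n : ℕ) : LS (fun _ : α => n) := by
  refine ⟨⟨n, fun a B h => ?_⟩, fun src dst m hs hd hinj hne => ?_⟩
  · simp only [below_nat]
    exact (Nat.lt_pow_self (by omega)).le
  refine ⟨.seq (.loop (dst ()) (.dec (dst ()))) (addConst (dst ()) n), n,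
    fun a σ B h1 h2 h3 => ?_⟩
  refine ⟨_, .seq (.clear σ) (.addConst n _ ?_), fun r => ?_, fun x hx => ?_⟩
  · simp
    exact (Nat.lt_pow_self (by omega)).le
  · change Function.update (β := fun _ => ℕ) _ (dst ()) _ (dst ()) = n
    simp
  · have : x ≠ dst () := by rintro rfl; exact hx ⟨_, rfl⟩
    simp [this]

/-- Fresh registers for the values of a type. -/
theorem exists_fresh (β : Type) [Coded β] (m : ℕ) : ∃ (tmp : Reg β → ℕ) (m' : ℕ) (l : List ℕ),
    m ≤ m' ∧ (∀ r, m ≤ tmp r) ∧ (∀ r, tmp r < m') ∧ Function.Injective tmp ∧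
      ∀ x, x ∈ l ↔ x ∈ Set.range tmp := by
  have : Fintype (Reg β) := Fintype.ofFinite _
  let e := Fintype.equivFin (Reg β)
  refine ⟨fun r => m + e r, m + Fintype.card (Reg β),
    (Finset.univ : Finset (Reg β)).toList.map fun r => m + e r, by omega,
    fun r => Nat.le_add_right _ _, fun r => Nat.add_lt_add_left (e r).2 m, fun r r' h => ?_, fun x => by simp⟩
  have h : m + (e r : ℕ) = m + (e r' : ℕ) := h
  exact e.injective (Fin.ext (by omega))

-- The intermediate value lives in fresh registers at or above `m`. They are cleared at the end
-- because the work space has to be returned empty.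
@[fun_prop] theorem LS.comp {g : β → γ} {f : α → β} (hg : LS g) (hf : LS f) :
    LS (fun a => g (f a)) := by
  obtain ⟨c1, hc1⟩ := hf.1
  obtain ⟨c2, hc2⟩ := hg.1
  refine ⟨⟨(c1 + 2) * c2, fun a B hB => (hc2 _ _ (hc1 a B hB)).mono (pow_bound_comp B c1 c2)⟩,
    fun src dst m hs hd hinj hne => ?_⟩
  obtain ⟨tmp, m', l, hm, htm, htm', htinj, hl⟩ := exists_fresh β m
  obtain ⟨p, c, hp⟩ := hf.2 src tmp m' (fun r => (hs r).trans_le hm) htm' htinj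
    (fun r r' => ((hs r).trans_le (htm r')).ne)
  obtain ⟨p', c', hp'⟩ := hg.2 tmp dst m' htm' (fun r => (hd r).trans_le hm) hinj
    (fun r r' => ((hd r').trans_le (htm r)).ne')
  refine ⟨.seq p (.seq p' (clearAll l)), max c ((c1 + 2) * c'), fun a σ B h1 h2 h3 => ?_⟩
  obtain ⟨τ, e1, k1, k2⟩ := hp a σ B h1 (fun r hr => h2 r (hm.trans hr)) h3
  obtain ⟨ρ, e2, k3, k4⟩ := hp' (f a) τ _ k1 (fun r hr => by
    rw [k2 _ ?_, h2 r (hm.trans hr)]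
    rintro ⟨r', rfl⟩
    exact absurd hr (not_le.2 (htm' _))) (hc1 a B h3)
  refine ⟨_, .seq (e1.mono (pow_bound_mono B (le_max_left _ _))) (.seq (e2.mono
    ((pow_bound_comp B c1 c').trans (pow_bound_mono B (le_max_right _ _)))) (.clearAll l ρ)),
    fun r => ?_, fun x hx => ?_⟩
  · have : dst r ∉ l := by
      rw [hl]
      rintro ⟨r', hr'⟩
      exact absurd (htm r') (by rw [hr']; exact not_le.2 (hd r))
    simp only [this, if_false]
    exact k3 r
  · by_cases hxl : x ∈ l
    · simp only [hxl, if_true]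
      obtain ⟨r, rfl⟩ := (hl x).1 hxl
      exact (h2 _ (htm r)).symm
    · simp only [hxl, if_false]
      rw [k4 x hx, k2 x (fun h => hxl ((hl x).2 h))]

@[fun_prop] theorem LS.fst {f : α → β × γ} (hf : LS f) : LS (fun a => (f a).1) := LS.fst'.comp hf

@[fun_prop] theorem LS.snd {f : α → β × γ} (hf : LS f) : LS (fun a => (f a).2) := LS.snd'.comp hf

/-- A function is computable if all its registers are. -/
theorem LS.of_code {f : α → β} (h : ∀ r, LS (fun a => code (f a) r)) : LS f := by
  have h1 : LS (fun a r => code (f a) r) := .pi h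
  have h2 := h1.1
  refine ⟨?_, fun src dst m hs hd hinj hne => ?_⟩
  · obtain ⟨c, hc⟩ := h1.1
    exact ⟨c, fun a B hB r => hc a B hB (r, ())⟩
  · obtain ⟨p, c, hp⟩ := h1.2 src (fun r => dst r.1) m hs (fun _ => hd _)
      (fun r r' h => Prod.ext (hinj h) rfl) (fun _ _ => hne _ _)
    refine ⟨p, c, fun a σ B k1 k2 k3 => ?_⟩
    obtain ⟨σ', e, k4, k5⟩ := hp a σ B k1 k2 k3
    refine ⟨σ', e, fun r => k4 (r, ()), fun x hx => k5 x ?_⟩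
    rintro ⟨r, rfl⟩
    exact hx ⟨_, rfl⟩

@[fun_prop] theorem LS.const (b : β) : LS (fun _ : α => b) := .of_code fun _ => .constNat _

@[fun_prop] theorem LS.succ {f : α → ℕ} (hf : LS f) : LS (fun a => f a + 1) := LS.succ'.comp hf

/-- Bounded iteration. -/
theorem LS.iterate {n : α → ℕ} {init : α → β} {step : β → β} (hn : LS n) (hi : LS init)
    (hs : LS step)
    (hb : ∃ c, ∀ a B, Below a B → ∀ i ≤ n a, Below (step^[i] (init a)) ((B + 2) ^ c)) :
    LS (fun a => step^[n a] (init a)) := by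
  -- A common bound for all iterates is indispensable: composing the bound of `step` with itself
  -- would give an exponent that grows with `n a`.
  obtain ⟨c0, hc0⟩ := hb
  refine ⟨⟨c0, fun a B hB => hc0 a B hB _ le_rfl⟩, fun src dst m hsrc hd hinj hne => ?_⟩
  obtain ⟨tmp, m', l, hm, htm, htm', htinj, hl⟩ := exists_fresh β (m + 1)
  obtain ⟨p1, c1, hp1⟩ := hn.2 src (fun _ => m) m' (fun r => (hsrc r).trans_le (by omega))
    (fun _ => by omega) (fun _ _ _ => rfl) (fun r _ => (hsrc r).ne)
  obtain ⟨p2, c2, hp2⟩ := hi.2 src dst m' (fun r => (hsrc r).trans_le (by omega))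
    (fun r => (hd r).trans_le (by omega)) hinj hne
  -- A program may not overwrite its own input, so the new value is computed in `tmp` and then
  -- copied back to `dst`. Register `m` is the loop counter.
  obtain ⟨p3, c3, hp3⟩ := hs.2 dst tmp m' (fun r => (hd r).trans_le (by omega)) htm' htinj
    (fun r r' => by have := hd r; have := htm r'; omega)
  obtain ⟨p4, c4, hp4⟩ := (LS.id (α := β)).2 tmp dst m' htm'
    (fun r => (hd r).trans_le (by omega)) hinj (fun r r' => by have := hd r'; have := htm r; omega)
  set body : Prog := .seq (.dec m) (.seq p3 (.seq p4 (clearAll l))) with hbody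
  set C := c1 + c2 + (c0 + 2) * c3 + (c0 + 2) * c4 with hC
  refine ⟨.seq p1 (.seq p2 (.loop m body)), C, fun a σ B h1 h2 h3 => ?_⟩
  have hsd : ∀ r, src r ∉ Set.range dst := fun r ⟨r', hr'⟩ => hne _ _ hr'.symm
  obtain ⟨τ, e1, k1, k2⟩ := hp1 a σ B h1 (fun r hr => h2 r (by omega)) h3
  replace k1 : τ m = n a := k1 ()
  replace k2 : ∀ x, x ≠ m → τ x = σ x := fun x hx => k2 x (by rintro ⟨_, rfl⟩; exact hx rfl)
  obtain ⟨ρ, e2, k3, k4⟩ := hp2 a τ B (fun r => by rw [k2 _ (hsrc r).ne, h1])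
    (fun r hr => by rw [k2 _ (by omega), h2 r (by omega)]) h3
  have hdlt : ∀ x, m ≤ x → x ∉ Set.range dst := by
    rintro x hx ⟨r, rfl⟩; exact absurd hx (not_le.2 (hd r))
  have hloop : ∀ k i, k + i = n a → ∀ ρ : ℕ → ℕ, ρ m = k → (∀ r, ρ (dst r) =
      code (step^[i] (init a)) r) → (∀ x, m < x → ρ x = 0) →
      ∃ ρ', Exec ((B + 2) ^ C) (.loop m body) ρ ρ' ∧
        (∀ r, ρ' (dst r) = code (step^[n a] (init a)) r) ∧
        ρ' m = 0 ∧ ∀ x, x ∉ Set.range dst → x ≠ m → ρ' x = ρ x := by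
    intro k
    induction k with
    | zero =>
      intro i hi ρ h4 h5 h6
      have : i = n a := by omega
      exact ⟨ρ, .loop_zero h4, by rw [← this]; exact h5, h4, fun _ _ _ => rfl⟩
    | succ k ih =>
      intro i hi ρ h4 h5 h6
      set ρ1 := Function.update ρ m (ρ m - 1) with hρ1
      have hρ1d : ∀ x, x ≠ m → ρ1 x = ρ x := fun x hx => by simp [hρ1, hx]
      have hbi := hc0 a B h3 i (by omega)
      obtain ⟨ρ2, e3, k5, k6⟩ := hp3 (step^[i] (init a)) ρ1 _
        (fun r => by rw [hρ1d _ (hd r).ne, h5]) (fun x hx => by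
          rw [hρ1d _ (by omega), h6 x (by omega)]) hbi
      have hbi' := hc0 a B h3 (i + 1) (by omega)
      rw [Function.iterate_succ_apply'] at hbi'
      obtain ⟨ρ3, e4, k7, k8⟩ := hp4 (step (step^[i] (init a))) ρ2 _ k5 (fun x hx => by
        rw [k6 _ ?_, hρ1d _ (by omega), h6 x (by omega)]
        rintro ⟨r, rfl⟩
        exact absurd hx (not_le.2 (htm' _))) hbi'
      set ρ4 : ℕ → ℕ := fun x => if x ∈ l then 0 else ρ3 x with hρ4
      have hm_l : ∀ x, x ≤ m → x ∉ l := by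
        intro x hx h
        obtain ⟨r, rfl⟩ := (hl x).1 h
        have := htm r
        omega
      have hρ4' : ∀ x, x ∉ Set.range dst → x ≠ m → m < x ∨ x < m → ρ4 x = ρ x := by
        intro x hx hxm _
        by_cases hxl : x ∈ l
        · simp only [hρ4, hxl, if_true]
          obtain ⟨r, rfl⟩ := (hl x).1 hxl
          have := htm r
          exact (h6 _ (by omega)).symm
        · simp only [hρ4, hxl, if_false]
          rw [k8 x hx, k6 x (fun h => hxl ((hl x).2 h)), hρ1d x hxm]
      obtain ⟨ρ', e5, k9, k10, k11⟩ := ih (i + 1) (by omega) ρ4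
        (by
          simp only [hρ4, hm_l m le_rfl, if_false]
          rw [k8 m (hdlt m le_rfl), k6 m ?_]
          · simp [hρ1, h4]
          · rintro ⟨r, hr⟩; have := htm r; omega)
        (fun r => by
          simp only [hρ4, hm_l _ (hd r).le, if_false]
          rw [k7, Function.iterate_succ_apply'])
        (fun x hx => by rw [hρ4' x (hdlt x hx.le) hx.ne' (Or.inl hx), h6 x hx])
      refine ⟨ρ', .loop_succ (by omega) (.seq (.dec m ρ (by omega)) (.seq (e3.mono ?_)
        (.seq (e4.mono ?_) (.clearAll l ρ3)))) e5, k9, k10, fun x hx hxm => ?_⟩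
      · exact (pow_bound_comp B c0 c3).trans (pow_bound_mono B (by omega))
      · exact (pow_bound_comp B c0 c4).trans (pow_bound_mono B (by omega))
      · rw [k11 x hx hxm, hρ4' x hx hxm (by omega)]
  obtain ⟨ρ', e3, k5, k6, k7⟩ := hloop (n a) 0 (by omega) ρ
    (by rw [k4 m (hdlt m le_rfl), k1]) (fun r => by rw [k3]; rfl)
    (fun x hx => by rw [k4 x (hdlt x hx.le), k2 x hx.ne', h2 x hx.le])
  refine ⟨ρ', .seq (e1.mono (pow_bound_mono B (by omega)))
    (.seq (e2.mono (pow_bound_mono B (by omega))) e3), k5, fun x hx => ?_⟩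
  by_cases hxm : x = m
  · rw [hxm, k6, h2 m le_rfl]
  · rw [k7 x hx hxm, k4 x hx, k2 x hxm]

/-! ### Arithmetic and logic in linear space -/

/-- Iterate on triples that carry the argument and a counter along. The arithmetic and logic below
rest on this form of recursion. -/
theorem LS.natRec {n : α → ℕ} {init : α → β} {step : α → ℕ → β → β} (hn : LS n) (hi : LS init)
    (hs : LS (fun x : α × ℕ × β => step x.1 x.2.1 x.2.2))
    (hb : ∃ c, ∀ a B, Below a B → ∀ i ≤ n a,
      Below (Nat.rec (motive := fun _ => β) (init a) (step a) i) ((B + 2) ^ c)) :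
    LS (fun a => Nat.rec (motive := fun _ => β) (init a) (step a) (n a)) := by
  obtain ⟨c, hc⟩ := hb
  obtain ⟨c', hc'⟩ := hn.1
  let step' : α × ℕ × β → α × ℕ × β := fun x => (x.1, x.2.1 + 1, step x.1 x.2.1 x.2.2)
  have key : ∀ a i, step'^[i] (a, 0, init a) =
      (a, i, Nat.rec (motive := fun _ => β) (init a) (step a) i) := by
    intro a i
    induction i with
    | zero => rfl
    | succ i ih => rw [Function.iterate_succ_apply', ih]
  have h1 : LS step' := by
    simp only [step']
    fun_prop
  have h2 := LS.iterate (init := fun a => (a, 0, init a)) hn (by fun_prop) h1 ⟨1 + c' + c, by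
    intro a B hB i hin
    rw [key]
    refine below_prod.2 ⟨hB.mono (le_pow_bound B (by omega)), below_prod.2 ⟨?_, ?_⟩⟩
    · exact below_nat.2 (hin.trans ((below_nat.1 (hc' a B hB)).trans
        (pow_bound_mono B (by omega))))
    · exact (hc a B hB i hin).mono (pow_bound_mono B (by omega))⟩
  simp only [key] at h2
  exact h2.snd.snd

@[fun_prop] theorem LS.add {f g : α → ℕ} (hf : LS f) (hg : LS g) : LS (fun a => f a + g a) := by
  have h : LS (fun x : ℕ × ℕ => Nat.rec (motive := fun _ => ℕ) x.1 (fun _ y => y + 1) x.2) := by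
    refine LS.natRec (by fun_prop) (by fun_prop) (by fun_prop) ⟨2, ?_⟩
    rintro ⟨x, y⟩ B hB i hi
    simp at hB hi ⊢
    have : ∀ i, Nat.rec (motive := fun _ => ℕ) x (fun _ y => y + 1) i = x + i := by
      intro i
      induction i with
      | zero => rfl
      | succ i ih => simp only [ih]; rfl
    rw [this]
    nlinarith
  have h2 : (fun a => f a + g a) = fun a => (fun x : ℕ × ℕ =>
      Nat.rec (motive := fun _ => ℕ) x.1 (fun _ y => y + 1) x.2) (f a, g a) := by
    funext a
    simp only
    induction g a with
    | zero => rfl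
    | succ i ih => simp only [← ih]; rfl
  rw [h2]
  exact h.comp (by fun_prop)

@[fun_prop] theorem LS.mul {f g : α → ℕ} (hf : LS f) (hg : LS g) : LS (fun a => f a * g a) := by
  have key : ∀ x i : ℕ, Nat.rec (motive := fun _ => ℕ) 0 (fun _ y => y + x) i = x * i := by
    intro x i
    induction i with
    | zero => rfl
    | succ i ih => simp only [ih]; rfl
  have h : LS (fun x : ℕ × ℕ => Nat.rec (motive := fun _ => ℕ) 0 (fun _ y => y + x.1) x.2) := by
    refine LS.natRec (step := fun (x : ℕ × ℕ) _ y => y + x.1) (by fun_prop) (by fun_prop)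
      (by fun_prop) ⟨2, ?_⟩
    rintro ⟨x, y⟩ B hB i hi
    simp at hB hi ⊢
    rw [key]
    have := Nat.mul_le_mul hB.1 (hi.trans hB.2)
    nlinarith
  have h2 : (fun a => f a * g a) = fun a => (fun x : ℕ × ℕ =>
      Nat.rec (motive := fun _ => ℕ) 0 (fun _ y => y + x.1) x.2) (f a, g a) := by
    funext a
    exact (key _ _).symm
  rw [h2]
  exact h.comp (by fun_prop)

theorem LS.pred {f : α → ℕ} (hf : LS f) : LS (fun a => f a - 1) := by
  have h : LS (fun x : ℕ => Nat.rec (motive := fun _ => ℕ) 0 (fun i _ => i) x) := by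
    refine LS.natRec (step := fun _ i _ => i) (by fun_prop) (by fun_prop) (by fun_prop) ⟨1, ?_⟩
    intro x B hB i hi
    simp at hB hi ⊢
    cases i <;> simp <;> omega
  have h2 : (fun a => f a - 1) = fun a => (fun x : ℕ =>
      Nat.rec (motive := fun _ => ℕ) 0 (fun i _ => i) x) (f a) := by
    funext a
    simp only
    cases f a <;> rfl
  rw [h2]
  exact h.comp (by fun_prop)

@[fun_prop] theorem LS.sub {f g : α → ℕ} (hf : LS f) (hg : LS g) : LS (fun a => f a - g a) := by
  have key : ∀ x i : ℕ, Nat.rec (motive := fun _ => ℕ) x (fun _ y => y - 1) i = x - i := by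
    intro x i
    induction i with
    | zero => rfl
    | succ i ih => simp only [ih]; rfl
  have h : LS (fun x : ℕ × ℕ => Nat.rec (motive := fun _ => ℕ) x.1 (fun _ y => y - 1) x.2) := by
    refine LS.natRec (step := fun (x : ℕ × ℕ) _ y => y - 1) (by fun_prop) (by fun_prop)
      (LS.pred (by fun_prop)) ⟨1, ?_⟩
    rintro ⟨x, y⟩ B hB i hi
    simp at hB hi ⊢
    rw [key]
    omega
  have h2 : (fun a => f a - g a) = fun a => (fun x : ℕ × ℕ =>
      Nat.rec (motive := fun _ => ℕ) x.1 (fun _ y => y - 1) x.2) (f a, g a) := by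
    funext a
    exact (key _ _).symm
  rw [h2]
  exact h.comp (by fun_prop)

/-- Case distinction is a recursion whose step ignores the accumulator. -/
theorem LS.cond {n : α → ℕ} {f g : α → β} (hn : LS n) (hf : LS f) (hg : LS g) :
    LS (fun a => if n a = 0 then f a else g a) := by
  have key : ∀ (x y : β) (i : ℕ), Nat.rec (motive := fun _ => β) x (fun _ _ => y) i =
      if i = 0 then x else y := by
    intro x y i
    cases i <;> simp
  have h : LS (fun x : ℕ × β × β =>
      Nat.rec (motive := fun _ => β) x.2.1 (fun _ _ => x.2.2) x.1) := by
    refine LS.natRec (step := fun (x : ℕ × β × β) _ _ => x.2.2) (by fun_prop) (by fun_prop)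
      (by fun_prop) ⟨1, ?_⟩
    rintro ⟨x, y, z⟩ B hB i hi
    simp at hB hi
    rw [key]
    dsimp only
    split_ifs
    · exact hB.2.1.mono (le_pow_bound B le_rfl)
    · exact hB.2.2.mono (le_pow_bound B le_rfl)
  have h2 : (fun a => if n a = 0 then f a else g a) = fun a => (fun x : ℕ × β × β =>
      Nat.rec (motive := fun _ => β) x.2.1 (fun _ _ => x.2.2) x.1) (n a, f a, g a) := by
    funext a
    exact (key _ _ _).symm
  rw [h2]
  exact h.comp (by fun_prop)

open Classical in
/-- Predicates that are decidable in linear space. -/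
@[fun_prop]
def LSP (P : α → Prop) : Prop := LS (fun a => if P a then (1 : ℕ) else 0)

theorem LSP.congr {P Q : α → Prop} (hP : LSP P) (h : ∀ a, P a ↔ Q a) : LSP Q := by
  have : P = Q := funext fun a => propext (h a)
  rwa [← this]

@[fun_prop] theorem LSP.comp {g : β → Prop} {f : α → β} (hg : LSP g) (hf : LS f) :
    LSP (fun a => g (f a)) := LS.comp (g := fun b => _) hg hf

@[fun_prop] theorem LSP.const (p : Prop) : LSP (fun _ : α => p) := LS.const _

@[fun_prop] theorem LS.ite {P : α → Prop} [DecidablePred P] {f g : α → β} (hP : LSP P) (hf : LS f)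
    (hg : LS g) : LS (fun a => if P a then f a else g a) := by
  have := LS.cond hP hg hf
  convert this using 2 with a
  by_cases h : P a <;> simp [h]

theorem LSP.eq_zero {f : α → ℕ} (hf : LS f) : LSP (fun a => f a = 0) := by
  have := LS.cond hf (LS.const 1) (LS.const 0)
  unfold LSP
  convert this using 2 with a
  by_cases h : f a = 0 <;> simp [h]

@[fun_prop] theorem LSP.not {P : α → Prop} (hP : LSP P) : LSP (fun a => ¬ P a) :=
  (LSP.eq_zero hP).congr fun a => by by_cases h : P a <;> simp [h]

@[fun_prop] theorem LSP.and {P Q : α → Prop} (hP : LSP P) (hQ : LSP Q) :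
    LSP (fun a => P a ∧ Q a) :=
  (LSP.not (LSP.eq_zero (LS.mul hP hQ))).congr fun a => by
    by_cases h : P a <;> by_cases h' : Q a <;> simp [h, h']

@[fun_prop] theorem LSP.or {P Q : α → Prop} (hP : LSP P) (hQ : LSP Q) :
    LSP (fun a => P a ∨ Q a) :=
  (LSP.not (hP.not.and hQ.not)).congr fun a => by tauto

@[fun_prop] theorem LSP.imp {P Q : α → Prop} (hP : LSP P) (hQ : LSP Q) :
    LSP (fun a => P a → Q a) :=
  (hP.not.or hQ).congr fun a => by tauto

@[fun_prop] theorem LSP.le {f g : α → ℕ} (hf : LS f) (hg : LS g) : LSP (fun a => f a ≤ g a) :=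
  (LSP.eq_zero (hf.sub hg)).congr fun a => by omega

@[fun_prop] theorem LSP.lt {f g : α → ℕ} (hf : LS f) (hg : LS g) : LSP (fun a => f a < g a) :=
  (LSP.le hf.succ hg).congr fun a => by omega

theorem LSP.forall_finset {ι : Type} (s : Finset ι) {P : ι → α → Prop} (h : ∀ i, LSP (P i)) :
    LSP (fun a => ∀ i ∈ s, P i a) := by
  classical
  induction s using Finset.induction_on with
  | empty => exact (LSP.const True).congr fun a => by simp
  | insert i s _ ih => exact ((h i).and ih).congr fun a => by simp

theorem LSP.forall_finite {ι : Type} [Finite ι] {P : ι → α → Prop} (h : ∀ i, LSP (P i)) :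
    LSP (fun a => ∀ i, P i a) := by
  have : Fintype ι := Fintype.ofFinite _
  exact (LSP.forall_finset Finset.univ h).congr fun a => by simp

@[fun_prop] theorem LSP.eq {f g : α → β} (hf : LS f) (hg : LS g) : LSP (fun a => f a = g a) := by
  have h : ∀ r, LSP (fun a => code (f a) r = code (g a) r) := fun r => by
    have h1 : LS (fun a => code (f a) r) := (LS.reg r).comp hf
    have h2 : LS (fun a => code (g a) r) := (LS.reg r).comp hg
    exact ((LSP.le h1 h2).and (LSP.le h2 h1)).congr fun a => by omega
  exact (LSP.forall_finite h).congr fun a => ⟨fun h => inj (funext h), fun h r => by rw [h]⟩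

@[fun_prop] theorem LS.inf {f g : α → ℕ} (hf : LS f) (hg : LS g) :
    LS (fun a => min (f a) (g a)) := by
  simp only [min_def]
  fun_prop

@[fun_prop] theorem LSP.ball {P : α → ℕ → Prop} {b : α → ℕ}
    (hP : LSP (fun x : α × ℕ => P x.1 x.2)) (hb : LS b) : LSP (fun a => ∀ y < b a, P a y) := by
  classical
  let g : α → ℕ → ℕ := fun a => Nat.rec (motive := fun _ => ℕ) 1
    (fun i acc => if P a i then acc else 0)
  have key : ∀ a i, g a i = if ∀ y < i, P a y then 1 else 0 := by
    intro a i
    induction i with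
    | zero => simp [g]
    | succ i ih =>
      have h1 : g a (i + 1) = if P a i then g a i else 0 := rfl
      rw [h1, ih]
      by_cases h2 : P a i
      · rw [if_pos h2]
        congr 1
        refine propext ⟨fun h y hy => ?_, fun h y hy => h y (by omega)⟩
        rcases Nat.lt_succ_iff_lt_or_eq.1 hy with h3 | rfl
        · exact h y h3
        · exact h2
      · rw [if_neg h2, if_neg fun h => h2 (h i (by omega))]
  have hs : LS (fun x : α × ℕ × ℕ => if P x.1 x.2.1 then x.2.2 else 0) := by
    have : LSP (fun x : α × ℕ × ℕ => P x.1 x.2.1) :=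
      hP.comp (f := fun x : α × ℕ × ℕ => (x.1, x.2.1)) (by fun_prop)
    fun_prop
  have h : LS (fun a => g a (b a)) := by
    refine LS.natRec (step := fun a i acc => if P a i then acc else 0) hb (by fun_prop) hs
      ⟨1, fun a B _ i _ => ?_⟩
    have := key a i
    simp only [g] at this
    rw [this, below_nat]
    split_ifs <;> simp
  refine LSP.congr (LSP.not (LSP.eq_zero h)) fun a => ?_
  rw [key]
  simp

@[fun_prop] theorem LSP.bex {P : α → ℕ → Prop} {b : α → ℕ}
    (hP : LSP (fun x : α × ℕ => P x.1 x.2)) (hb : LS b) : LSP (fun a => ∃ y < b a, P a y) :=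
  (LSP.not (LSP.ball (P := fun a y => ¬ P a y) hP.not hb)).congr fun a => by
    push Not; rfl

/-- Bounded search. -/
theorem LS.sInf_lt {P : α → ℕ → Prop} {b : α → ℕ}
    (hP : LSP (fun x : α × ℕ => P x.1 x.2)) (hb : LS b) :
    LS (fun a => sInf {y | y < b a ∧ P a y}) := by
  classical
  -- The accumulator counts the numbers before the first witness and is frozen from then on.
  let g : α → ℕ → ℕ := fun a => Nat.rec (motive := fun _ => ℕ) 0
    (fun i acc => if ∃ y < i + 1, P a y then acc else acc + 1)
  have key : ∀ a i, (∀ y < i, ¬ P a y) → g a i = i := by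
    intro a i
    induction i with
    | zero => intro _; rfl
    | succ i ih =>
      intro h
      have h1 : g a (i + 1) = if ∃ y < i + 1, P a y then g a i else g a i + 1 := rfl
      rw [h1, if_neg (by push Not; exact h), ih fun y hy => h y (by omega)]
  have key2 : ∀ a y, P a y → (∀ z < y, ¬ P a z) → ∀ i, y ≤ i → g a i = y := by
    intro a y hy hz i hi
    induction i, hi using Nat.le_induction with
    | base => exact key a y hz
    | succ i hi ih =>
      have h1 : g a (i + 1) = if ∃ y < i + 1, P a y then g a i else g a i + 1 := rfl
      rw [h1, if_pos ⟨y, by omega, hy⟩, ih]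
  have hle : ∀ a i, g a i ≤ i := by
    intro a i
    induction i with
    | zero => exact le_rfl
    | succ i ih =>
      have h1 : g a (i + 1) = if ∃ y < i + 1, P a y then g a i else g a i + 1 := rfl
      rw [h1]
      split_ifs <;> omega
  have hs : LS (fun x : α × ℕ × ℕ => if ∃ y < x.2.1 + 1, P x.1 y then x.2.2 else x.2.2 + 1) := by
    have : LSP (fun x : α × ℕ × ℕ => ∃ y < x.2.1 + 1, P x.1 y) := by
      refine LSP.bex ?_ (by fun_prop)
      exact hP.comp (f := fun x : (α × ℕ × ℕ) × ℕ => (x.1.1, x.2)) (by fun_prop)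
    fun_prop
  obtain ⟨c, hc⟩ := hb.1
  have h : LS (fun a => g a (b a)) := by
    refine LS.natRec (step := fun a i acc => if ∃ y < i + 1, P a y then acc else acc + 1) hb
      (by fun_prop) hs ⟨c, fun a B hB i hi => ?_⟩
    exact below_nat.2 (((hle a i).trans hi).trans (below_nat.1 (hc a B hB)))
  -- Without a witness the counter would end at `b a`, whereas `sInf ∅ = 0`.
  have h2 : LS (fun a => if ∃ y < b a, P a y then g a (b a) else 0) := by
    exact LS.ite (LSP.bex hP hb) h (LS.const 0)
  convert h2 using 2 with a
  split_ifs with h3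
  · have h4 : {y | y < b a ∧ P a y}.Nonempty := h3
    obtain ⟨h5, h6⟩ := Nat.sInf_mem h4
    exact (key2 a _ h6 (fun z hz hPz => Nat.notMem_of_lt_sInf hz ⟨by omega, hPz⟩) _ h5.le).symm
  · have : {y | y < b a ∧ P a y} = ∅ := Set.eq_empty_of_forall_notMem fun y hy => h3 ⟨y, hy⟩
    rw [this, Nat.sInf_empty]

@[fun_prop] theorem LS.div {f g : α → ℕ} (hf : LS f) (hg : LS g) : LS (fun a => f a / g a) := by
  have h1 : LS (fun x : ℕ × ℕ => sInf {q | q < x.1 + 1 ∧ x.1 < (q + 1) * x.2}) :=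
    LS.sInf_lt (P := fun (x : ℕ × ℕ) q => x.1 < (q + 1) * x.2) (by fun_prop) (by fun_prop)
  have h2 : ∀ x y : ℕ, sInf {q | q < x + 1 ∧ x < (q + 1) * y} = x / y := by
    intro x y
    rcases Nat.eq_zero_or_pos y with rfl | hy
    · simp
    · refine le_antisymm (Nat.sInf_le ⟨Nat.lt_succ_of_le (Nat.div_le_self _ _), ?_⟩) ?_
      · have := Nat.lt_div_mul_add (a := x) hy
        nlinarith
      · refine le_csInf ⟨x / y, Nat.lt_succ_of_le (Nat.div_le_self _ _), ?_⟩ fun q hq => ?_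
        · have := Nat.lt_div_mul_add (a := x) hy
          nlinarith
        · have := (Nat.div_lt_iff_lt_mul hy).2 hq.2
          omega
  simp only [h2] at h1
  exact h1.comp (f := fun a => (f a, g a)) (by fun_prop)

@[fun_prop] theorem LS.mod {f g : α → ℕ} (hf : LS f) (hg : LS g) : LS (fun a => f a % g a) := by
  have : LS (fun a => f a - g a * (f a / g a)) := by fun_prop
  convert this using 2 with a
  have := Nat.div_add_mod (f a) (g a)
  omega

/-- The number `x` without its last `m` digits in base `b`. -/
def divPow (x b m : ℕ) : ℕ := x / b ^ m

@[fun_prop] theorem LS.divPow {f g h : α → ℕ} (hf : LS f) (hg : LS g) (hh : LS h) :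
    LS (fun a => divPow (f a) (g a) (h a)) := by
  have key : ∀ x b i : ℕ, Nat.rec (motive := fun _ => ℕ) x (fun _ y => y / b) i =
      _root_.divPow x b i := by
    intro x b i
    induction i with
    | zero => simp [_root_.divPow]
    | succ i ih => simp only [ih]; simp only [_root_.divPow, pow_succ, Nat.div_div_eq_div_mul]
  have h1 : LS (fun x : ℕ × ℕ × ℕ =>
      Nat.rec (motive := fun _ => ℕ) x.1 (fun _ y => y / x.2.1) x.2.2) := by
    refine LS.natRec (step := fun (x : ℕ × ℕ × ℕ) _ y => y / x.2.1) (by fun_prop) (by fun_prop)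
      (by fun_prop) ⟨1, ?_⟩
    rintro ⟨x, y, z⟩ B hB i hi
    simp at hB hi ⊢
    rw [key]
    have : _root_.divPow x y i ≤ x := Nat.div_le_self _ _
    omega
  simp only [key] at h1
  exact h1.comp (f := fun a => (f a, g a, h a)) (by fun_prop)

/-- The `i`-th digit of `x` in base `b`. -/
def digit (b i x : ℕ) : ℕ := x / b ^ i % b

@[fun_prop] theorem LS.digit {f g h : α → ℕ} (hf : LS f) (hg : LS g) (hh : LS h) :
    LS (fun a => digit (f a) (g a) (h a)) := by
  have : LS (fun a => _root_.divPow (h a) (f a) (g a) % f a) := by fun_prop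
  exact this

/-- A truncated power. -/
def minPow (K b e : ℕ) : ℕ := min K (b ^ e)

-- A power with variable exponent is not polynomially bounded, hence not in `LS`. Truncating every
-- partial product at `K` repairs this, and the truncation commutes with multiplication by `b`.
@[fun_prop] theorem LS.minPow {f g h : α → ℕ} (hf : LS f) (hg : LS g) (hh : LS h) :
    LS (fun a => minPow (f a) (g a) (h a)) := by
  have key : ∀ K b i : ℕ, Nat.rec (motive := fun _ => ℕ) (min K 1) (fun _ y => min K (y * b)) i =
      _root_.minPow K b i := by
    intro K b i
    induction i with
    | zero => simp [_root_.minPow]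
    | succ i ih =>
      simp only [ih]
      simp only [_root_.minPow, pow_succ]
      rcases Nat.eq_zero_or_pos b with rfl | hb
      · simp
      · rcases le_total K (b ^ i) with h | h
        · have h1 : K ≤ K * b := Nat.le_mul_of_pos_right K hb
          have h2 : K ≤ b ^ i * b := h.trans (Nat.le_mul_of_pos_right _ hb)
          rw [min_eq_left h, min_eq_left h1, min_eq_left h2]
        · rw [min_eq_right h]
  have h1 : LS (fun x : ℕ × ℕ × ℕ =>
      Nat.rec (motive := fun _ => ℕ) (min x.1 1) (fun _ y => min x.1 (y * x.2.1)) x.2.2) := by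
    refine LS.natRec (step := fun (x : ℕ × ℕ × ℕ) _ y => min x.1 (y * x.2.1)) (by fun_prop)
      (by fun_prop) (by fun_prop) ⟨1, ?_⟩
    rintro ⟨x, y, z⟩ B hB i hi
    simp at hB hi ⊢
    rw [key]
    have : _root_.minPow x y i ≤ x := min_le_left _ _
    omega
  simp only [key] at h1
  exact h1.comp (f := fun a => (f a, g a, h a)) (by fun_prop)

@[fun_prop] theorem LS.pow {f : α → ℕ} (hf : LS f) (n : ℕ) : LS (fun a => f a ^ n) := by
  induction n with
  | zero => simp only [pow_zero]; fun_prop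
  | succ n ih => simp only [pow_succ]; fun_prop

@[fun_prop] theorem LS.log {f : α → ℕ} (hf : LS f) : LS (fun a => Nat.log 2 (f a)) := by
  have h1 : LS (fun x : ℕ => sInf {k | k < x + 1 ∧ _root_.divPow x 2 (k + 1) = 0}) :=
    LS.sInf_lt (P := fun x k => _root_.divPow x 2 (k + 1) = 0) (by fun_prop) (by fun_prop)
  have h2 : ∀ x : ℕ, sInf {k | k < x + 1 ∧ _root_.divPow x 2 (k + 1) = 0} = Nat.log 2 x := by
    intro x
    have h3 : Nat.log 2 x < x + 1 ∧ _root_.divPow x 2 (Nat.log 2 x + 1) = 0 :=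
      ⟨Nat.lt_succ_of_le (Nat.log_le_self 2 x),
        Nat.div_eq_of_lt (Nat.lt_pow_succ_log_self (by omega) x)⟩
    refine le_antisymm (Nat.sInf_le h3) (le_csInf ⟨_, h3⟩ fun k hk => ?_)
    have h4 : x < 2 ^ (k + 1) := by
      by_contra h
      have := Nat.div_pos (not_lt.1 h) (by positivity)
      have h5 : x / 2 ^ (k + 1) = 0 := hk.2
      omega
    exact Nat.lt_succ_iff.1 (Nat.log_lt_of_lt_pow' (by omega) h4)
  simp only [h2] at h1
  exact h1.comp hf

@[fun_prop] theorem LS.sqrt {f : α → ℕ} (hf : LS f) : LS (fun a => Nat.sqrt (f a)) := by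
  have h1 : LS (fun x : ℕ => sInf {k | k < x + 1 ∧ x < (k + 1) * (k + 1)}) :=
    LS.sInf_lt (P := fun x k => x < (k + 1) * (k + 1)) (by fun_prop) (by fun_prop)
  have h2 : ∀ x : ℕ, sInf {k | k < x + 1 ∧ x < (k + 1) * (k + 1)} = Nat.sqrt x := by
    intro x
    have h3 : Nat.sqrt x < x + 1 ∧ x < (Nat.sqrt x + 1) * (Nat.sqrt x + 1) :=
      ⟨Nat.lt_succ_of_le (Nat.sqrt_le_self x), Nat.lt_succ_sqrt x⟩
    refine le_antisymm (Nat.sInf_le h3) (le_csInf ⟨_, h3⟩ fun k hk => ?_)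
    exact Nat.lt_succ_iff.1 (Nat.sqrt_lt.2 hk.2)
  simp only [h2] at h1
  exact h1.comp hf

@[fun_prop] theorem LS.unpair {f : α → ℕ} (hf : LS f) : LS (fun a => Nat.unpair (f a)) := by
  unfold Nat.unpair
  fun_prop

/-- Case distinction over a finite type. -/
theorem LS.finite_arg {ι : Type} [Finite ι] [Coded ι] {i : α → ι} {f : ι → α → β} (hi : LS i)
    (hf : ∀ j, LS (f j)) : LS (fun a => f (i a) a) := by
  classical
  refine LS.of_code fun r => ?_
  have hfr : ∀ j, LS (fun a => code (f j a) r) := fun j => (LS.reg r).comp (hf j)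
  have key : ∀ s : Finset ι, LS (fun a => if i a ∈ s then code (f (i a) a) r else 0) := by
    intro s
    induction s using Finset.induction_on with
    | empty => simpa using LS.const 0
    | insert j s _ ih =>
      have h : LS (fun a => if i a = j then code (f j a) r else
          if i a ∈ s then code (f (i a) a) r else 0) := by
        have := hfr j
        fun_prop
      convert h using 2 with a
      by_cases h1 : i a = j
      · simp [h1]
      · simp [h1]
  have : Fintype ι := Fintype.ofFinite _
  simpa using key Finset.univ

theorem LS.of_finite [Finite α] (f : α → β) : LS f :=
  LS.finite_arg (i := fun a => a) (f := fun a _ => f a) (by fun_prop) fun _ => by fun_prop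

/-- Finite types are coded by one register. -/
@[reducible] noncomputable def Coded.ofFinite (ι : Type) [Finite ι] : Coded ι where
  Reg := Unit
  code i _ := Finite.equivFin ι i
  inj i j h := (Finite.equivFin ι).injective (Fin.ext (congrFun h ()))

noncomputable instance : Coded SignType := .ofFinite _

noncomputable instance : Coded (Option Bool) := .ofFinite _

/-! ### Words as numbers -/

theorem wordNum_nil : wordNum [] = 1 := rfl

theorem wordNum_cons (b : Bool) (l : List Bool) : wordNum (b :: l) = b.toNat + 2 * wordNum l := rfl

theorem wordNum_pos (l : List Bool) : 0 < wordNum l := by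
  induction l with
  | nil => simp [wordNum_nil]
  | cons b l ih => rw [wordNum_cons]; omega

theorem log_wordNum (l : List Bool) : Nat.log 2 (wordNum l) = l.length := by
  induction l with
  | nil => simp [wordNum_nil]
  | cons b l ih =>
    have h := wordNum_pos l
    rw [wordNum_cons, Nat.log_of_one_lt_of_le (by omega) (by omega)]
    have : (b.toNat + 2 * wordNum l) / 2 = wordNum l := by cases b <;> simp; omega
    rw [this, ih, List.length_cons]

theorem wordNum_injective : Function.Injective wordNum := by
  intro l
  induction l with
  | nil =>
    intro l' h
    cases l' with
    | nil => rfl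
    | cons b l' => have := wordNum_pos l'; rw [wordNum_nil, wordNum_cons] at h; omega
  | cons b l ih =>
    intro l' h
    cases l' with
    | nil => have := wordNum_pos l; rw [wordNum_nil, wordNum_cons] at h; omega
    | cons b' l' =>
      rw [wordNum_cons, wordNum_cons] at h
      have h1 : b = b' ∧ wordNum l = wordNum l' := by
        cases b <;> cases b' <;> simp at h ⊢ <;> omega
      rw [h1.1, ih h1.2]

theorem exists_wordNum {n : ℕ} (hn : 0 < n) : ∃ l, wordNum l = n := by
  induction n using Nat.strong_induction_on with
  | _ n ih =>
    rcases Nat.lt_or_ge 1 n with h | h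
    · obtain ⟨l, hl⟩ := ih (n / 2) (by omega) (by omega)
      refine ⟨decide (n % 2 = 1) :: l, ?_⟩
      rw [wordNum_cons, hl]
      rcases Nat.mod_two_eq_zero_or_one n with h' | h' <;> simp [h'] <;> omega
    · exact ⟨[], by rw [wordNum_nil]; omega⟩

/-- The word of a number. -/
noncomputable def numWord (n : ℕ) : List Bool := Function.invFun wordNum n

theorem numWord_wordNum (l : List Bool) : numWord (wordNum l) = l :=
  Function.leftInverse_invFun wordNum_injective l

theorem wordNum_numWord {n : ℕ} (hn : 0 < n) : wordNum (numWord n) = n :=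
  Function.invFun_eq (exists_wordNum hn)

theorem wordNum_lt (l : List Bool) : wordNum l < 2 ^ (l.length + 1) := by
  rw [← log_wordNum]; exact Nat.lt_pow_succ_log_self (by omega) _

theorem le_wordNum (l : List Bool) : 2 ^ l.length ≤ wordNum l := by
  rw [← log_wordNum]; exact Nat.pow_log_le_self 2 (wordNum_pos l).ne'

theorem digit_cons_zero {b a x : ℕ} (ha : a < b) : digit b 0 (a + b * x) = a := by
  simp [digit, Nat.mod_eq_of_lt ha]

theorem digit_cons_succ {b a x i : ℕ} (ha : a < b) :
    digit b (i + 1) (a + b * x) = digit b i x := by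
  unfold digit
  rw [pow_succ', ← Nat.div_div_eq_div_mul, Nat.add_mul_div_left _ _ (by omega),
    Nat.div_eq_of_lt ha, zero_add]

theorem digit_wordNum (l : List Bool) (i : ℕ) (h : i < l.length) :
    digit 2 i (wordNum l) = (l[i]).toNat := by
  induction l generalizing i with
  | nil => simp at h
  | cons b l ih =>
    have hb : b.toNat < 2 := Bool.toNat_lt b
    rw [wordNum_cons]
    cases i with
    | zero => rw [digit_cons_zero hb]; rfl
    | succ i => rw [digit_cons_succ hb, ih i (by simpa using h)]; rfl

theorem digit_le (b i x : ℕ) : digit b i x ≤ x := (Nat.mod_le _ _).trans (Nat.div_le_self _ _)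

theorem digit_zero_right (b i : ℕ) : digit b i 0 = 0 := by simp [digit]

theorem digit_lt {b : ℕ} (hb : 0 < b) (i x : ℕ) : digit b i x < b := Nat.mod_lt _ hb

/-- Positions of nonzero digits are smaller than the number. -/
theorem lt_of_digit_ne_zero {b i x : ℕ} (hb : 1 < b) (h : digit b i x ≠ 0) : i < x := by
  by_contra hi
  have h1 : x < b ^ i := (not_lt.1 hi).trans_lt (Nat.lt_pow_self hb)
  exact h (by simp [digit, Nat.div_eq_of_lt h1])

theorem digit_div_pow (b q j x : ℕ) : digit b j (x / b ^ q) = digit b (q + j) x := by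
  unfold digit
  rw [Nat.div_div_eq_div_mul, pow_add]

theorem digit_mul_pow (b q j x : ℕ) (hb : 0 < b) :
    digit b j (b ^ q * x) = if j < q then 0 else digit b (j - q) x := by
  unfold digit
  split_ifs with h
  · obtain ⟨k, rfl⟩ := Nat.exists_eq_add_of_lt h
    rw [show b ^ (j + k + 1) * x = b ^ j * (b * (b ^ k * x)) by ring,
      Nat.mul_div_cancel_left _ (by positivity), Nat.mul_mod_right]
  · obtain ⟨k, rfl⟩ := Nat.exists_eq_add_of_le (not_lt.1 h)
    rw [pow_add, ← Nat.div_div_eq_div_mul, Nat.mul_div_cancel_left _ (by positivity)]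
    simp

theorem digit_decomp {b lo a hi h j : ℕ} (hb : 0 < b) (hlo : lo < b ^ h) (ha : a < b) :
    digit b j (lo + b ^ h * (a + b * hi)) =
      if j < h then digit b j lo else if j = h then a else digit b (j - h - 1) hi := by
  split_ifs with h1 h2
  · obtain ⟨k, rfl⟩ := Nat.exists_eq_add_of_lt h1
    unfold digit
    rw [show lo + b ^ (j + k + 1) * (a + b * hi) = lo + b ^ j * (b * (b ^ k * (a + b * hi))) by
      ring, Nat.add_mul_div_left _ _ (by positivity), Nat.add_mul_mod_self_left]
  · subst h2
    unfold digit
    rw [Nat.add_mul_div_left _ _ (by positivity), Nat.div_eq_of_lt hlo, zero_add,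
      Nat.add_mul_mod_self_left, Nat.mod_eq_of_lt ha]
  · obtain ⟨k, rfl⟩ := Nat.exists_eq_add_of_le (show h + 1 ≤ j by omega)
    unfold digit
    rw [show h + 1 + k = h + (k + 1) by ring, pow_add, ← Nat.div_div_eq_div_mul,
      Nat.add_mul_div_left _ _ (by positivity), Nat.div_eq_of_lt hlo, zero_add]
    have := digit_cons_succ (b := b) (a := a) (x := hi) (i := k) ha
    unfold digit at this
    rw [this]
    congr 3
    omega

/-- The new digit is added before the old one is subtracted, so the natural subtraction is exact.
This is how `tapeStep` writes a symbol. -/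
theorem digit_set {b a x h j : ℕ} (ha : a < b) :
    digit b j (x + a * b ^ h - digit b h x * b ^ h) = if j = h then a else digit b j x := by
  have hb : 0 < b := by omega
  obtain ⟨lo, hi, hlo, hx⟩ : ∃ lo hi, lo < b ^ h ∧ x = lo + b ^ h * (digit b h x + b * hi) := by
    refine ⟨x % b ^ h, x / b ^ h / b, Nat.mod_lt _ (by positivity), ?_⟩
    unfold digit
    rw [Nat.mod_add_div, Nat.mod_add_div]
  have h1 : digit b h x < b := digit_lt hb _ _
  have h2 : x + a * b ^ h - digit b h x * b ^ h = lo + b ^ h * (a + b * hi) := by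
    have h3 : x + a * b ^ h = lo + b ^ h * (a + b * hi) + digit b h x * b ^ h := by
      nth_rw 1 [hx]; ring
    rw [h3, Nat.add_sub_cancel]
  rw [h2, digit_decomp hb hlo ha]
  have h4 := digit_decomp (j := j) (hi := hi) hb hlo h1
  rw [← hx] at h4
  rw [h4]
  split_ifs <;> first | rfl | omega

/-! ### Simulation of oracle machines -/

attribute [local instance] OracleTM.finite_state OracleTM.finite_aux OracleTM.finite_work

noncomputable instance (M : OracleTM) : Coded M.State := .ofFinite _

instance {W : Type} [Finite W] : Finite (TapeName W) := by
  let f : TapeName W → Fin 4 ⊕ W := fun i => match i with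
    | .program => .inl 0
    | .input => .inl 1
    | .query => .inl 2
    | .output => .inl 3
    | .work w => .inr w
  refine Finite.of_injective f fun i j h => ?_
  cases i <;> cases j <;> simp [f] at h ⊢ <;> assumption

/-- The number of tape symbols. -/
noncomputable def symBase (Aux : Type) : ℕ := Nat.card (Bool ⊕ Aux) + 1

/-- Tape symbols as digits; the blank is `0`. -/
noncomputable def symCode {Aux : Type} [Finite Aux] : TapeSymbol Aux → ℕ
  | none => 0
  | some s => Finite.equivFin (Bool ⊕ Aux) s + 1

section Symbols

variable {Aux : Type} [Finite Aux]

theorem symCode_lt (a : TapeSymbol Aux) : symCode a < symBase Aux := by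
  cases a with
  | none => simp [symCode, symBase]
  | some s => exact Nat.succ_lt_succ (Finite.equivFin (Bool ⊕ Aux) s).2

theorem symCode_injective : Function.Injective (symCode (Aux := Aux)) := by
  intro a b h
  cases a <;> cases b <;> simp [symCode] at h ⊢
  exact (Finite.equivFin (Bool ⊕ Aux)).injective (Fin.ext h)

theorem exists_symCode {n : ℕ} (h : n < symBase Aux) : ∃ a : TapeSymbol Aux, symCode a = n := by
  cases n with
  | zero => exact ⟨none, rfl⟩
  | succ n =>
    exact ⟨some ((Finite.equivFin (Bool ⊕ Aux)).symm ⟨n, by simpa [symBase] using h⟩),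
      by simp [symCode]⟩

theorem one_lt_symBase : 1 < symBase Aux := by
  have h := symCode_lt (Aux := Aux) (some (.inl true))
  have : symCode (Aux := Aux) (some (.inl true)) = Finite.equivFin (Bool ⊕ Aux) (.inl true) + 1 :=
    rfl
  omega

noncomputable instance : Coded (Option (Bool ⊕ Aux)) where
  Reg := Unit
  code a _ := symCode a
  inj _ _ h := symCode_injective (congrFun h ())

/-- The tape symbol of a digit. -/
noncomputable def symOf (n : ℕ) : TapeSymbol Aux := Function.invFun symCode n

theorem symOf_symCode (a : TapeSymbol Aux) : symOf (symCode a) = a :=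
  Function.leftInverse_invFun symCode_injective a

theorem LS.symOf_mod {f : α → ℕ} (hf : LS f) :
    LS (fun a => (symOf (f a % symBase Aux) : TapeSymbol Aux)) := by
  refine LS.of_code fun r => ?_
  have h : LS (fun a => f a % symBase Aux) := by fun_prop
  convert h using 2 with a
  have h1 := Nat.mod_lt (f a) (by have := one_lt_symBase (Aux := Aux); omega : 0 < symBase Aux)
  exact Function.invFun_eq (exists_symCode h1)

@[fun_prop] theorem LS.symCode {f : α → TapeSymbol Aux} (hf : LS f) :
    LS (fun a => symCode (f a)) := (LS.reg (α := TapeSymbol Aux) ()).comp hf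

end Symbols

/-- The base in which slices of words of the length of `w` are coded. -/
def lenBase (w : ℕ) : ℕ := minPow (2 * w + 1) 2 (Nat.log 2 w + 1)

theorem lenBase_eq {w : ℕ} (hw : 0 < w) : lenBase w = 2 ^ (Nat.log 2 w + 1) := by
  refine min_eq_right ?_
  have := Nat.pow_log_le_self 2 hw.ne'
  rw [pow_succ]; omega

@[fun_prop] theorem LS.lenBase {f : α → ℕ} (hf : LS f) : LS (fun a => lenBase (f a)) := by
  unfold _root_.lenBase
  fun_prop

/-- The word number `w` occurs in the table `W` of codes of slices, written in base `b`. -/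
def TableMem (b W w : ℕ) : Prop :=
  0 < w ∧ ∃ i < W + 1, digit (lenBase w) i (digit b (Nat.log 2 w) W) = w

@[fun_prop] theorem LSP.tableMem {f g h : α → ℕ} (hf : LS f) (hg : LS g) (hh : LS h) :
    LSP (fun a => TableMem (f a) (g a) (h a)) := by
  unfold TableMem
  fun_prop

/-- A digit never exceeds the number it belongs to, so quantifiers over the words of a table can be
bounded by the table. -/
theorem TableMem.le {b W w : ℕ} (h : TableMem b W w) : w ≤ W := by
  obtain ⟨-, i, -, h⟩ := h
  rw [← h]
  exact (digit_le _ _ _).trans (digit_le _ _ _)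

/-- The oracle of a table. -/
def tableSet (b W : ℕ) : Set (List Bool) := {x | TableMem b W (wordNum x)}

/-! ### Words on tapes as digits of numbers -/

section Spells

variable {Aux : Type} [Finite Aux]

/-- The digits of `Y` spell the word number `w`. -/
def SpellsNum (Aux : Type) [Finite Aux] (Y w : ℕ) : Prop :=
  (∀ i < Nat.log 2 w, digit (symBase Aux) i Y =
    if digit 2 i w = 1 then symCode (Aux := Aux) (some (.inl true))
    else symCode (Aux := Aux) (some (.inl false))) ∧
  ∀ b : Bool, digit (symBase Aux) (Nat.log 2 w) Y ≠ symCode (Aux := Aux) (some (.inl b))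

@[fun_prop] theorem LSP.spellsNum {f g : α → ℕ} (hf : LS f) (hg : LS g) :
    LSP (fun a => SpellsNum Aux (f a) (g a)) := by
  unfold SpellsNum
  refine LSP.and (by fun_prop) (LSP.forall_finite fun b => by fun_prop)

theorem symCode_bit (b : Bool) : (if b.toNat = 1 then symCode (Aux := Aux) (some (.inl true))
    else symCode (Aux := Aux) (some (.inl false))) = symCode (Aux := Aux) (some (.inl b)) := by
  cases b <;> simp

theorem spellsNum_iff {Y : ℕ} {tape : ℤ → TapeSymbol Aux}
    (h : ∀ k : ℕ, digit (symBase Aux) k Y = symCode (tape k)) (l : List Bool) :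
    SpellsNum Aux Y (wordNum l) ↔ OracleTM.Spells tape l := by
  unfold SpellsNum OracleTM.Spells
  rw [log_wordNum]
  refine and_congr ⟨fun h1 i hi => ?_, fun h1 i hi => ?_⟩ (forall_congr' fun b => ?_)
  · have := h1 i hi
    rw [h, digit_wordNum l i hi, symCode_bit] at this
    exact symCode_injective this
  · rw [h, digit_wordNum l i hi, symCode_bit, h1 i hi]
  · rw [h, ne_eq, symCode_injective.eq_iff]

/-- The digits of the tape that holds a word. -/
noncomputable def tapeNum (Aux : Type) [Finite Aux] (w : ℕ) : ℕ :=
  sInf {Y | Y < (w + 1) ^ symBase Aux + 1 ∧ (SpellsNum Aux Y w ∧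
    divPow Y (symBase Aux) (Nat.log 2 w) = 0)}

@[fun_prop] theorem LS.tapeNum {f : α → ℕ} (hf : LS f) : LS (fun a => tapeNum Aux (f a)) := by
  have : LS (_root_.tapeNum Aux) := by
    refine LS.sInf_lt (P := fun w Y => SpellsNum Aux Y w ∧
      _root_.divPow Y (symBase Aux) (Nat.log 2 w) = 0) (by fun_prop) (by fun_prop)
  exact this.comp hf

/-- `tapeNum` is defined by minimization, so that its computability comes for free. What remains is
a candidate below the search bound, and the fact that the two conditions determine all digits. -/
theorem digit_tapeNum (l : List Bool) (k : ℕ) :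
    digit (symBase Aux) k (tapeNum Aux (wordNum l)) =
      symCode (Aux := Aux) (OracleTM.wordTape l (k : ℤ)) := by
  have hB := one_lt_symBase (Aux := Aux)
  have hex : ∃ Y, Y < symBase Aux ^ l.length ∧
      ∀ k : ℕ, digit (symBase Aux) k Y = symCode (Aux := Aux) (OracleTM.wordTape l (k : ℤ)) := by
    induction l with
    | nil => exact ⟨0, by simp, fun k => by simp [digit_zero_right, OracleTM.wordTape, symCode]⟩
    | cons b l ih =>
      obtain ⟨Y, h1, h2⟩ := ih
      have hb := symCode_lt (Aux := Aux) (some (.inl b))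
      refine ⟨symCode (Aux := Aux) (some (.inl b)) + symBase Aux * Y, ?_, fun k => ?_⟩
      · rw [List.length_cons, pow_succ']
        have := Nat.mul_le_mul_left (symBase Aux) (Nat.succ_le_of_lt h1)
        rw [Nat.mul_succ] at this
        omega
      · cases k with
        | zero => rw [digit_cons_zero hb]; simp [OracleTM.wordTape]
        | succ k =>
          rw [digit_cons_succ hb, h2]
          have : (0 : ℤ) ≤ (k : ℤ) + 1 := by omega
          have h3 : ((k : ℤ) + 1).toNat = k + 1 := by omega
          simp [OracleTM.wordTape, this, h3]
  obtain ⟨Y, h1, h2⟩ := hex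
  have hY : Y ∈ {Y | Y < (wordNum l + 1) ^ symBase Aux + 1 ∧ (SpellsNum Aux Y (wordNum l) ∧
      divPow Y (symBase Aux) (Nat.log 2 (wordNum l)) = 0)} := by
    refine ⟨?_, (spellsNum_iff (tape := OracleTM.wordTape l) h2 l).2 ⟨fun i hi => ?_, ?_⟩, ?_⟩
    -- Here the search bound is justified: a change of base turns a power with exponent `l.length`
    -- into a fixed power of the word number.
    · have h3 : symBase Aux ^ l.length ≤ (wordNum l + 1) ^ symBase Aux := by
        calc symBase Aux ^ l.length ≤ (2 ^ symBase Aux) ^ l.length :=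
              Nat.pow_le_pow_left Nat.lt_two_pow_self.le _
          _ = (2 ^ l.length) ^ symBase Aux := by rw [← pow_mul, ← pow_mul, mul_comm]
          _ ≤ (wordNum l + 1) ^ symBase Aux :=
              Nat.pow_le_pow_left ((le_wordNum l).trans (by omega)) _
      omega
    · simp [OracleTM.wordTape]
    · intro b; simp [OracleTM.wordTape]
    · rw [log_wordNum]; exact Nat.div_eq_of_lt h1
  obtain ⟨-, h4, h5⟩ := Nat.sInf_mem (s := {Y | Y < (wordNum l + 1) ^ symBase Aux + 1 ∧
    (SpellsNum Aux Y (wordNum l) ∧ divPow Y (symBase Aux) (Nat.log 2 (wordNum l)) = 0)}) ⟨Y, hY⟩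
  change SpellsNum Aux (tapeNum Aux (wordNum l)) _ at h4
  change divPow (tapeNum Aux (wordNum l)) _ _ = 0 at h5
  rw [log_wordNum] at h5
  rcases Nat.lt_or_ge k l.length with hk | hk
  · have := h4.1 k (by rw [log_wordNum]; exact hk)
    rw [this, digit_wordNum l k hk, symCode_bit]
    simp [OracleTM.wordTape, List.getElem?_eq_getElem hk]
  · have h6 : OracleTM.wordTape (Aux := Aux) l (k : ℤ) = none := by
      simp [OracleTM.wordTape, hk]
    rw [h6]
    have h7 : tapeNum Aux (wordNum l) < symBase Aux ^ l.length :=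
      (Nat.div_eq_zero_iff_lt (by positivity)).1 h5
    simp [digit, symCode, Nat.div_eq_of_lt (h7.trans_le (Nat.pow_le_pow_right (by omega) hk))]

end Spells

/-! ### Configurations and runs as numbers -/

section Simulation

variable (M : OracleTM)

/-- Simulated configurations: the state and, for every tape, its contents and the position of the
head, as a number in base `symBase M.Aux` and a power of that base. -/
abbrev Sim : Type := M.State × (TapeName M.Work → ℕ × ℕ)

/-- Write a symbol and move the head. -/
noncomputable def tapeStep (Q : ℕ) (x : ℕ × ℕ) (a : TapeSymbol M.Aux × SignType) : ℕ × ℕ :=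
  (x.1 + symCode a.1 * x.2 - x.1 / x.2 % symBase M.Aux * x.2,
    -- The cap keeps the position polynomially bounded for arbitrary arguments. With `Q = symBase ^
    -- q` it is not effective during the first `q` steps, where the head is at digit at most `2 *
    -- q`.
    if a.2 = 1 then (if x.2 * symBase M.Aux ≤ Q * Q then x.2 * symBase M.Aux else x.2)
    else if a.2 = -1 then x.2 / symBase M.Aux else x.2)

/-- The word on the query tape occurs in the table. -/
def QueryHit (Q b W X : ℕ) : Prop :=
  ∃ w < W + 1, TableMem b W w ∧ SpellsNum M.Aux (X / Q) w

open Classical in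
/-- One simulated step, with the oracle given by the table `W` in base `b`. -/
noncomputable def simStep (Q b W : ℕ) (s : Sim M) : Sim M :=
  match M.verdict s.1 with
  | some _ => s
  | none =>
    match M.ask s.1 with
    | some (y, n) => (if QueryHit M Q b W (s.2 .query).1 then y else n, s.2)
    | none =>
      let a := M.trans s.1 (fun i => symOf ((s.2 i).1 / (s.2 i).2 % symBase M.Aux))
      (a.1, fun i => tapeStep M Q (s.2 i) (a.2 i))

/-- The simulated initial configuration. -/
noncomputable def simInit (Q p x : ℕ) : Sim M :=
  (M.start, fun i => match i with
    -- Multiplication by `Q = symBase ^ q` shifts cell `z` to digit `z + q` and leaves room for `q`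
    -- cells on the left of cell 0.
    | .program => (Q * tapeNum M.Aux p, Q)
    | .input => (Q * tapeNum M.Aux x, Q)
    | _ => (0, Q))

/-- The simulated run. -/
noncomputable def simRun (Q b W p x s : ℕ) : Sim M := (simStep M Q b W)^[s] (simInit M Q p x)

variable {M}

theorem LS.tapeStep {Q : α → ℕ} {f : α → ℕ × ℕ} {g : α → TapeSymbol M.Aux × SignType} (hQ : LS Q)
    (hf : LS f) (hg : LS g) : LS (fun a => tapeStep M (Q a) (f a) (g a)) := by
  unfold _root_.tapeStep
  fun_prop

theorem LSP.queryHit {Q b W X : α → ℕ} (hQ : LS Q) (hb : LS b) (hW : LS W) (hX : LS X) :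
    LSP (fun a => QueryHit M (Q a) (b a) (W a) (X a)) := by
  unfold QueryHit
  fun_prop

theorem LS.simStep {Q b W : α → ℕ} {s : α → Sim M} (hQ : LS Q) (hb : LS b) (hW : LS W)
    (hs : LS s) : LS (fun a => simStep M (Q a) (b a) (W a) (s a)) := by
  classical
  have h : LS (fun x : (ℕ × ℕ × ℕ) × Sim M => _root_.simStep M x.1.1 x.1.2.1 x.1.2.2 x.2) := by
    let F : M.State → (ℕ × ℕ × ℕ) × Sim M → Sim M := fun j x =>
      match M.verdict j with
      | some _ => x.2
      | none =>
        match M.ask j with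
        | some (y, n) => (if QueryHit M x.1.1 x.1.2.1 x.1.2.2 (x.2.2 .query).1 then y else n, x.2.2)
        | none =>
          let a := M.trans j (fun i => symOf ((x.2.2 i).1 / (x.2.2 i).2 % symBase M.Aux))
          (a.1, fun i => _root_.tapeStep M x.1.1 (x.2.2 i) (a.2 i))
    have htape : ∀ i, LS (fun x : (ℕ × ℕ × ℕ) × Sim M => x.2.2 i) := fun i =>
      (LS.eval i).comp (f := fun x : (ℕ × ℕ × ℕ) × Sim M => x.2.2) (by fun_prop)
    have hF : ∀ j, LS (F j) := by
      intro j
      simp only [F]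
      rcases M.verdict j with _ | v
      · rcases M.ask j with _ | ⟨y, n⟩
        · have hscan : LS (fun (x : (ℕ × ℕ × ℕ) × Sim M) i =>
              (symOf ((x.2.2 i).1 / (x.2.2 i).2 % symBase M.Aux) : TapeSymbol M.Aux)) :=
            LS.pi fun i => by
              have := htape i
              exact LS.symOf_mod (by fun_prop)
          have ha : LS (fun x : (ℕ × ℕ × ℕ) × Sim M => M.trans j (fun i =>
              (symOf ((x.2.2 i).1 / (x.2.2 i).2 % symBase M.Aux)))) :=
            (LS.of_finite (M.trans j)).comp hscan
          refine LS.mk ha.fst (LS.pi fun i => ?_)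
          exact LS.tapeStep (by fun_prop) (htape i) ((LS.eval i).comp ha.snd)
        · refine LS.mk (LS.ite (LSP.queryHit (by fun_prop) (by fun_prop) (by fun_prop)
            (htape .query).fst) (by fun_prop) (by fun_prop)) (by fun_prop)
      · dsimp only
        fun_prop
    exact LS.finite_arg (i := fun x : (ℕ × ℕ × ℕ) × Sim M => x.2.1) (by fun_prop) hF
  exact h.comp (f := fun a => ((Q a, b a, W a), s a)) (by fun_prop)

theorem LS.simInit {Q p x : α → ℕ} (hQ : LS Q) (hp : LS p) (hx : LS x) :
    LS (fun a => simInit M (Q a) (p a) (x a)) := by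
  unfold _root_.simInit
  refine LS.mk (by fun_prop) (LS.pi fun i => ?_)
  cases i <;> simp only <;> fun_prop

/-- No relation to an actual run is assumed: `LS` requires polynomial bounds for all arguments, also
for those that represent no configuration. -/
theorem simStep_bound (Q b W : ℕ) (s : Sim M) (i : TapeName M.Work) :
    ((simStep M Q b W s).2 i).2 ≤ max (s.2 i).2 (Q * Q) ∧
    ((simStep M Q b W s).2 i).1 ≤ (s.2 i).1 + symBase M.Aux * (s.2 i).2 := by
  unfold simStep
  split
  · simp
  · split
    · simp
    · dsimp only [tapeStep]
      set a := (M.trans s.1 fun i => symOf ((s.2 i).1 / (s.2 i).2 % symBase M.Aux)).2 i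
      constructor
      · split_ifs with h1 h2
        · exact h2.trans (le_max_right _ _)
        · exact le_max_left _ _
        · exact (Nat.div_le_self _ _).trans (le_max_left _ _)
        · exact le_max_left _ _
      · refine (Nat.sub_le _ _).trans ?_
        have := Nat.mul_le_mul_right (s.2 i).2 (symCode_lt a.1).le
        omega

theorem simRun_bound (Q b W p x s : ℕ) (i : TapeName M.Work) :
    ((simRun M Q b W p x s).2 i).2 ≤ Q + Q * Q ∧
    ((simRun M Q b W p x s).2 i).1 ≤
      ((simInit M Q p x).2 i).1 + s * (symBase M.Aux * (Q + Q * Q)) := by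
  induction s with
  | zero =>
    refine ⟨?_, by simp [simRun]⟩
    have : ((simInit M Q p x).2 i).2 = Q := by cases i <;> rfl
    simp [simRun, this]
  | succ s ih =>
    have h := simStep_bound Q b W (simRun M Q b W p x s) i
    have h1 : simRun M Q b W p x (s + 1) = simStep M Q b W (simRun M Q b W p x s) :=
      Function.iterate_succ_apply' _ _ _
    rw [h1]
    refine ⟨h.1.trans (max_le ih.1 (by omega)), h.2.trans ?_⟩
    have := Nat.mul_le_mul_left (symBase M.Aux) ih.1
    rw [Nat.succ_mul]
    omega

theorem LS.simRun {Q b W p x s : α → ℕ} (hQ : LS Q) (hb : LS b) (hW : LS W) (hp : LS p)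
    (hx : LS x) (hs : LS s) :
    LS (fun a => simRun M (Q a) (b a) (W a) (p a) (x a) (s a)) := by
  let step : (ℕ × ℕ × ℕ) × Sim M → (ℕ × ℕ × ℕ) × Sim M := fun y =>
    (y.1, _root_.simStep M y.1.1 y.1.2.1 y.1.2.2 y.2)
  have hstep : LS step := LS.mk (by fun_prop)
    (LS.simStep (by fun_prop) (by fun_prop) (by fun_prop) (by fun_prop))
  have hI : LS (fun a => _root_.simInit M (Q a) (p a) (x a)) := LS.simInit hQ hp hx
  have key : ∀ a i, step^[i] ((Q a, b a, W a), _root_.simInit M (Q a) (p a) (x a)) =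
      ((Q a, b a, W a), _root_.simRun M (Q a) (b a) (W a) (p a) (x a) i) := by
    intro a i
    induction i with
    | zero => rfl
    | succ i ih =>
      rw [Function.iterate_succ_apply', ih]
      simp only [step, _root_.simRun, Function.iterate_succ_apply']
  have hbound : LS (fun a => (((Q a, b a, W a), _root_.simInit M (Q a) (p a) (x a)),
      Q a + Q a * Q a, s a * (symBase M.Aux * (Q a + Q a * Q a)))) := by fun_prop
  obtain ⟨c, hc⟩ := hbound.1
  have h := LS.iterate (n := s) (init := fun a => ((Q a, b a, W a),
    _root_.simInit M (Q a) (p a) (x a))) hs (by fun_prop) hstep ⟨c + 1 + Nat.card M.State, by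
      intro a B hB i hi
      rw [key]
      have h0 := hc a B hB
      simp only [below_prod, below_nat] at h0
      obtain ⟨⟨⟨h1, h2, h3⟩, h4, h5⟩, h6, h7⟩ := h0
      have hm : (B + 2) ^ c ≤ (B + 2) ^ (c + 1 + Nat.card M.State) :=
        pow_bound_mono B (by omega)
      refine below_prod.2 ⟨?_, below_prod.2 ⟨fun r => ?_, below_pi.2 fun j => ?_⟩⟩
      · simp only [below_prod, below_nat]
        exact ⟨h1.trans hm, h2.trans hm, h3.trans hm⟩
      · have h8 : code (_root_.simRun M (Q a) (b a) (W a) (p a) (x a) i).1 r < Nat.card M.State :=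
          (Finite.equivFin M.State _).2
        exact (h8.trans (Nat.lt_pow_self (by omega : 1 < B + 2))).le.trans
          (pow_bound_mono B (by omega))
      · have h8 := simRun_bound (M := M) (Q a) (b a) (W a) (p a) (x a) i j
        have h9 := below_pi.1 h5 j
        simp only [below_prod, below_nat] at h9 ⊢
        refine ⟨?_, (h8.1.trans h6).trans hm⟩
        have h10 := Nat.mul_le_mul_right (symBase M.Aux * (Q a + Q a * Q a)) hi
        have h11 : 2 * (B + 2) ^ c ≤ (B + 2) ^ (c + 1 + Nat.card M.State) := by
          have : (B + 2) ^ (c + 1) ≤ (B + 2) ^ (c + 1 + Nat.card M.State) :=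
            pow_bound_mono B (by omega)
          rw [pow_succ] at this
          nlinarith [Nat.zero_le ((B + 2) ^ c)]
        omega⟩
  simp only [key] at h
  exact h.snd

/-- The verdict of a simulated run. -/
noncomputable def simVerdict (M : OracleTM) (Q b W p x s : ℕ) : Option Bool :=
  M.verdict (simRun M Q b W p x s).1

@[fun_prop] theorem LS.simVerdict {Q b W p x s : α → ℕ} (hQ : LS Q) (hb : LS b) (hW : LS W)
    (hp : LS p) (hx : LS x) (hs : LS s) :
    LS (fun a => simVerdict M (Q a) (b a) (W a) (p a) (x a) (s a)) :=
  (LS.of_finite M.verdict).comp (LS.simRun hQ hb hW hp hx hs).fst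

/-- The simulated configuration represents a configuration whose heads are at distance at most `k`
from their first cells. -/
structure SimRep (q k : ℕ) (c : M.Config) (s : Sim M) : Prop where
  state : s.1 = c.state
  tape : ∀ i, ∀ j : ℕ, digit (symBase M.Aux) j (s.2 i).1 = symCode (c.cells i ((j : ℤ) - q))
  pos : ∀ i, ∃ h : ℕ, (h : ℤ) = c.head i + q ∧ (s.2 i).2 = symBase M.Aux ^ h
  near : ∀ i, (c.head i).natAbs ≤ k

theorem SimRep.mono {q k k' : ℕ} {c : M.Config} {s : Sim M} (h : SimRep q k c s) (hk : k ≤ k') :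
    SimRep q k' c s := ⟨h.state, h.tape, h.pos, fun i => (h.near i).trans hk⟩

theorem SimRep.scan {q k : ℕ} {c : M.Config} {s : Sim M} (h : SimRep q k c s)
    (i : TapeName M.Work) :
    (s.2 i).1 / (s.2 i).2 % symBase M.Aux = symCode (c.cells i (c.head i)) := by
  obtain ⟨m, hm, hP⟩ := h.pos i
  rw [hP]
  have := h.tape i m
  unfold digit at this
  rw [this, hm]
  simp

theorem SimRep.queryHit {q k : ℕ} {c : M.Config} {s : Sim M} (h : SimRep q k c s) (b W : ℕ) :
    QueryHit M (symBase M.Aux ^ q) b W (s.2 .query).1 ↔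
      ∃ w ∈ tableSet b W, OracleTM.Spells (c.cells .query) w := by
  have hd : ∀ j : ℕ, digit (symBase M.Aux) j ((s.2 .query).1 / symBase M.Aux ^ q) =
      symCode (c.cells .query (j : ℤ)) := by
    intro j
    rw [digit_div_pow, h.tape]
    congr 2
    push_cast
    ring
  constructor
  · rintro ⟨w, -, h1, h2⟩
    have hw := wordNum_numWord h1.1
    rw [← hw] at h1 h2
    exact ⟨numWord w, h1, (spellsNum_iff hd _).1 h2⟩
  · rintro ⟨w, h1, h2⟩
    exact ⟨wordNum w, Nat.lt_succ_of_le (TableMem.le h1), h1, (spellsNum_iff hd w).2 h2⟩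

/-- As long as `k < q`, the heads are strictly inside the window of digits. Hence a move to the left
divides exactly and a move to the right is not capped. -/
theorem SimRep.step {q k : ℕ} {c : M.Config} {s : Sim M} (h : SimRep q k c s) (hk : k < q)
    (b W : ℕ) : SimRep q (k + 1) (M.step (tableSet b W) c)
      (simStep M (symBase M.Aux ^ q) b W s) := by
  classical
  have hB := one_lt_symBase (Aux := M.Aux)
  unfold OracleTM.step simStep
  rw [h.state]
  rcases M.verdict c.state with _ | v
  · rcases M.ask c.state with _ | ⟨y, n⟩
    rotate_left
    · refine ⟨?_, h.tape, h.pos, fun i => (h.near i).trans (by omega)⟩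
      have := h.queryHit b W
      dsimp only
      by_cases h1 : QueryHit M (symBase M.Aux ^ q) b W (s.2 .query).1
      · rw [if_pos h1, if_pos (this.1 h1)]
      · rw [if_neg h1, if_neg fun h2 => h1 (this.2 h2)]
    · have hscan : (fun i => (symOf ((s.2 i).1 / (s.2 i).2 % symBase M.Aux) : TapeSymbol M.Aux)) =
          fun i => c.cells i (c.head i) := by
        funext i
        rw [h.scan, symOf_symCode]
      rw [hscan]
      dsimp only
      set a := M.trans c.state fun i => c.cells i (c.head i)
      refine ⟨rfl, fun i j => ?_, fun i => ?_, fun i => ?_⟩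
      · obtain ⟨m, hm, hP⟩ := h.pos i
        have h1 : (s.2 i).1 / (s.2 i).2 % symBase M.Aux = digit (symBase M.Aux) m (s.2 i).1 := by
          rw [hP]; rfl
        dsimp only [tapeStep]
        rw [h1, hP, digit_set (symCode_lt _), h.tape]
        by_cases h2 : j = m
        · rw [if_pos h2, if_pos (by omega)]
        · rw [if_neg h2, if_neg (by omega)]
      · obtain ⟨m, hm, hP⟩ := h.pos i
        have hn := h.near i
        dsimp only [tapeStep]
        rcases ha : (a.2 i).2 with _ | _ | _
        · refine ⟨m, ?_, ?_⟩
          · change (m : ℤ) = c.head i + ((0 : SignType) : ℤ) + q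
            simp; omega
          · change (if (0 : SignType) = 1 then _ else if (0 : SignType) = -1 then _ else _) = _
            rw [if_neg (by decide), if_neg (by decide), hP]
        · obtain ⟨m', rfl⟩ : ∃ m', m = m' + 1 := ⟨m - 1, by omega⟩
          refine ⟨m', ?_, ?_⟩
          · change (m' : ℤ) = c.head i + ((-1 : SignType) : ℤ) + q
            simp; omega
          · change (if (-1 : SignType) = 1 then _ else if (-1 : SignType) = -1 then _ else _) = _
            rw [if_neg (by decide), if_pos rfl, hP, pow_succ, Nat.mul_div_cancel _ (by omega)]
        · refine ⟨m + 1, ?_, ?_⟩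
          · change ((m + 1 : ℕ) : ℤ) = c.head i + ((1 : SignType) : ℤ) + q
            simp; omega
          · change (if (1 : SignType) = 1 then _ else if (1 : SignType) = -1 then _ else _) = _
            rw [if_pos rfl, hP, ← pow_succ, ← pow_add, if_pos]
            exact Nat.pow_le_pow_right (by omega) (by omega)
      · have hn := h.near i
        change (c.head i + ((a.2 i).2 : ℤ)).natAbs ≤ k + 1
        rcases ha : (a.2 i).2 with _ | _ | _
        · change (c.head i + ((0 : SignType) : ℤ)).natAbs ≤ k + 1
          simp; omega
        · change (c.head i + ((-1 : SignType) : ℤ)).natAbs ≤ k + 1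
          simp; omega
        · change (c.head i + ((1 : SignType) : ℤ)).natAbs ≤ k + 1
          simp; omega
  · exact h.mono (by omega)

theorem simInit_rep (q : ℕ) (p x : List Bool) :
    SimRep q 0 (M.init p x) (simInit M (symBase M.Aux ^ q) (wordNum p) (wordNum x)) := by
  have hB := one_lt_symBase (Aux := M.Aux)
  have hword : ∀ (l : List Bool) (j : ℕ),
      digit (symBase M.Aux) j (symBase M.Aux ^ q * tapeNum M.Aux (wordNum l)) =
        symCode (OracleTM.wordTape (Aux := M.Aux) l ((j : ℤ) - q)) := by
    intro l j
    rw [digit_mul_pow _ _ _ _ (by omega)]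
    split_ifs with h
    · have : ¬ (0 : ℤ) ≤ (j : ℤ) - q := by omega
      simp only [OracleTM.wordTape, this, if_false]
      rfl
    · rw [digit_tapeNum]
      congr 2
      omega
  refine ⟨rfl, fun i j => ?_, fun i => ⟨q, by simp [OracleTM.init], by cases i <;> rfl⟩,
    fun i => by simp [OracleTM.init]⟩
  cases i with
  | program => exact hword p j
  | input => exact hword x j
  | query => exact digit_zero_right _ _
  | output => exact digit_zero_right _ _
  | work w => exact digit_zero_right _ _

theorem simRun_rep {q s : ℕ} (hs : s ≤ q) (b W : ℕ) (p x : List Bool) :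
    SimRep q s (M.run (tableSet b W) p x s)
      (simRun M (symBase M.Aux ^ q) b W (wordNum p) (wordNum x) s) := by
  induction s with
  | zero => exact simInit_rep q p x
  | succ s ih =>
    have := (ih (by omega)).step (by omega) b W
    unfold OracleTM.run simRun
    rw [Function.iterate_succ_apply', Function.iterate_succ_apply']
    exact this

theorem simVerdict_eq {q s : ℕ} (hs : s ≤ q) (b W : ℕ) (p x : List Bool) :
    simVerdict M (symBase M.Aux ^ q) b W (wordNum p) (wordNum x) s =
      M.verdictAt (tableSet b W) p x s := by
  unfold simVerdict OracleTM.verdictAt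
  rw [(simRun_rep hs b W p x).state]

end Simulation

/-! ### Combinatorics -/

/-- In a large family of subsets of a set with fewer than `N (N + 1) / 2` elements, some member is
covered by at most `N - 1` others. -/
theorem exists_covered {V : Type} [DecidableEq V] (Ω : Finset V) (S : V → Finset ℕ) (P N : ℕ)
    (hS : ∀ x ∈ Ω, S x ⊆ Finset.range P) (hP : 2 * P < N * (N + 1)) (hΩ : P + N ≤ Ω.card) :
    ∃ x ∈ Ω, ∃ Y ⊆ Ω, x ∉ Y ∧ Y.card < N ∧ S x ⊆ Y.biUnion S := by
  classical
  by_contra hcon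
  push Not at hcon
  -- Private elements of different members are different, so at most `P` members have one. At least
  -- `N` members have none, and each element of such a member lies in another member.
  let isPriv : V → ℕ → Prop := fun x p => p ∈ S x ∧ ∀ y ∈ Ω, y ≠ x → p ∉ S y
  let Ω' := Ω.filter fun x => ¬ ∃ p, isPriv x p
  have hpriv : (Ω.filter fun x => ∃ p, isPriv x p).card ≤ P := by
    have h : ∀ x ∈ Ω.filter fun x => ∃ p, isPriv x p, ∃ p, isPriv x p := fun x hx =>
      (Finset.mem_filter.1 hx).2
    choose! f hf using h
    rw [← Finset.card_range P]
    refine Finset.card_le_card_of_injOn f (fun x hx => ?_) fun x hx y hy hxy => ?_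
    · exact hS x (Finset.mem_filter.1 hx).1 (hf x hx).1
    · by_contra hne
      refine (hf y hy).2 x (Finset.mem_filter.1 hx).1 hne ?_
      rw [← hxy]
      exact (hf x hx).1
  have hΩ' : N ≤ Ω'.card := by
    have := Finset.card_filter_add_card_filter_not (s := Ω) (fun x => ∃ p, isPriv x p)
    change _ + Ω'.card = _ at this
    omega
  -- Greedy choice: if no member has the desired cover, the chosen members contribute at least `N`,
  -- `N - 1`, …, `1` new elements, in total `N * (N + 1) / 2`, which is more than `P`.
  have step : ∀ k ≤ N, ∃ Z ⊆ Ω', Z.card = k ∧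
      2 * N * k + k ≤ 2 * (Z.biUnion S).card + k * k := by
    intro k
    induction k with
    | zero => intro _; exact ⟨∅, by simp, by simp, by simp⟩
    | succ k ih =>
      intro hk
      obtain ⟨Z, hZ, hZk, hZS⟩ := ih (by omega)
      obtain ⟨x, hx, hxZ⟩ : ∃ x ∈ Ω', x ∉ Z := by
        by_contra h
        push Not at h
        have := Finset.card_le_card (show Ω' ⊆ Z from h)
        omega
      have hxΩ := (Finset.mem_filter.1 hx).1
      have hxp := (Finset.mem_filter.1 hx).2
      -- Otherwise `Z`, together with one other member for each of the fewer than `N - k` new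
      -- elements, covers `S x` by fewer than `N` members.
      have hnew : N - k ≤ (S x \ Z.biUnion S).card := by
        by_contra hlt
        have h : ∀ p ∈ S x, ∃ y ∈ Ω, y ≠ x ∧ p ∈ S y := by
          intro p hp
          by_contra h
          push Not at h
          exact hxp ⟨p, hp, h⟩
        have : Nonempty V := ⟨x⟩
        choose! g hg using h
        refine hcon x hxΩ (Z ∪ (S x \ Z.biUnion S).image g) ?_ ?_ ?_ ?_
        · refine Finset.union_subset (hZ.trans (Finset.filter_subset _ _)) ?_
          intro y hy
          obtain ⟨p, hp, rfl⟩ := Finset.mem_image.1 hy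
          exact (hg p (Finset.mem_sdiff.1 hp).1).1
        · intro h
          rcases Finset.mem_union.1 h with h | h
          · exact hxZ h
          · obtain ⟨p, hp, hpx⟩ := Finset.mem_image.1 h
            exact (hg p (Finset.mem_sdiff.1 hp).1).2.1 hpx
        · have h1 := Finset.card_union_le Z ((S x \ Z.biUnion S).image g)
          have h2 := Finset.card_image_le (s := S x \ Z.biUnion S) (f := g)
          omega
        · intro p hp
          by_cases h : p ∈ Z.biUnion S
          · obtain ⟨y, hy, hpy⟩ := Finset.mem_biUnion.1 h
            exact Finset.mem_biUnion.2 ⟨y, Finset.mem_union_left _ hy, hpy⟩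
          · exact Finset.mem_biUnion.2 ⟨g p, Finset.mem_union_right _
              (Finset.mem_image_of_mem _ (Finset.mem_sdiff.2 ⟨hp, h⟩)), (hg p hp).2.2⟩
      refine ⟨insert x Z, Finset.insert_subset hx hZ, by
        rw [Finset.card_insert_of_notMem hxZ, hZk], ?_⟩
      have hcard : ((insert x Z).biUnion S).card = (S x \ Z.biUnion S).card +
          (Z.biUnion S).card := by
        rw [Finset.biUnion_insert, ← Finset.card_sdiff_add_card]
      rw [hcard]
      obtain ⟨d, rfl⟩ := Nat.exists_eq_add_of_le hk
      have : k + 1 + d - k = d + 1 := by omega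
      rw [this] at hnew
      nlinarith
  obtain ⟨Z, hZ, -, h⟩ := step N le_rfl
  have hle : (Z.biUnion S).card ≤ P := by
    rw [← Finset.card_range P]
    refine Finset.card_le_card (Finset.biUnion_subset.2 fun x hx => hS x ?_)
    exact (Finset.mem_filter.1 (hZ hx)).1
  nlinarith

/-- A digraph of outdegree at most `δ` on at least `(2 δ + 1) r` vertices has an independent set of
size `r`. -/
theorem exists_independent {V : Type} [DecidableEq V] (R : V → V → Prop) (δ r : ℕ) (Ω : Finset V)
    (hout : ∀ x ∈ Ω, ∀ F ⊆ Ω, (∀ y ∈ F, R x y) → F.card ≤ δ) (hr : (2 * δ + 1) * r ≤ Ω.card) :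
    ∃ I ⊆ Ω, I.card = r ∧ ∀ x ∈ I, ∀ y ∈ I, x ≠ y → ¬ R x y := by
  classical
  induction r generalizing Ω with
  | zero => exact ⟨∅, by simp, by simp, by simp⟩
  | succ r ih =>
    have hne : Ω.Nonempty := by
      rw [← Finset.card_pos]
      exact lt_of_lt_of_le (by positivity) hr
    -- Indegrees and outdegrees have the same sum, so some vertex has indegree at most `δ`.
    obtain ⟨v, hv, hin⟩ : ∃ v ∈ Ω, (Ω.filter fun x => R x v).card ≤ δ := by
      refine Finset.exists_le_of_sum_le (f := fun v => (Ω.filter fun x => R x v).card)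
        (g := fun _ => δ) hne ?_
      have h := Finset.sum_card_bipartiteAbove_eq_sum_card_bipartiteBelow (s := Ω) (t := Ω) R
      simp only [Finset.bipartiteAbove, Finset.bipartiteBelow] at h
      rw [← h]
      exact Finset.sum_le_sum fun x hx => hout x hx _ (Finset.filter_subset _ _)
        fun y hy => (Finset.mem_filter.1 hy).2
    -- Choosing `v` costs `v` itself, at most `δ` predecessors and at most `δ` successors.
    set bad := insert v ((Ω.filter fun x => R x v) ∪ Ω.filter fun x => R v x) with hbad
    have hbadc : bad.card ≤ 2 * δ + 1 := by
      have h1 : bad.card ≤ _ := Finset.card_insert_le v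
        ((Ω.filter fun x => R x v) ∪ Ω.filter fun x => R v x)
      have h2 := Finset.card_union_le (Ω.filter fun x => R x v) (Ω.filter fun x => R v x)
      have h3 := hout v hv _ (Finset.filter_subset (fun x => R v x) Ω)
        fun y hy => (Finset.mem_filter.1 hy).2
      omega
    obtain ⟨I, hI, hIr, hind⟩ := ih (Ω \ bad)
      (fun x hx F hF hR => hout x (Finset.mem_sdiff.1 hx).1 F (hF.trans Finset.sdiff_subset) hR)
      (by
        have := Finset.le_card_sdiff bad Ω
        rw [Nat.mul_succ] at hr
        omega)
    have hvI : ∀ y ∈ I, y ≠ v ∧ ¬ R y v ∧ ¬ R v y := by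
      intro y hy
      obtain ⟨h1, h2⟩ := Finset.mem_sdiff.1 (hI hy)
      simp only [hbad, Finset.mem_insert, Finset.mem_union, Finset.mem_filter, not_or,
        not_and] at h2
      exact ⟨h2.1, h2.2.1 h1, h2.2.2 h1⟩
    refine ⟨insert v I, Finset.insert_subset hv (hI.trans Finset.sdiff_subset), ?_, ?_⟩
    · rw [Finset.card_insert_of_notMem fun h => (hvI v h).1 rfl, hIr]
    · intro x hx y hy hxy
      rcases Finset.mem_insert.1 hx with hx' | hx' <;> rcases Finset.mem_insert.1 hy with hy' | hy'
      · exact absurd (hx'.trans hy'.symm) hxy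
      · rw [hx']; exact (hvI y hy').2.2
      · rw [hy']; exact (hvI x hx').2.1
      · exact hind x hx' y hy' hxy

/-! ### Queries -/

/-- This is why every step contributes at most one query, and why `T` steps can see at most `T`
words. -/
theorem OracleTM.Spells.unique {Aux : Type} {tape : ℤ → TapeSymbol Aux} {l l' : List Bool}
    (h : OracleTM.Spells tape l) (h' : OracleTM.Spells tape l') : l = l' := by
  have key : ∀ {l l' : List Bool}, OracleTM.Spells tape l → OracleTM.Spells tape l' →
      l'.length ≤ l.length := by
    intro l l' h h'
    by_contra hlt
    push Not at hlt
    exact h.2 _ (h'.1 l.length hlt)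
  refine List.ext_getElem (le_antisymm (key h' h) (key h h')) fun i h1 h2 => ?_
  have := (h.1 i h1).symm.trans (h'.1 i h2)
  simpa using this

section Queries

variable (M : OracleTM)

/-- The words that stand on the query tape during the first `s` steps. -/
def queries (O : Set (List Bool)) (p x : List Bool) (s : ℕ) : Set (List Bool) :=
  {w | ∃ s' < s, OracleTM.Spells ((M.run O p x s').cells .query) w}

variable {M}

theorem card_le_of_subset_queries {O : Set (List Bool)} {p x : List Bool} {s : ℕ}
    (F : Finset (List Bool)) (hF : ∀ w ∈ F, w ∈ queries M O p x s) : F.card ≤ s := by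
  choose! f hf using hF
  rw [← Finset.card_range s]
  refine Finset.card_le_card_of_injOn f (fun w hw => by simpa using (hf w hw).1) ?_
  intro w hw w' hw' h
  have h1 := (hf w hw).2
  rw [h] at h1
  exact h1.unique (hf w' hw').2

theorem OracleTM.run_succ (O : Set (List Bool)) (p x : List Bool) (s : ℕ) :
    M.run O p x (s + 1) = M.step O (M.run O p x s) := Function.iterate_succ_apply' _ _ _

/-- Agreement is needed only on the words queried under `O`: as long as the runs coincide, so do
their next queries. -/
theorem OracleTM.run_congr {O O' : Set (List Bool)} {p x : List Bool} {s : ℕ}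
    (h : ∀ w ∈ queries M O p x s, w ∈ O ↔ w ∈ O') : M.run O p x s = M.run O' p x s := by
  induction s with
  | zero => rfl
  | succ s ih =>
    have ih' := ih fun w ⟨s', hs', hw⟩ => h w ⟨s', by omega, hw⟩
    rw [run_succ, run_succ, ← ih']
    have hq : (∃ w ∈ O, Spells ((M.run O p x s).cells .query) w) ↔
        ∃ w ∈ O', Spells ((M.run O p x s).cells .query) w := by
      constructor
      · rintro ⟨w, h1, h2⟩; exact ⟨w, (h w ⟨s, by omega, h2⟩).1 h1, h2⟩
      · rintro ⟨w, h1, h2⟩; exact ⟨w, (h w ⟨s, by omega, h2⟩).2 h1, h2⟩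
    unfold step
    rcases M.verdict (M.run O p x s).state with _ | v
    · rcases M.ask (M.run O p x s).state with _ | ⟨y, n⟩
      · rfl
      · by_cases hO : ∃ w ∈ O, Spells ((M.run O p x s).cells .query) w
        · simp only [if_pos hO, if_pos (hq.1 hO)]
        · simp only [if_neg hO, if_neg (mt hq.2 hO)]
    · rfl

theorem OracleTM.verdictAt_congr {O O' : Set (List Bool)} {p x : List Bool} {s T : ℕ} (hs : s ≤ T)
    (h : ∀ w ∈ queries M O p x T, w ∈ O ↔ w ∈ O') :
    M.verdictAt O p x s = M.verdictAt O' p x s := by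
  unfold verdictAt
  rw [run_congr fun w ⟨s', hs', hw⟩ => h w ⟨s', by omega, hw⟩]

theorem OracleTM.verdictAt_mono {O : Set (List Bool)} {p x : List Bool} {s s' : ℕ} {v : Bool}
    (hs : s ≤ s') (h : M.verdictAt O p x s = some v) : M.verdictAt O p x s' = some v := by
  induction s', hs using Nat.le_induction with
  | base => exact h
  | succ s' _ ih =>
    unfold verdictAt at ih ⊢
    rw [run_succ]
    have : M.step O (M.run O p x s') = M.run O p x s' := by
      unfold step
      simp only [ih]
    rw [this, ih]

/-- All words of length `m`. -/
noncomputable def wordsOfLength (m : ℕ) : Finset (List Bool) :=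
  (Finset.univ : Finset (Fin m → Bool)).map ⟨List.ofFn, List.ofFn_injective⟩

theorem mem_wordsOfLength {m : ℕ} {l : List Bool} : l ∈ wordsOfLength m ↔ l.length = m := by
  unfold wordsOfLength
  simp only [Finset.mem_map, Finset.mem_univ, true_and, Function.Embedding.coeFn_mk]
  constructor
  · rintro ⟨f, rfl⟩; simp
  · rintro rfl; exact ⟨l.get, by simp⟩

theorem card_wordsOfLength (m : ℕ) : (wordsOfLength m).card = 2 ^ m := by
  simp [wordsOfLength]

variable (M) in
/-- `D` extends the oracle `O` by `N` words of length `m` such that no program `p` with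
`wordNum p < P` distinguishes a certain element of `D` from the others in time `T`, and that the
behavior of such programs on the words of `O` remains unchanged for `T` steps. -/
structure GoodSlice (O : Set (List Bool)) (m N P T : ℕ) (D : Set (List Bool)) : Prop where
  ncard : D.ncard = N
  length : ∀ d ∈ D, d.length = m
  stable : ∀ x ∈ O, ∀ p : List Bool, wordNum p < P → ∀ s ≤ T,
    M.verdictAt (O ∪ D) p x s = M.verdictAt O p x s
  diag : ∃ x ∈ D, ∀ p : List Bool, wordNum p < P →
    ¬ (M.verdictAt (O ∪ D) p x T = some true ∧
      ∀ y ∈ D, y ≠ x → M.verdictAt (O ∪ D) p y T = some false)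

/-- The core of the lower bound. Independence makes the behavior of small programs on a word of the
slice independent of the rest of the slice. The covering lemma can therefore be applied to
acceptance sets that are fixed before the slice is chosen. -/
theorem exists_goodSlice (O : Finset (List Bool)) (m N P T : ℕ)
    (hP : 2 * P < N * (N + 1))
    (hcount : O.card * (P * T) + (2 * (P * T) + 1) * (P + N) ≤ 2 ^ m) :
    ∃ D : Set (List Bool), GoodSlice M O m N P T D := by
  classical
  set progs : Finset (List Bool) := (Finset.range P).image numWord with hprogs
  have hprogs_card : progs.card ≤ P := by
    simpa using Finset.card_image_le (s := Finset.range P) (f := numWord)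
  have mem_progs : ∀ p : List Bool, wordNum p < P → p ∈ progs := fun p hp =>
    Finset.mem_image.2 ⟨wordNum p, by simpa using hp, numWord_wordNum p⟩
  -- words that are queried on old inputs
  let forb : Finset (List Bool) := O.biUnion fun x => progs.biUnion fun p =>
    (wordsOfLength m).filter fun w => w ∈ queries M O p x T
  have hforb : forb.card ≤ O.card * (P * T) := by
    refine Finset.card_biUnion_le_card_mul _ _ _ fun x _ => ?_
    refine (Finset.card_biUnion_le_card_mul _ _ T fun p _ => ?_).trans
      (Nat.mul_le_mul_right _ hprogs_card)
    exact card_le_of_subset_queries _ fun w hw => (Finset.mem_filter.1 hw).2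
  -- The query relation refers to the oracle `O ∪ {x}`, which does not involve the still unknown
  -- slice.
  let R : List Bool → List Bool → Prop := fun x y =>
    ∃ p ∈ progs, y ∈ queries M (O ∪ {x}) p x T
  obtain ⟨I, hI, hIc, hind⟩ := exists_independent R (P * T) (P + N) (wordsOfLength m \ forb)
    (by
      intro x _ F _ hR
      have : F ⊆ progs.biUnion fun p => F.filter fun y => y ∈ queries M (O ∪ {x}) p x T := by
        intro y hy
        obtain ⟨p, hp, hq⟩ := hR y hy
        exact Finset.mem_biUnion.2 ⟨p, hp, Finset.mem_filter.2 ⟨hy, hq⟩⟩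
      refine (Finset.card_le_card this).trans ((Finset.card_biUnion_le_card_mul _ _ T
        fun p _ => ?_).trans (Nat.mul_le_mul_right _ hprogs_card))
      exact card_le_of_subset_queries _ fun w hw => (Finset.mem_filter.1 hw).2)
    (by
      have := Finset.le_card_sdiff forb (wordsOfLength m)
      rw [card_wordsOfLength] at this
      omega)
  let S : List Bool → Finset ℕ := fun x => (Finset.range P).filter fun k =>
    M.verdictAt (O ∪ {x}) (numWord k) x T = some true
  obtain ⟨x, hx, Y, hY, hxY, hYc, hcov⟩ := exists_covered I S P N
    (fun x _ => Finset.filter_subset _ _) hP hIc.ge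
  -- Fewer than `N` covering words together with `x` are at most `N`. Filling up inside `I` reaches
  -- exactly `N` words and preserves independence.
  obtain ⟨D, hD1, hD2, hDc⟩ := Finset.exists_subsuperset_card_eq
    (Finset.insert_subset hx hY) (by
      rw [Finset.card_insert_of_notMem hxY]; omega : (insert x Y).card ≤ N) (by omega)
  -- A run on `z` with oracle `O ∪ {z}` that had another word of `D` on the query tape would be an
  -- edge inside the independent set.
  have hrun : ∀ z ∈ D, ∀ p : List Bool, wordNum p < P →
      M.verdictAt (O ∪ D) p z T = M.verdictAt (O ∪ {z}) p z T := by
    intro z hz p hp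
    refine (OracleTM.verdictAt_congr le_rfl fun w hw => ?_).symm
    constructor
    · rintro (h | rfl)
      · exact Or.inl h
      · exact Or.inr hz
    · rintro (h | h)
      · exact Or.inl h
      · by_contra hne
        have hzw : z ≠ w := by
          rintro rfl
          exact hne (Or.inr rfl)
        exact hind z (hD2 hz) w (hD2 h) hzw ⟨p, mem_progs p hp, hw⟩
  refine ⟨D, by simpa using hDc, fun d hd => ?_, fun x' hx' p hp s hs => ?_, x,
    hD1 (Finset.mem_insert_self _ _), fun p hp hdist => ?_⟩
  · exact mem_wordsOfLength.1 (Finset.mem_sdiff.1 (hI (hD2 hd))).1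
  · refine (OracleTM.verdictAt_congr hs fun w hw => ?_).symm
    refine ⟨Or.inl, ?_⟩
    rintro (h | h)
    · exact h
    · exfalso
      obtain ⟨h1, h2⟩ := Finset.mem_sdiff.1 (hI (hD2 h))
      exact h2 (Finset.mem_biUnion.2 ⟨x', hx', Finset.mem_biUnion.2 ⟨p, mem_progs p hp,
        Finset.mem_filter.2 ⟨h1, hw⟩⟩⟩)
  · obtain ⟨h1, h2⟩ := hdist
    rw [hrun x (hD1 (Finset.mem_insert_self _ _)) p hp] at h1
    have h3 : wordNum p ∈ S x := by
      simp only [S, Finset.mem_filter, Finset.mem_range, numWord_wordNum]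
      exact ⟨hp, h1⟩
    obtain ⟨y, hy, hyS⟩ := Finset.mem_biUnion.1 (hcov h3)
    have hyD : y ∈ D := hD1 (Finset.mem_insert_of_mem hy)
    have h4 := h2 y hyD (by rintro rfl; exact hxY hy)
    rw [hrun y hyD p hp] at h4
    simp only [S, Finset.mem_filter, numWord_wordNum] at hyS
    rw [hyS.2] at h4
    simp at h4

end Queries

/-! ### Codes of slices -/

/-- The words of length `m` that occur among the digits of `d`. -/
def codeSet (m d : ℕ) : Set (List Bool) :=
  {x | x.length = m ∧ ∃ i, digit (2 ^ (m + 1)) i d = wordNum x}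

/-- The words in a family of slices. -/
def codedSet (D : ℕ → ℕ) : Set (List Bool) := {x | x ∈ codeSet x.length (D x.length)}

/-- `d` is the code of `N` different words of length `m`. -/
structure CodesWords (m N d : ℕ) : Prop where
  lt : d < (2 ^ (m + 1)) ^ N
  le_digit : ∀ i < N, 2 ^ m ≤ digit (2 ^ (m + 1)) i d
  inj : ∀ i < N, ∀ j < N, digit (2 ^ (m + 1)) i d = digit (2 ^ (m + 1)) j d → i = j

theorem codeSet_zero (m : ℕ) : codeSet m 0 = ∅ := by
  refine Set.eq_empty_of_forall_notMem fun x hx => ?_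
  obtain ⟨i, hi⟩ := hx.2
  rw [digit_zero_right] at hi
  exact (wordNum_pos x).ne hi

theorem lt_of_digit_ne_zero_of_lt_pow {b i x N : ℕ} (hb : 0 < b) (hx : x < b ^ N)
    (h : digit b i x ≠ 0) : i < N := by
  by_contra hi
  refine h ?_
  unfold digit
  rw [Nat.div_eq_of_lt (hx.trans_le (Nat.pow_le_pow_right hb (not_lt.1 hi))), Nat.zero_mod]

theorem codeSet_subset_image {m N d : ℕ} (h : d < (2 ^ (m + 1)) ^ N) :
    codeSet m d ⊆ (fun i => numWord (digit (2 ^ (m + 1)) i d)) '' Set.Iio N := by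
  rintro x ⟨-, i, hi⟩
  refine ⟨i, lt_of_digit_ne_zero_of_lt_pow (by positivity) h ?_, ?_⟩
  · rw [hi]; exact (wordNum_pos x).ne'
  · simp only [hi, numWord_wordNum]

theorem codeSet_finite (m d : ℕ) : (codeSet m d).Finite := by
  have h : d < (2 ^ (m + 1)) ^ d := Nat.lt_pow_self (Nat.one_lt_two_pow (by omega))
  exact ((Set.finite_Iio d).image _).subset (codeSet_subset_image h)

theorem ncard_codeSet_le {m N d : ℕ} (h : d < (2 ^ (m + 1)) ^ N) : (codeSet m d).ncard ≤ N := by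
  refine (Set.ncard_le_ncard (codeSet_subset_image h) ((Set.finite_Iio N).image _)).trans ?_
  refine (Set.ncard_image_le (Set.finite_Iio N)).trans ?_
  rw [← Finset.coe_range, Set.ncard_coe_finset, Finset.card_range]

namespace CodesWords

variable {m N d : ℕ}

theorem length_numWord (h : CodesWords m N d) {i : ℕ} (hi : i < N) :
    (numWord (digit (2 ^ (m + 1)) i d)).length = m := by
  have h1 := h.le_digit i hi
  have h2 : 0 < digit (2 ^ (m + 1)) i d := lt_of_lt_of_le (by positivity) h1
  have h3 := digit_lt (b := 2 ^ (m + 1)) (by positivity) i d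
  rw [← log_wordNum, wordNum_numWord h2]
  exact Nat.log_eq_of_pow_le_of_lt_pow h1 h3

theorem wordNum_numWord_digit (h : CodesWords m N d) {i : ℕ} (hi : i < N) :
    wordNum (numWord (digit (2 ^ (m + 1)) i d)) = digit (2 ^ (m + 1)) i d :=
  wordNum_numWord (lt_of_lt_of_le (by positivity) (h.le_digit i hi))

theorem codeSet_eq (h : CodesWords m N d) :
    codeSet m d = (fun i => numWord (digit (2 ^ (m + 1)) i d)) '' Set.Iio N := by
  refine (codeSet_subset_image h.lt).antisymm ?_
  rintro _ ⟨i, hi, rfl⟩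
  exact ⟨h.length_numWord hi, i, (h.wordNum_numWord_digit hi).symm⟩

theorem numWord_digit_inj (h : CodesWords m N d) {i j : ℕ} (hi : i < N) (hj : j < N)
    (hij : numWord (digit (2 ^ (m + 1)) i d) = numWord (digit (2 ^ (m + 1)) j d)) : i = j := by
  refine h.inj i hi j hj ?_
  rw [← h.wordNum_numWord_digit hi, ← h.wordNum_numWord_digit hj, hij]

theorem ncard_codeSet (h : CodesWords m N d) : (codeSet m d).ncard = N := by
  have hinj : Set.InjOn (fun i => numWord (digit (2 ^ (m + 1)) i d)) (Set.Iio N) :=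
    fun i hi j hj hij => h.numWord_digit_inj hi hj hij
  rw [h.codeSet_eq, hinj.ncard_image, ← Finset.coe_range, Set.ncard_coe_finset, Finset.card_range]

end CodesWords

theorem digit_ofDigits {b : ℕ} (l : List ℕ) (hl : ∀ a ∈ l, a < b) (i : ℕ) :
    digit b i (Nat.ofDigits b l) = l.getD i 0 := by
  induction l generalizing i with
  | nil => simp [digit_zero_right]
  | cons a l ih =>
    have ha : a < b := hl a (by simp)
    rw [Nat.ofDigits_cons]
    cases i with
    | zero => rw [digit_cons_zero ha]; rfl
    | succ i =>
      rw [digit_cons_succ ha, ih fun a h => hl a (by simp [h])]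
      rfl

theorem exists_codesWords {m N : ℕ} {S : Set (List Bool)} (hS : S.Finite) (hN : S.ncard = N)
    (hm : ∀ x ∈ S, x.length = m) : ∃ d, CodesWords m N d ∧ codeSet m d = S := by
  set l : List ℕ := hS.toFinset.toList.map wordNum with hl
  have hlen : l.length = N := by
    rw [hl, List.length_map, Finset.length_toList, ← Set.ncard_eq_toFinset_card S hS, hN]
  have hnd : l.Nodup := (Finset.nodup_toList _).map wordNum_injective
  have hmem : ∀ a, a ∈ l ↔ ∃ x ∈ S, wordNum x = a := by intro a; simp [hl]
  have hlt : ∀ a ∈ l, a < 2 ^ (m + 1) := by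
    intro a ha
    obtain ⟨x, hx, rfl⟩ := (hmem a).1 ha
    rw [← hm x hx]
    exact wordNum_lt x
  have hdig := digit_ofDigits l hlt
  have hd : CodesWords m N (Nat.ofDigits (2 ^ (m + 1)) l) := by
    refine ⟨?_, fun i hi => ?_, fun i hi j hj hij => ?_⟩
    · rw [← hlen]
      exact Nat.ofDigits_lt_base_pow_length (Nat.one_lt_two_pow (by omega)) hlt
    · rw [hdig, List.getD_eq_getElem l 0 (hlen ▸ hi)]
      obtain ⟨x, hx, h⟩ := (hmem _).1 (List.getElem_mem (hlen ▸ hi : i < l.length))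
      rw [← h, ← hm x hx]
      exact le_wordNum x
    · rw [hdig, hdig, List.getD_eq_getElem l 0 (hlen ▸ hi),
        List.getD_eq_getElem l 0 (hlen ▸ hj)] at hij
      exact (List.Nodup.getElem_inj_iff hnd).1 hij
  refine ⟨_, hd, ?_⟩
  ext x
  constructor
  · rintro ⟨-, i, hi⟩
    rw [hdig] at hi
    rcases Nat.lt_or_ge i l.length with h | h
    · rw [List.getD_eq_getElem l 0 h] at hi
      obtain ⟨y, hy, h⟩ := (hmem _).1 (List.getElem_mem h)
      rw [hi] at h
      rwa [← wordNum_injective h]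
    · rw [List.getD_eq_default l 0 h] at hi
      exact absurd hi (wordNum_pos x).ne
  · intro hx
    refine ⟨hm x hx, ?_⟩
    obtain ⟨i, hi, h⟩ := List.getElem_of_mem ((hmem _).2 ⟨x, hx, rfl⟩)
    exact ⟨i, by rw [hdig, List.getD_eq_getElem l 0 hi, h]⟩

theorem codedSet_update {D : ℕ → ℕ} {m d : ℕ} (h : D m = 0) :
    codedSet (Function.update D m d) = codedSet D ∪ codeSet m d := by
  ext x
  simp only [codedSet, Set.mem_ofPred_eq, Set.mem_union]
  by_cases hx : x.length = m
  · rw [hx, Function.update_self, h, codeSet_zero]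
    simp
  · rw [Function.update_of_ne hx]
    refine ⟨Or.inl, ?_⟩
    rintro (h1 | h1)
    · exact h1
    · exact absurd h1.1 hx

/-! ### The construction in stages -/

/-- The size `N` is large enough for the slice of the words of length `m`. -/
def Reaches (t : ℕ → ℕ) (m N : ℕ) : Prop := t m ≤ N ^ 6 ∨ 2 ^ m ≤ N ^ 24

/-- The slice of the words of length `m` is to have size `N`. -/
def Active (t : ℕ → ℕ) (m N : ℕ) : Prop := m < N ∧ Reaches t m N ∧ ¬ Reaches t m (N - 1)

/-- `d` codes a suitable slice. -/
def GoodCode (U : OracleTM) (O : Set (List Bool)) (m N d : ℕ) : Prop :=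
  CodesWords m N d ∧ GoodSlice U O m N (N ^ 2 / 2) (N ^ 3) (codeSet m d)

open Classical in
/-- The codes of the slices that are determined before stage `j`. -/
noncomputable def stage (U : OracleTM) (t : ℕ → ℕ) : ℕ → ℕ → ℕ
  | 0 => 0
  | j + 1 =>
    if Active t j.unpair.1 j.unpair.2 then
      Function.update (stage U t j) j.unpair.1
        (sInf {d | GoodCode U (codedSet (stage U t j)) j.unpair.1 j.unpair.2 d})
    else stage U t j

/-- The oracle. -/
def oracle (U : OracleTM) (t : ℕ → ℕ) : Set (List Bool) := ⋃ j, codedSet (stage U t j)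

/-- For `m < N` the pair is `N ^ 2 + m`, so stages are ordered by size first. This is the purpose of
the clause `m < N` in `Active`. -/
theorem le_of_pair_lt {m N m' N' : ℕ} (hm : m < N) (h : Nat.pair m' N' < Nat.pair m N) :
    N' ≤ N := by
  have h1 := Nat.max_sq_add_min_le_pair m' N'
  have h2 := Nat.pair_lt_max_add_one_sq m N
  have h3 : (max m' N') ^ 2 < (max m N + 1) ^ 2 := by omega
  have h4 := lt_of_pow_lt_pow_left₀ 2 (by omega) h3
  omega

section Construction

variable {U : OracleTM} {t : ℕ → ℕ}

theorem Reaches.mono {m N N' : ℕ} (h : Reaches t m N) (hN : N ≤ N') : Reaches t m N' :=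
  h.imp (fun h => h.trans (Nat.pow_le_pow_left hN 6)) fun h => h.trans (Nat.pow_le_pow_left hN 24)

theorem Active.unique {m N N' : ℕ} (h : Active t m N) (h' : Active t m N') : N = N' := by
  have key : ∀ {N N'}, Active t m N → Active t m N' → ¬ N < N' := fun h h' hlt =>
    h'.2.2 (h.2.1.mono (by omega))
  have h1 := key h h'
  have h2 := key h' h
  omega

theorem stage_succ_of_active {m N : ℕ} (h : Active t m N) :
    stage U t (Nat.pair m N + 1) = Function.update (stage U t (Nat.pair m N)) m
      (sInf {d | GoodCode U (codedSet (stage U t (Nat.pair m N))) m N d}) := by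
  have h' : Active t (Nat.unpair (Nat.pair m N)).1 (Nat.unpair (Nat.pair m N)).2 := by
    rwa [Nat.unpair_pair]
  rw [stage, if_pos h']
  simp only [Nat.unpair_pair]

theorem stage_succ_of_not_active {j : ℕ} (h : ¬ Active t j.unpair.1 j.unpair.2) :
    stage U t (j + 1) = stage U t j := by
  rw [stage, if_neg h]

/-- If there is no good code, the infimum is 0, the code of the empty slice. Such a stage leaves the
oracle unchanged, so small sizes need no special treatment. -/
theorem sInf_goodCode (U : OracleTM) (O : Set (List Bool)) (m N : ℕ) :
    sInf {d | GoodCode U O m N d} = 0 ∨ GoodCode U O m N (sInf {d | GoodCode U O m N d}) := by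
  rcases Set.eq_empty_or_nonempty {d | GoodCode U O m N d} with h | h
  · rw [h, Nat.sInf_empty]; exact Or.inl rfl
  · exact Or.inr (Nat.sInf_mem h)

theorem sInf_goodCode_lt (U : OracleTM) (O : Set (List Bool)) (m N : ℕ) :
    sInf {d | GoodCode U O m N d} < (2 ^ (m + 1)) ^ N := by
  rcases sInf_goodCode U O m N with h | h
  · rw [h]; positivity
  · exact h.1.lt

/-- Induction on stages: only active stages matter. -/
theorem stage_induction {P : ℕ → Prop} {j₀ : ℕ} (h0 : P j₀)
    (hs : ∀ j, j₀ ≤ j → P j → stage U t (j + 1) = stage U t j → P (j + 1))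
    (ha : ∀ m N, j₀ ≤ Nat.pair m N → P (Nat.pair m N) → Active t m N → P (Nat.pair m N + 1))
    {j : ℕ} (hj : j₀ ≤ j) : P j := by
  induction j, hj using Nat.le_induction with
  | base => exact h0
  | succ j hj ih =>
    by_cases h : Active t j.unpair.1 j.unpair.2
    · have := ha j.unpair.1 j.unpair.2
      rw [Nat.pair_unpair] at this
      exact this hj ih h
    · exact hs j hj ih (stage_succ_of_not_active h)

theorem stage_ne_zero {j k : ℕ} (h : stage U t j k ≠ 0) :
    ∃ N, Active t k N ∧ Nat.pair k N < j ∧ stage U t j k < (2 ^ (k + 1)) ^ N := by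
  revert h
  refine stage_induction (U := U) (t := t) (j₀ := 0)
    (P := fun j => stage U t j k ≠ 0 →
      ∃ N, Active t k N ∧ Nat.pair k N < j ∧ stage U t j k < (2 ^ (k + 1)) ^ N)
    (fun h => absurd rfl h) (fun j _ ih he h => ?_) (fun m N _ ih hA h => ?_) (Nat.zero_le j)
  · rw [he] at h ⊢
    obtain ⟨N, h1, h2, h3⟩ := ih h
    exact ⟨N, h1, by omega, h3⟩
  · rw [stage_succ_of_active hA] at h ⊢
    by_cases hk : k = m
    · subst hk
      rw [Function.update_self]
      exact ⟨N, hA, by omega, sInf_goodCode_lt _ _ _ _⟩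
    · rw [Function.update_of_ne hk] at h ⊢
      obtain ⟨N, h1, h2, h3⟩ := ih h
      exact ⟨N, h1, by omega, h3⟩

theorem stage_pair_self {m N : ℕ} (h : Active t m N) : stage U t (Nat.pair m N) m = 0 := by
  by_contra hne
  obtain ⟨N', h1, h2, -⟩ := stage_ne_zero hne
  rw [h.unique h1] at h2
  exact lt_irrefl _ h2

theorem codedSet_stage_succ {m N : ℕ} (h : Active t m N) :
    codedSet (stage U t (Nat.pair m N + 1)) = codedSet (stage U t (Nat.pair m N)) ∪
      codeSet m (sInf {d | GoodCode U (codedSet (stage U t (Nat.pair m N))) m N d}) := by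
  rw [stage_succ_of_active h, codedSet_update (stage_pair_self h)]

theorem stage_eq_of_lt {m N j : ℕ} (h : Active t m N) (hj : Nat.pair m N < j) :
    stage U t j m = stage U t (Nat.pair m N + 1) m := by
  refine stage_induction (U := U) (t := t) (j₀ := Nat.pair m N + 1)
    (P := fun j => stage U t j m = stage U t (Nat.pair m N + 1) m) rfl
    (fun j _ ih he => by rw [he, ih]) (fun m' N' hle ih hA => ?_) hj
  rw [stage_succ_of_active hA, Function.update_of_ne, ih]
  rintro rfl
  rw [h.unique hA] at hle
  omega

theorem stage_eq_zero_of_le {m N j : ℕ} (h : Active t m N) (hj : j ≤ Nat.pair m N) :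
    stage U t j m = 0 := by
  by_contra hne
  obtain ⟨N', h1, h2, -⟩ := stage_ne_zero hne
  rw [h.unique h1] at hj
  omega

theorem mem_codedSet_stage {j : ℕ} {x : List Bool} (h : x ∈ codedSet (stage U t j)) :
    stage U t j x.length ≠ 0 := by
  intro h0
  have : x ∈ codeSet x.length (stage U t j x.length) := h
  rw [h0, codeSet_zero] at this
  exact this

theorem codedSet_stage_mono : Monotone fun j => codedSet (stage U t j) := by
  refine monotone_nat_of_le_succ fun j => ?_
  by_cases h : Active t j.unpair.1 j.unpair.2
  · have := codedSet_stage_succ (U := U) h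
    rw [Nat.pair_unpair] at this
    rw [this]
    exact Set.subset_union_left
  · rw [stage_succ_of_not_active h]

theorem codedSet_stage_pair_subset {m N : ℕ} (hm : m < N) :
    codedSet (stage U t (Nat.pair m N)) ⊆
      ⋃ k ∈ Finset.range N, codeSet k (stage U t (Nat.pair m N) k) := by
  intro x hx
  obtain ⟨N', h1, h2, -⟩ := stage_ne_zero (mem_codedSet_stage hx)
  have h3 := le_of_pair_lt hm h2
  have h4 := h1.1
  exact Set.mem_biUnion (x := x.length) (by simp; omega) hx

theorem codedSet_stage_pair_finite {m N : ℕ} (hm : m < N) :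
    (codedSet (stage U t (Nat.pair m N))).Finite :=
  (Set.Finite.biUnion (Finset.finite_toSet _) fun _ _ => codeSet_finite _ _).subset
    (codedSet_stage_pair_subset hm)

/-- Earlier active stages have size at most `N` and length below their size. This leaves at most `N`
lengths with at most `N` words each. -/
theorem ncard_codedSet_stage_pair {m N : ℕ} (hm : m < N) :
    (codedSet (stage U t (Nat.pair m N))).ncard ≤ N * N := by
  classical
  refine (Set.ncard_le_ncard (codedSet_stage_pair_subset hm)
    (Set.Finite.biUnion (Finset.finite_toSet _) fun _ _ => codeSet_finite _ _)).trans ?_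
  have h1 : ∀ s : Finset ℕ, (⋃ k ∈ s, codeSet k (stage U t (Nat.pair m N) k)).ncard ≤
      s.card * N := by
    intro s
    induction s using Finset.induction_on with
    | empty => simp
    | insert k s hk ih =>
      rw [Finset.set_biUnion_insert, Finset.card_insert_of_notMem hk]
      refine (Set.ncard_union_le _ _).trans ?_
      have : (codeSet k (stage U t (Nat.pair m N) k)).ncard ≤ N := by
        by_cases h0 : stage U t (Nat.pair m N) k = 0
        · rw [h0, codeSet_zero]; simp
        · obtain ⟨N', h1, h2, h3⟩ := stage_ne_zero h0
          exact (ncard_codeSet_le h3).trans (le_of_pair_lt hm h2)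
      rw [Nat.succ_mul]
      omega
  simpa using h1 (Finset.range N)

/-- With at most `N ^ 2` old words, `P ≤ N ^ 2 / 2` programs and `N ^ 3` steps, the demand is at
most `3 * N ^ 7`. Since `N ≤ 2 * (N - 1)`, this is at most `384 * (N - 1) ^ 7`, far below `(N - 1) ^
24`. -/
theorem count_bound {m N c : ℕ} (hN : 4 ≤ N) (hc : c ≤ N * N) (h : (N - 1) ^ 24 < 2 ^ m) :
    c * (N ^ 2 / 2 * N ^ 3) + (2 * (N ^ 2 / 2 * N ^ 3) + 1) * (N ^ 2 / 2 + N) ≤ 2 ^ m := by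
  refine le_trans ?_ h.le
  obtain ⟨a, rfl⟩ : ∃ a, N = a + 1 := ⟨N - 1, by omega⟩
  rw [Nat.add_sub_cancel]
  have hP : 2 * ((a + 1) ^ 2 / 2) ≤ (a + 1) ^ 2 := Nat.mul_div_le _ _
  set P := (a + 1) ^ 2 / 2
  set N := a + 1
  have ha : 3 ≤ a := by omega
  have h1 : 2 * (P * N ^ 3) ≤ N ^ 5 := by
    calc 2 * (P * N ^ 3) = 2 * P * N ^ 3 := by ring
      _ ≤ N ^ 2 * N ^ 3 := Nat.mul_le_mul_right _ hP
      _ = N ^ 5 := by ring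
  have h2 : P + N ≤ N ^ 2 := by nlinarith
  have h3 : 1 ≤ N ^ 5 := Nat.one_le_pow _ _ (by omega)
  have h4 : c * (P * N ^ 3) ≤ N ^ 7 := by
    calc c * (P * N ^ 3) ≤ N * N * N ^ 5 := Nat.mul_le_mul hc (by omega)
      _ = N ^ 7 := by ring
  have h5 : (2 * (P * N ^ 3) + 1) * (P + N) ≤ 2 * N ^ 7 := by
    calc (2 * (P * N ^ 3) + 1) * (P + N) ≤ (2 * N ^ 5) * N ^ 2 :=
          Nat.mul_le_mul (by omega) h2
      _ = 2 * N ^ 7 := by ring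
  have h6 : N ^ 7 ≤ 128 * a ^ 7 := by
    calc N ^ 7 ≤ (2 * a) ^ 7 := Nat.pow_le_pow_left (by omega) 7
      _ = 128 * a ^ 7 := by ring
  have h7 : 384 * a ^ 7 ≤ a ^ 24 := by
    calc 384 * a ^ 7 ≤ 3 ^ 17 * a ^ 7 := Nat.mul_le_mul_right _ (by norm_num)
      _ ≤ a ^ 17 * a ^ 7 := Nat.mul_le_mul_right _ (Nat.pow_le_pow_left ha 17)
      _ = a ^ 24 := by ring
  omega

/-- Minimality of the active size gives `(N - 1) ^ 24 < 2 ^ m`, so there are enough words of length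
`m` for a good slice. -/
theorem exists_goodCode {m N : ℕ} (h : Active t m N) (hN : 4 ≤ N) :
    ∃ d, GoodCode U (codedSet (stage U t (Nat.pair m N))) m N d := by
  have hfin := codedSet_stage_pair_finite (U := U) (t := t) h.1
  have hcard := ncard_codedSet_stage_pair (U := U) (t := t) h.1
  obtain ⟨O, hO⟩ := hfin.exists_finset_coe
  rw [← hO] at hcard ⊢
  rw [Set.ncard_coe_finset] at hcard
  have hb : (N - 1) ^ 24 < 2 ^ m := not_le.1 fun h' => h.2.2 (Or.inr h')
  obtain ⟨S, hS⟩ := exists_goodSlice (M := U) O m N (N ^ 2 / 2) (N ^ 3)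
    (by have := Nat.mul_div_le (N ^ 2) 2; nlinarith) (count_bound hN hcard hb)
  have hSf : S.Finite := Set.finite_of_ncard_ne_zero (by rw [hS.ncard]; omega)
  obtain ⟨d, hd, rfl⟩ := exists_codesWords hSf hS.ncard hS.length
  exact ⟨d, hd, hS⟩

/-- A later active stage has size `N' ≥ N`. Its stability clause therefore covers all programs and
times that matter for size `N`. -/
theorem verdictAt_stage_succ {m N j : ℕ} {x p : List Bool} {s : ℕ}
    (hj : Nat.pair m N < j) (hx : x ∈ codedSet (stage U t j)) (hp : wordNum p < N ^ 2 / 2)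
    (hs : s ≤ N ^ 3) :
    U.verdictAt (codedSet (stage U t (j + 1))) p x s =
      U.verdictAt (codedSet (stage U t j)) p x s := by
  by_cases h : Active t j.unpair.1 j.unpair.2
  · obtain ⟨m', N', rfl⟩ : ∃ m' N', j = Nat.pair m' N' := ⟨_, _, (Nat.pair_unpair j).symm⟩
    simp only [Nat.unpair_pair] at h
    have hN : N ≤ N' := le_of_pair_lt h.1 hj
    rw [codedSet_stage_succ h]
    rcases sInf_goodCode U (codedSet (stage U t (Nat.pair m' N'))) m' N' with h0 | h0
    · rw [h0, codeSet_zero, Set.union_empty]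
    · refine h0.2.stable x hx p (hp.trans_le ?_) s (hs.trans (Nat.pow_le_pow_left hN 3))
      exact Nat.div_le_div_right (Nat.pow_le_pow_left hN 2)
  · rw [stage_succ_of_not_active h]

theorem queries_finite (O : Set (List Bool)) (p x : List Bool) (s : ℕ) :
    (queries U O p x s).Finite := by
  have : queries U O p x s ⊆ ⋃ s' ∈ Set.Iio s,
      {w | OracleTM.Spells ((U.run O p x s').cells .query) w} := by
    rintro w ⟨s', hs', h⟩
    exact Set.mem_biUnion (x := s') hs' h
  refine (Set.Finite.biUnion (Set.finite_Iio s) fun s' _ => ?_).subset this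
  exact Set.Subsingleton.finite fun w hw w' hw' => hw.unique hw'

/-- Only finitely many words are queried in `s` steps, so the run sees the oracle of some finite
stage. From there the stability of verdicts leads back to the stage of `m`. -/
theorem verdictAt_oracle {m N : ℕ} {x p : List Bool} {s : ℕ}
    (hx : x ∈ codedSet (stage U t (Nat.pair m N + 1))) (hp : wordNum p < N ^ 2 / 2)
    (hs : s ≤ N ^ 3) :
    U.verdictAt (oracle U t) p x s =
      U.verdictAt (codedSet (stage U t (Nat.pair m N + 1))) p x s := by
  obtain ⟨j, hj, hq⟩ : ∃ j, Nat.pair m N + 1 ≤ j ∧ ∀ w ∈ queries U (oracle U t) p x s,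
      w ∈ oracle U t → w ∈ codedSet (stage U t j) := by
    have hfin := queries_finite (U := U) (oracle U t) p x s
    have : ∀ w ∈ queries U (oracle U t) p x s, ∃ j, w ∈ oracle U t → w ∈ codedSet (stage U t j) := by
      intro w _
      by_cases h : w ∈ oracle U t
      · obtain ⟨j, hj⟩ := Set.mem_iUnion.1 h
        exact ⟨j, fun _ => hj⟩
      · exact ⟨0, fun h' => absurd h' h⟩
    choose! f hf using this
    obtain ⟨B, hB⟩ := (hfin.image f).bddAbove
    refine ⟨max B (Nat.pair m N + 1), le_max_right _ _, fun w hw hwo => ?_⟩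
    exact codedSet_stage_mono ((hB (Set.mem_image_of_mem f hw)).trans (le_max_left _ _))
      (hf w hw hwo)
  rw [OracleTM.verdictAt_congr (O' := codedSet (stage U t j)) le_rfl fun w hw =>
    ⟨hq w hw, fun h => Set.mem_iUnion.2 ⟨j, h⟩⟩]
  clear hq
  induction j, hj using Nat.le_induction with
  | base => rfl
  | succ j hj ih =>
    rw [verdictAt_stage_succ hj (codedSet_stage_mono hj hx) hp hs, ih]

theorem slice_oracle {m N : ℕ} (h : Active t m N) :
    slice (oracle U t) m = codeSet m (stage U t (Nat.pair m N + 1) m) := by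
  ext x
  constructor
  · rintro ⟨hx, rfl⟩
    obtain ⟨j, hj⟩ := Set.mem_iUnion.1 hx
    rcases Nat.lt_or_ge (Nat.pair x.length N) j with hlt | hge
    · rw [← stage_eq_of_lt h hlt]
      exact hj
    · exact absurd (stage_eq_zero_of_le h hge) (mem_codedSet_stage hj)
  · intro hx
    obtain rfl := hx.1
    exact ⟨Set.mem_iUnion.2 ⟨_, hx⟩, rfl⟩

/-- Every slice of the oracle contains a word that is hard to distinguish from the others. -/
theorem exists_hard_word {m N : ℕ} (h : Active t m N) (hN : 4 ≤ N) :
    (slice (oracle U t) m).ncard = N ∧ ∃ x ∈ slice (oracle U t) m, ∀ p : List Bool,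
      wordNum p < N ^ 2 / 2 → ¬ (U.verdictAt (oracle U t) p x (N ^ 3) = some true ∧
        ∀ y ∈ slice (oracle U t) m, y ≠ x →
          U.verdictAt (oracle U t) p y (N ^ 3) = some false) := by
  have hgood : GoodCode U (codedSet (stage U t (Nat.pair m N))) m N
      (stage U t (Nat.pair m N + 1) m) := by
    rw [stage_succ_of_active h, Function.update_self]
    exact Nat.sInf_mem (exists_goodCode h hN)
  have hset := codedSet_stage_succ (U := U) h
  have hstage : sInf {d | GoodCode U (codedSet (stage U t (Nat.pair m N))) m N d} =
      stage U t (Nat.pair m N + 1) m := by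
    rw [stage_succ_of_active h, Function.update_self]
  rw [hstage] at hset
  rw [slice_oracle h]
  refine ⟨hgood.2.ncard, ?_⟩
  have hmem : ∀ x ∈ codeSet m (stage U t (Nat.pair m N + 1) m),
      x ∈ codedSet (stage U t (Nat.pair m N + 1)) := by
    intro x hx
    rw [hset]
    exact Or.inr hx
  obtain ⟨x, hx, hdiag⟩ := hgood.2.diag
  refine ⟨x, hx, fun p hp hdist => hdiag p hp ?_⟩
  rw [← hset]
  refine ⟨?_, fun y hy hyx => ?_⟩
  · rw [← verdictAt_oracle (hmem x hx) hp le_rfl]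
    exact hdist.1
  · rw [← verdictAt_oracle (hmem y hy) hp le_rfl]
    exact hdist.2 y hy hyx

end Construction

/-! ### The lower bound -/

theorem ENat.exists_eq_sInf_of_ne_top {S : Set ℕ∞} (h : sInf S ≠ ⊤) : sInf S ∈ S := by
  refine csInf_mem ?_
  by_contra hne
  rw [Set.not_nonempty_iff_eq_empty] at hne
  rw [hne, sInf_empty] at h
  exact h rfl

section LowerBound

variable {U : OracleTM} {t : ℕ → ℕ}

/-- For large `n` both `n ^ 6 < t n` and `n ^ 24 < 2 ^ n` hold, so no size up to `n` is sufficient.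
The least sufficient size then exceeds `n` and is active. -/
theorem eventually_active (ht : Superpolynomial t) :
    ∀ᶠ n in atTop, ∃ N, 4 ≤ N ∧ Active t n N := by
  have h2 : ∀ᶠ n : ℕ in atTop, n ^ 24 < 2 ^ n := by
    have h := (tendsto_pow_const_div_const_pow_of_one_lt 24 (one_lt_two (α := ℝ))).eventually
      (gt_mem_nhds one_pos)
    filter_upwards [h] with n hn
    rw [div_lt_one (by positivity)] at hn
    exact_mod_cast hn
  filter_upwards [ht 6, h2, eventually_ge_atTop 4] with n h6 h24 hn
  have hex : ∃ N, Reaches t n N := ⟨t n, Or.inl (Nat.le_self_pow (by omega) _)⟩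
  classical
  have hnot : ∀ N ≤ n, ¬ Reaches t n N := fun N hN h => by
    rcases h.mono hN with h | h <;> omega
  have hlt : n < Nat.find hex := by
    by_contra h
    exact hnot _ (not_lt.1 h) (Nat.find_spec hex)
  exact ⟨Nat.find hex, by omega, hlt, Nat.find_spec hex, Nat.find_min hex (by omega)⟩

theorem verdictAt_of_halts {A : Set (List Bool)} {p x : List Bool} {b : ℝ} {s : ℕ} {v : Bool}
    (hb : b ≤ s) (h : U.HaltsWithin A p x b) (hv : ∃ s', U.verdictAt A p x s' = some v) :
    U.verdictAt A p x s = some v := by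
  obtain ⟨s₁, hs₁, h₁⟩ := h
  obtain ⟨s₂, h₂⟩ := hv
  have hs : s₁ ≤ s := by exact_mod_cast hs₁.trans hb
  obtain ⟨w, hw⟩ := Option.ne_none_iff_exists'.1 h₁
  rw [OracleTM.verdictAt_mono hs hw, ← OracleTM.verdictAt_mono (le_max_left s₁ s₂) hw,
    OracleTM.verdictAt_mono (le_max_right s₁ s₂) h₂]

/-- Used with `k = 3` for the running time and with `k = 1` for the size of the slice. -/
theorem min_le_pow_of_reaches {n N : ℕ} (h : Reaches t n N) {a b : ℝ} {k : ℕ} (ha : 0 ≤ a)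
    (hb : 0 ≤ b) (hak : a * 6 = k) (hbk : b * 24 = k) :
    min ((t n : ℝ) ^ a) ((2 : ℝ) ^ (n * b)) ≤ (N : ℝ) ^ k := by
  have hN : (0 : ℝ) ≤ N := Nat.cast_nonneg N
  rcases h with h | h
  · refine (min_le_left _ _).trans ?_
    have h' : (t n : ℝ) ≤ (N : ℝ) ^ 6 := by exact_mod_cast h
    refine (Real.rpow_le_rpow (Nat.cast_nonneg _) h' ha).trans_eq ?_
    rw [← Real.rpow_natCast, ← Real.rpow_natCast, ← Real.rpow_mul hN, ← hak, mul_comm]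
    norm_num
  · refine (min_le_right _ _).trans ?_
    have h' : (2 : ℝ) ^ n ≤ (N : ℝ) ^ 24 := by exact_mod_cast h
    rw [Real.rpow_mul two_pos.le, Real.rpow_natCast]
    refine (Real.rpow_le_rpow (by positivity) h' hb).trans_eq ?_
    rw [← Real.rpow_natCast, ← Real.rpow_natCast, ← Real.rpow_mul hN, ← hbk, mul_comm]
    norm_num

/-- The loss of 2 has two sources: the program number is below `2 ^ (p.length + 1)`, not `2 ^
p.length`, and the number of programs is only half of `N ^ 2`. -/
theorem two_mul_logb_le {p : List Bool} {N : ℕ} (hN : 1 ≤ N) (hp : N ^ 2 / 2 ≤ wordNum p) :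
    2 * Real.logb 2 (N : ℝ) - 2 ≤ (p.length : ℝ) := by
  have h1 := wordNum_lt p
  have h2 : N ^ 2 ≤ 2 ^ (p.length + 2) := by
    rw [show 2 ^ (p.length + 2) = 2 * 2 ^ (p.length + 1) from pow_succ' _ _]
    omega
  have h3 : ((N : ℝ)) ^ 2 ≤ (2 : ℝ) ^ (p.length + 2) := by exact_mod_cast h2
  have hpos : (0 : ℝ) < N := by exact_mod_cast hN
  have h4 := Real.logb_le_logb_of_le one_lt_two (by positivity) h3
  rw [Real.logb_pow, Real.logb_pow, Real.logb_self_eq_one one_lt_two] at h4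
  push_cast at h4
  linarith

theorem oracle_hard (ht : Superpolynomial t) :
    ∃ c : ℝ, ∀ᶠ n : ℕ in atTop, ∃ x ∈ slice (oracle U t) n,
      (∀ T : ℕ → ℝ,
        T n ≤ min ((t n : ℝ) ^ (1 / 2 : ℝ)) ((2 : ℝ) ^ ((n : ℝ) / 8)) →
        ((2 * Real.logb 2 ((slice (oracle U t) n).ncard : ℝ) - c : ℝ) : EReal) ≤
          ((distComplexity U T (oracle U t) x : ENNReal) : EReal)) ∧
      min ((t n : ℝ) ^ (1 / 6 : ℝ)) ((2 : ℝ) ^ ((n : ℝ) / 24)) ≤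
        ((slice (oracle U t) n).ncard : ℝ) := by
  refine ⟨2, ?_⟩
  filter_upwards [eventually_active ht] with n ⟨N, hN, hA⟩
  obtain ⟨hcard, x, hx, hhard⟩ := exists_hard_word (U := U) hA hN
  rw [hcard]
  refine ⟨x, hx, fun T hT => ?_, ?_⟩
  · have hTN : T n ≤ ((N ^ 3 : ℕ) : ℝ) := by
      refine hT.trans ?_
      have := min_le_pow_of_reaches hA.2.1 (a := 1 / 2) (b := 1 / 8) (k := 3) (by norm_num)
        (by norm_num) (by norm_num) (by norm_num)
      rw [mul_one_div] at this
      exact_mod_cast this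
    by_cases htop : distComplexity U T (oracle U t) x = ⊤
    · rw [htop]; simp
    · obtain ⟨p, hp, hlen⟩ := ENat.exists_eq_sInf_of_ne_top htop
      change distComplexity U T (oracle U t) x = _ at hlen
      rw [hlen]
      have hpN : N ^ 2 / 2 ≤ wordNum p := by
        by_contra hlt
        refine hhard p (not_le.1 hlt) ⟨?_, fun y hy hyx => ?_⟩
        · exact verdictAt_of_halts (by rw [hx.2]; exact hTN) (hp.2.2 x) hp.1
        · exact verdictAt_of_halts (by rw [hy.2]; exact hTN) (hp.2.2 y) (hp.2.1 y hyx)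
      have := two_mul_logb_le (by omega) hpN
      calc ((2 * Real.logb 2 (N : ℝ) - 2 : ℝ) : EReal) ≤ ((p.length : ℝ) : EReal) :=
            EReal.coe_le_coe_iff.2 this
        _ = _ := by
            rw [ENat.toENNReal_coe, ← ENNReal.coe_natCast, EReal.coe_nnreal_eq_coe_real,
              NNReal.coe_natCast]
  · have := min_le_pow_of_reaches hA.2.1 (a := 1 / 6) (b := 1 / 24) (k := 1) (by norm_num)
      (by norm_num) (by norm_num) (by norm_num)
    rw [mul_one_div, pow_one] at this
    exact this

end LowerBound

/-! ### Deciding a set by an unbounded search -/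

/-- Here polynomial bounds on values become linear bounds on bit lengths, that is, on space. -/
theorem size_pow_le (B c : ℕ) : Nat.size ((B + 2) ^ c) ≤ (Nat.size B + 1) * c + 1 := by
  rw [Nat.size_le]
  have h : B + 2 ≤ 2 ^ (Nat.size B + 1) := by
    have := Nat.lt_size_self B
    have := Nat.one_le_two_pow (n := Nat.size B)
    rw [pow_succ]
    omega
  calc (B + 2) ^ c ≤ (2 ^ (Nat.size B + 1)) ^ c := Nat.pow_le_pow_left h c
    _ = 2 ^ ((Nat.size B + 1) * c) := (pow_mul _ _ _).symm
    _ < 2 ^ ((Nat.size B + 1) * c + 1) := Nat.pow_lt_pow_right (by omega) (by omega)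

/-- A predicate of two registers is computed to another register. -/
theorem LSP.exists_prog {P : ℕ × ℕ → Prop} (hP : LSP P) {d m : ℕ} (hd : 2 ≤ d) (hdm : d < m) :
    ∃ p c, ∀ (σ : ℕ → ℕ) (B : ℕ), (∀ r, m ≤ r → σ r = 0) → σ 0 ≤ B → σ 1 ≤ B →
      ∃ v, (v ≠ 0 ↔ P (σ 0, σ 1)) ∧ Exec ((B + 2) ^ c) p σ (Function.update σ d v) := by
  classical
  obtain ⟨p, c, h⟩ := hP.2 (Sum.elim (fun _ => 0) fun _ => 1) (fun _ => d) m
    (by rintro (r | r) <;> simp <;> omega) (fun _ => hdm) (fun _ _ _ => rfl)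
    (by rintro (r | r) _ <;> simp <;> omega)
  refine ⟨p, c, fun σ B h0 h1 h2 => ?_⟩
  obtain ⟨σ', he, hv, ho⟩ := h (σ 0, σ 1) σ B (by rintro (r | r) <;> rfl) h0
    (below_prod.2 ⟨below_nat.2 h1, below_nat.2 h2⟩)
  have hv' := hv ()
  refine ⟨σ' d, ?_, ?_⟩
  · rw [hv']
    change (if P (σ 0, σ 1) then 1 else 0) ≠ 0 ↔ _
    split_ifs with hp <;> simp [hp]
  · convert he using 1
    funext x
    by_cases hx : x = d
    · rw [hx, Function.update_self]
    · rw [Function.update_of_ne hx, ho x (by rintro ⟨_, rfl⟩; exact hx rfl)]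

/-- The search for `K` has no bound in terms of the input, so it lies outside `LS`. It still runs in
small space, because it stops at the first solution and no candidate above `K` is ever tested. -/
theorem computableInSpace_of_search {A : Set (List Bool)} {t : ℕ → ℕ} {D R : ℕ × ℕ → Prop}
    (hD : LSP D) (hR : LSP R) (K : List Bool → ℕ) (c : ℕ)
    (hK : ∀ x, D (wordNum x, K x)) (hmin : ∀ x, ∀ k < K x, ¬ D (wordNum x, k))
    (hA : ∀ x, x ∈ A ↔ R (wordNum x, K x))
    (hsize : ∀ x, Nat.size (max (wordNum x) (K x)) ≤ c * t x.length + c) :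
    ComputableInSpace A t := by
  obtain ⟨p, c₁, hp⟩ := hD.not.exists_prog (d := 2) (m := 4) le_rfl (by omega)
  obtain ⟨q, c₂, hq⟩ := hR.exists_prog (d := 3) (m := 4) (by omega) (by omega)
  set C := c₁ + c₂ + 1 with hC
  let B : List Bool → ℕ := fun x => max (wordNum x) (K x)
  refine computableInSpace_of_prog (.seq p (.seq (.loop 2 (.seq (.inc 1) p)) q)) 3
    (fun x => (B x + 2) ^ C) ((c + 1) * C + C + 1) (fun x => ?_) (fun x => ?_) fun x => ?_
  · refine (size_pow_le _ _).trans ?_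
    have h1 : Nat.size (B x) ≤ c * t x.length + c := hsize x
    have h2 := Nat.mul_le_mul_right C (Nat.succ_le_succ h1)
    simp only [Nat.succ_eq_add_one] at h2
    nlinarith [Nat.zero_le (C * t x.length), Nat.zero_le (t x.length)]
  · have h1 : x.length < Nat.size (B x) :=
      Nat.lt_size.2 ((le_wordNum x).trans (le_max_left _ _))
    have h2 : Nat.size (B x) ≤ c * t x.length + c := hsize x
    have h3 : c ≤ (c + 1) * C := by nlinarith [Nat.zero_le (c * (c₁ + c₂))]
    have h4 := Nat.mul_le_mul_right (t x.length) h3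
    nlinarith [Nat.zero_le (C * t x.length), Nat.zero_le (t x.length)]
  -- Register 0 keeps the input, register 1 holds the candidate `k`, and register 2 is nonzero
  -- exactly when `D` fails for `k`. Registers from 4 on are work space.
  · have hloop : ∀ i k, k + i = K x → ∀ σ : ℕ → ℕ, σ 0 = wordNum x → σ 1 = k →
        (σ 2 ≠ 0 ↔ ¬ D (wordNum x, k)) → (∀ r, 4 ≤ r → σ r = 0) →
        ∃ σ', Exec ((B x + 2) ^ C) (.loop 2 (.seq (.inc 1) p)) σ σ' ∧ σ' 0 = wordNum x ∧
          σ' 1 = K x ∧ ∀ r, 4 ≤ r → σ' r = 0 := by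
      intro i
      induction i with
      | zero =>
        intro k hk σ h0 h1 h2 h4
        obtain rfl : k = K x := by omega
        have h2' : σ 2 = 0 := by
          by_contra h
          exact h2.1 h (hK x)
        exact ⟨σ, .loop_zero h2', h0, h1, h4⟩
      | succ i ih =>
        intro k hk σ h0 h1 h2 h4
        have hkK : k + 1 ≤ K x := by omega
        have hB : k + 1 ≤ B x := hkK.trans (le_max_right _ _)
        set τ := Function.update σ 1 (σ 1 + 1) with hτ
        obtain ⟨v, hv, he⟩ := hp τ (B x)
          (fun r hr => by rw [hτ, Function.update_of_ne (by omega), h4 r hr])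
          (by rw [hτ, Function.update_of_ne (by omega), h0]; exact le_max_left _ _)
          (by rw [hτ, Function.update_self, h1]; exact hB)
        obtain ⟨σ', he', h0', h1', h4'⟩ := ih (k + 1) (by omega) (Function.update τ 2 v)
          (by simp [hτ, h0]) (by simp [hτ, h1]) (by
            rw [Function.update_self, hv]
            simp [hτ, h0, h1]) (fun r hr => by
            rw [Function.update_of_ne (by omega), hτ, Function.update_of_ne (by omega), h4 r hr])
        refine ⟨σ', .loop_succ (h2.2 (hmin x k (by omega))) (.seq (.inc 1 σ ?_)
          (he.mono (pow_bound_mono _ (by omega)))) he', h0', h1', h4'⟩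
        rw [h1]
        exact hB.trans (le_pow_bound _ (by omega))
    set σ : ℕ → ℕ := Function.update 0 0 (wordNum x) with hσ
    obtain ⟨v, hv, he⟩ := hp σ (B x) (fun r hr => by
      rw [hσ, Function.update_of_ne (by omega)]; rfl) (by simp [hσ, B]) (by simp [hσ])
    obtain ⟨τ, he₂, h0, h1, h4⟩ := hloop (K x) 0 (by omega) (Function.update σ 2 v)
      (by simp [hσ]) (by simp [hσ]) (by
        rw [Function.update_self, hv]
        simp [hσ]) (fun r hr => by
        rw [Function.update_of_ne (by omega), hσ, Function.update_of_ne (by omega)]; rfl)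
    obtain ⟨w, hw, he₃⟩ := hq τ (B x) h4 (by rw [h0]; exact le_max_left _ _)
      (by rw [h1]; exact le_max_right _ _)
    refine ⟨_, .seq (he.mono (pow_bound_mono _ (by omega))) (.seq he₂
      (he₃.mono (pow_bound_mono _ (by omega)))), ?_⟩
    rw [Function.update_self, hw, hA, h0, h1]

/-! ### Tables of codes -/

theorem tableMem_iff {b W w : ℕ} (hw : 0 < w) :
    TableMem b W w ↔ ∃ i, digit (2 ^ (Nat.log 2 w + 1)) i (digit b (Nat.log 2 w) W) = w := by
  unfold TableMem
  rw [lenBase_eq hw]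
  constructor
  · rintro ⟨-, i, -, h⟩
    exact ⟨i, h⟩
  · rintro ⟨i, h⟩
    refine ⟨hw, i, ?_, h⟩
    have h1 := lt_of_digit_ne_zero (Nat.one_lt_two_pow (by omega)) (h.trans_ne hw.ne')
    have h2 := digit_le b (Nat.log 2 w) W
    omega

theorem tableSet_eq (b W : ℕ) : tableSet b W = codedSet fun m => digit b m W := by
  ext x
  change TableMem b W (wordNum x) ↔ x.length = x.length ∧ _
  rw [tableMem_iff (wordNum_pos x), log_wordNum]
  simp

theorem tableSet_zero (b : ℕ) : tableSet b 0 = ∅ := by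
  rw [tableSet_eq]
  refine Set.eq_empty_of_forall_notMem fun x hx => ?_
  have : x ∈ codeSet x.length (digit b x.length 0) := hx
  rw [digit_zero_right, codeSet_zero] at this
  exact this

/-- The number with the digits `D 0, …, D (n - 1)` in base `b`. -/
def tableNum (b n : ℕ) (D : ℕ → ℕ) : ℕ := ∑ k ∈ Finset.range n, D k * b ^ k

theorem tableNum_succ (b n : ℕ) (D : ℕ → ℕ) :
    tableNum b (n + 1) D = D 0 + b * tableNum b n fun k => D (k + 1) := by
  unfold tableNum
  rw [Finset.sum_range_succ', Finset.mul_sum, pow_zero, mul_one, add_comm]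
  congr 1
  exact Finset.sum_congr rfl fun k _ => by ring

theorem tableNum_lt {b n : ℕ} {D : ℕ → ℕ} (hD : ∀ k, D k < b) : tableNum b n D < b ^ n := by
  induction n generalizing D with
  | zero => simp [tableNum]
  | succ n ih =>
    rw [tableNum_succ, pow_succ']
    have h1 := ih fun k => hD (k + 1)
    have h2 := hD 0
    nlinarith

theorem digit_tableNum {b n : ℕ} {D : ℕ → ℕ} (hD : ∀ k, D k < b) (h0 : ∀ k, n ≤ k → D k = 0)
    (k : ℕ) : digit b k (tableNum b n D) = D k := by
  induction n generalizing D k with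
  | zero => simp [tableNum, digit_zero_right, h0]
  | succ n ih =>
    rw [tableNum_succ]
    cases k with
    | zero => exact digit_cons_zero (hD 0)
    | succ k =>
      rw [digit_cons_succ (hD 0), ih (fun k => hD (k + 1)) fun k hk => h0 (k + 1) (by omega)]

theorem tableNum_update {b n m : ℕ} {D : ℕ → ℕ} (hm : m < n) (h : D m = 0) (d : ℕ) :
    tableNum b n (Function.update D m d) = tableNum b n D + b ^ m * d := by
  unfold tableNum
  have h1 : ∀ k ∈ Finset.range n, Function.update D m d k * b ^ k =
      D k * b ^ k + if k = m then b ^ m * d else 0 := by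
    intro k _
    by_cases hk : k = m
    · subst hk
      simp [h, mul_comm]
    · simp [hk]
  rw [Finset.sum_congr rfl h1, Finset.sum_add_distrib, Finset.sum_ite_eq']
  simp [hm]

theorem tableSet_tableNum {b n : ℕ} {D : ℕ → ℕ} (hD : ∀ k, D k < b)
    (h0 : ∀ k, n ≤ k → D k = 0) : tableSet b (tableNum b n D) = codedSet D := by
  rw [tableSet_eq]
  congr 1
  funext k
  exact digit_tableNum hD h0 k

/-! ### The construction with simulated machines -/

/-- `d` is the code of `N` different words, in base `B`. -/
def CodesWordsNum (B N d : ℕ) : Prop :=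
  divPow d B N = 0 ∧ (∀ i < N, B ≤ 2 * digit B i d) ∧
    ∀ i < N, ∀ j < N, digit B i d = digit B j d → i = j

/-- Verdicts on the words in the table `W` remain unchanged if it is replaced by `W'`. -/
def StableNum (U : OracleTM) (Q b W W' P T : ℕ) : Prop :=
  ∀ w < W + 1, TableMem b W w → ∀ p < P, 0 < p → ∀ s < T + 1,
    simVerdict U Q b W' p w s = simVerdict U Q b W p w s

/-- With the table `W`, some digit of `d` is not distinguished from the others. -/
def DiagNum (U : OracleTM) (Q b W B N P T d : ℕ) : Prop :=
  ∃ i < N, ∀ p < P, 0 < p → ¬ (simVerdict U Q b W p (digit B i d) T = some true ∧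
    ∀ j < N, ¬ j = i → simVerdict U Q b W p (digit B j d) T = some false)

@[fun_prop] theorem LSP.codesWordsNum {B N d : α → ℕ} (hB : LS B) (hN : LS N) (hd : LS d) :
    LSP (fun a => CodesWordsNum (B a) (N a) (d a)) := by
  unfold CodesWordsNum
  fun_prop

@[fun_prop] theorem LSP.stableNum {U : OracleTM} {Q b W W' P T : α → ℕ} (hQ : LS Q) (hb : LS b)
    (hW : LS W) (hW' : LS W') (hP : LS P) (hT : LS T) :
    LSP (fun a => StableNum U (Q a) (b a) (W a) (W' a) (P a) (T a)) := by
  unfold StableNum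
  fun_prop

@[fun_prop] theorem LSP.diagNum {U : OracleTM} {Q b W B N P T d : α → ℕ} (hQ : LS Q) (hb : LS b)
    (hW : LS W) (hB : LS B) (hN : LS N) (hP : LS P) (hT : LS T) (hd : LS d) :
    LSP (fun a => DiagNum U (Q a) (b a) (W a) (B a) (N a) (P a) (T a) (d a)) := by
  unfold DiagNum
  fun_prop

/-- `d` codes a suitable slice of words of length `m`, with `B = 2 ^ (m + 1)`. -/
def GoodNum (U : OracleTM) (Q b W W' B N d : ℕ) : Prop :=
  CodesWordsNum B N d ∧ StableNum U Q b W W' (N ^ 2 / 2) (N ^ 3) ∧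
    DiagNum U Q b W' B N (N ^ 2 / 2) (N ^ 3) d

@[fun_prop] theorem LSP.goodNum {U : OracleTM} {Q b W W' B N d : α → ℕ} (hQ : LS Q) (hb : LS b)
    (hW : LS W) (hW' : LS W') (hB : LS B) (hN : LS N) (hd : LS d) :
    LSP (fun a => GoodNum U (Q a) (b a) (W a) (W' a) (B a) (N a) (d a)) := by
  unfold GoodNum
  fun_prop

/-- The digits on the output tape after a simulated run without oracle. -/
noncomputable def outputNum (M : OracleTM) (Q p x s : ℕ) : ℕ :=
  ((simRun M Q 0 0 p x s).2 .output).1 / Q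

@[fun_prop] theorem LS.outputNum {M : OracleTM} {Q p x s : α → ℕ} (hQ : LS Q) (hp : LS p)
    (hx : LS x) (hs : LS s) : LS (fun a => outputNum M (Q a) (p a) (x a) (s a)) :=
  LS.div ((LS.eval _).comp (LS.simRun hQ (by fun_prop) (by fun_prop) hp hx hs).snd).fst hQ

/-- On the input `1ᵐ`, where `B = 2 ^ (m + 1)`, the machine `M` has produced a number that is at
most `E` after `c * E + c` steps. -/
def OutputLeNum (M : OracleTM) (c Q B E : ℕ) : Prop :=
  -- `B - 1` is the number of the word `1ᵐ`. The bits of a number at most `E` form a word whose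
  -- number is at most `3 * E + 1`, so the search bound suffices.
  ¬ simVerdict M Q 0 0 (wordNum []) (B - 1) (c * E + c) = none ∧ ∃ w < 4 * E + 4, 0 < w ∧
    SpellsNum M.Aux (outputNum M Q (wordNum []) (B - 1) (c * E + c)) w ∧
    -- Subtracting the leading 1 of the word number leaves the value of the bits.
    w - lenBase w / 2 ≤ E

@[fun_prop] theorem LSP.outputLeNum {M : OracleTM} (c : ℕ) {Q B E : α → ℕ} (hQ : LS Q) (hB : LS B)
    (hE : LS E) : LSP (fun a => OutputLeNum M c (Q a) (B a) (E a)) := by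
  unfold OutputLeNum
  fun_prop

/-- The number `N` is large enough for the words of length `m`, where `B = 2 ^ (m + 1)`. -/
def ReachesNum (M : OracleTM) (c Q B N : ℕ) : Prop :=
  OutputLeNum M c Q B (N ^ 6) ∨ B ≤ 2 * N ^ 24

@[fun_prop] theorem LSP.reachesNum {M : OracleTM} (c : ℕ) {Q B N : α → ℕ} (hQ : LS Q) (hB : LS B)
    (hN : LS N) : LSP (fun a => ReachesNum M c (Q a) (B a) (N a)) := by
  unfold ReachesNum
  fun_prop

open Classical in
/-- One stage of the construction, truncated at `K`. -/
noncomputable def stepNum (U M : OracleTM) (c K Q Q' b j W : ℕ) : ℕ :=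
  if j.unpair.1 < j.unpair.2 ∧ ReachesNum M c Q' (minPow K 2 (j.unpair.1 + 1)) j.unpair.2 ∧
      ¬ ReachesNum M c Q' (minPow K 2 (j.unpair.1 + 1)) (j.unpair.2 - 1) then
    -- The truncations at `K` bound the recursion uniformly, as `LS.natRec` requires. By
    -- `stagesNum_eq` they change nothing once `K` is large.
    min K (W + minPow K b j.unpair.1 * sInf {d | d < K + 1 ∧
      GoodNum U Q b W (W + minPow K b j.unpair.1 * d) (minPow K 2 (j.unpair.1 + 1)) j.unpair.2 d})
  else W

/-- The table after `j` stages. -/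
noncomputable def stagesNum (U M : OracleTM) (c K Q Q' b j : ℕ) : ℕ :=
  Nat.rec (motive := fun _ => ℕ) 0 (stepNum U M c K Q Q' b) j

theorem LS.stepNum {U M : OracleTM} (c : ℕ) {K Q Q' b j W : α → ℕ} (hK : LS K) (hQ : LS Q)
    (hQ' : LS Q') (hb : LS b) (hj : LS j) (hW : LS W) :
    LS (fun a => stepNum U M c (K a) (Q a) (Q' a) (b a) (j a) (W a)) := by
  classical
  unfold _root_.stepNum
  have h := LS.sInf_lt (P := fun a d => GoodNum U (Q a) (b a) (W a)
    (W a + _root_.minPow (K a) (b a) (j a).unpair.1 * d)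
    (_root_.minPow (K a) 2 ((j a).unpair.1 + 1)) (j a).unpair.2 d)
    (b := fun a => K a + 1) (by fun_prop) (by fun_prop)
  refine LS.ite (by fun_prop) (LS.inf hK (LS.add hW (LS.mul (by fun_prop) h))) hW

theorem stagesNum_le (U M : OracleTM) (c K Q Q' b j : ℕ) : stagesNum U M c K Q Q' b j ≤ K := by
  induction j with
  | zero => exact Nat.zero_le _
  | succ j ih =>
    change stepNum U M c K Q Q' b j (stagesNum U M c K Q Q' b j) ≤ K
    unfold stepNum
    split_ifs
    · exact min_le_left _ _
    · exact ih

@[fun_prop] theorem LS.stagesNum {U M : OracleTM} (c : ℕ) {K Q Q' b j : α → ℕ} (hK : LS K)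
    (hQ : LS Q) (hQ' : LS Q') (hb : LS b) (hj : LS j) :
    LS (fun a => stagesNum U M c (K a) (Q a) (Q' a) (b a) (j a)) := by
  obtain ⟨e, he⟩ := hK.1
  refine LS.natRec (init := fun _ => 0)
    (step := fun a => _root_.stepNum U M c (K a) (Q a) (Q' a) (b a)) hj
    (by fun_prop) (LS.stepNum c (by fun_prop) (by fun_prop) (by fun_prop) (by fun_prop)
      (by fun_prop) (by fun_prop)) ⟨e, fun a B hB i _ => ?_⟩
  exact below_nat.2 ((stagesNum_le U M c (K a) (Q a) (Q' a) (b a) i).trans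
    (below_nat.1 (he a B hB)))

/-! ### Correctness of the simulation -/

theorem codesWordsNum_iff {m N d : ℕ} : CodesWordsNum (2 ^ (m + 1)) N d ↔ CodesWords m N d := by
  have h1 : divPow d (2 ^ (m + 1)) N = 0 ↔ d < (2 ^ (m + 1)) ^ N :=
    Nat.div_eq_zero_iff_lt (by positivity)
  have h2 : ∀ i, 2 ^ (m + 1) ≤ 2 * digit (2 ^ (m + 1)) i d ↔ 2 ^ m ≤ digit (2 ^ (m + 1)) i d := by
    intro i
    have : 2 ^ (m + 1) = 2 * 2 ^ m := pow_succ' _ _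
    omega
  unfold CodesWordsNum
  simp only [h1, h2]
  exact ⟨fun h => ⟨h.1, h.2.1, h.2.2⟩, fun h => ⟨h.lt, h.le_digit, h.inj⟩⟩

theorem forall_wordNum_iff {P : ℕ} {F : ℕ → Prop} :
    (∀ p < P, 0 < p → F p) ↔ ∀ p : List Bool, wordNum p < P → F (wordNum p) := by
  constructor
  · exact fun h p hp => h _ hp (wordNum_pos p)
  · intro h p hp h0
    obtain ⟨l, rfl⟩ := exists_wordNum h0
    exact h l hp

theorem stableNum_iff {U : OracleTM} {q b W W' P T : ℕ} (hq : T ≤ q) :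
    StableNum U (symBase U.Aux ^ q) b W W' P T ↔ ∀ x ∈ tableSet b W, ∀ p : List Bool,
      wordNum p < P → ∀ s ≤ T, U.verdictAt (tableSet b W') p x s =
        U.verdictAt (tableSet b W) p x s := by
  unfold StableNum
  have key : ∀ x p : List Bool, (∀ s < T + 1, simVerdict U (symBase U.Aux ^ q) b W' (wordNum p)
      (wordNum x) s = simVerdict U (symBase U.Aux ^ q) b W (wordNum p) (wordNum x) s) ↔
      ∀ s ≤ T, U.verdictAt (tableSet b W') p x s = U.verdictAt (tableSet b W) p x s := by
    intro x p
    refine forall_congr' fun s => ?_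
    rw [Nat.lt_succ_iff]
    refine imp_congr_right fun hs => ?_
    rw [simVerdict_eq (hs.trans hq), simVerdict_eq (hs.trans hq)]
  constructor
  · intro h x hx p hp
    exact (key x p).1 (h _ (Nat.lt_succ_of_le (TableMem.le hx)) hx _ hp (wordNum_pos p))
  · intro h w _ hw
    rw [forall_wordNum_iff]
    intro p hp
    obtain ⟨x, rfl⟩ := exists_wordNum hw.1
    exact (key x p).2 (h x hw p hp)

theorem diagNum_iff {U : OracleTM} {q b W m N P T d : ℕ} (hq : T ≤ q) (hd : CodesWords m N d) :
    DiagNum U (symBase U.Aux ^ q) b W (2 ^ (m + 1)) N P T d ↔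
      ∃ x ∈ codeSet m d, ∀ p : List Bool, wordNum p < P →
        ¬ (U.verdictAt (tableSet b W) p x T = some true ∧
          ∀ y ∈ codeSet m d, y ≠ x → U.verdictAt (tableSet b W) p y T = some false) := by
  unfold DiagNum
  rw [hd.codeSet_eq, Set.exists_mem_image]
  have key : ∀ i < N, ∀ p : List Bool, simVerdict U (symBase U.Aux ^ q) b W (wordNum p)
      (digit (2 ^ (m + 1)) i d) T =
        U.verdictAt (tableSet b W) p (numWord (digit (2 ^ (m + 1)) i d)) T := by
    intro i hi p
    rw [← simVerdict_eq hq, hd.wordNum_numWord_digit hi]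
  refine exists_congr fun i => and_congr_right fun hi => ?_
  rw [forall_wordNum_iff]
  refine forall_congr' fun p => imp_congr_right fun hp => not_congr ?_
  rw [key i hi p, Set.forall_mem_image]
  refine and_congr_right fun _ => forall_congr' fun j => imp_congr_right fun hj => ?_
  rw [key j hj p]
  refine imp_congr_left (not_congr ⟨fun h => by rw [h], fun h => hd.numWord_digit_inj hj hi h⟩)

/-- The table equation is required only for `d` within the size of a code: larger `d` may spill into
other entries of the table, but they are rejected by the first clause of either side. -/
theorem goodNum_iff {U : OracleTM} {q b W W' m N d : ℕ} (hq : N ^ 3 ≤ q)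
    (hW' : d < (2 ^ (m + 1)) ^ N → tableSet b W' = tableSet b W ∪ codeSet m d) :
    GoodNum U (symBase U.Aux ^ q) b W W' (2 ^ (m + 1)) N d ↔
      GoodCode U (tableSet b W) m N d := by
  unfold GoodNum GoodCode
  rw [codesWordsNum_iff]
  refine and_congr_right fun hd => ?_
  rw [stableNum_iff hq, diagNum_iff hq hd, hW' hd.lt]
  exact ⟨fun h => ⟨hd.ncard_codeSet, fun _ h => h.1, h.1, h.2⟩, fun h => ⟨h.stable, h.diag⟩⟩

theorem bitsVal_bits (n : ℕ) : bitsVal n.bits = n := by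
  induction n using Nat.binaryRec' with
  | zero => simp [bitsVal]
  | bit b n h ih => rw [Nat.bits_append_bit n b h, bitsVal, ih, Nat.bit_val]; ring

theorem wordNum_eq_add (l : List Bool) : wordNum l = bitsVal l + 2 ^ l.length :=
  bitsVal_append_true l

theorem wordNum_replicate (m : ℕ) : wordNum (List.replicate m true) = 2 ^ (m + 1) - 1 := by
  induction m with
  | zero => rfl
  | succ m ih =>
    rw [List.replicate_succ, wordNum_cons, ih]
    have : 2 ^ (m + 1 + 1) = 2 * 2 ^ (m + 1) := pow_succ' _ _
    have := Nat.one_le_two_pow (n := m + 1)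
    simp
    omega

theorem OracleTM.run_eq_of_halted {M : OracleTM} {O : Set (List Bool)} {p x : List Bool} {s s' : ℕ}
    (hs : s ≤ s') (h : M.verdictAt O p x s ≠ none) : M.run O p x s' = M.run O p x s := by
  obtain ⟨v, hv⟩ := Option.ne_none_iff_exists'.1 h
  induction s', hs using Nat.le_induction with
  | base => rfl
  | succ s' _ ih =>
    rw [run_succ, ih]
    unfold verdictAt at hv
    unfold step
    simp only [hv]

/-- If `t m ≤ E`, then `M` halts within `c * E + c` steps. Conversely, if it has halted by then, its
output is already the final one. Hence values of `t` are compared with `E` without ever being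
computed when they are large. -/
theorem outputLeNum_iff {M : OracleTM} {t : ℕ → ℕ} {c q m E : ℕ} (hq : c * E + c ≤ q)
    (hM : ∃ s : ℕ, s ≤ c * t m + c ∧ M.verdictAt ∅ [] (List.replicate m true) s ≠ none ∧
      OracleTM.Spells ((M.run ∅ [] (List.replicate m true) s).cells .output) (Nat.bits (t m))) :
    OutputLeNum M c (symBase M.Aux ^ q) (2 ^ (m + 1)) E ↔ t m ≤ E := by
  obtain ⟨s, hs, hv, hsp⟩ := hM
  unfold OutputLeNum outputNum
  rw [← wordNum_replicate, simVerdict_eq hq, tableSet_zero]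
  have hrep := simRun_rep (M := M) hq 0 0 [] (List.replicate m true)
  rw [tableSet_zero] at hrep
  have hdig : ∀ k : ℕ, digit (symBase M.Aux) k (((simRun M (symBase M.Aux ^ q) 0 0 (wordNum [])
      (wordNum (List.replicate m true)) (c * E + c)).2 .output).1 / symBase M.Aux ^ q) =
      symCode ((M.run ∅ [] (List.replicate m true) (c * E + c)).cells .output k) := by
    intro k
    rw [digit_div_pow, hrep.tape]
    congr 2
    push_cast
    ring
  constructor
  · rintro ⟨h2, w, -, hw, h3, h4⟩
    obtain ⟨l, rfl⟩ := exists_wordNum hw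
    have h5 := (spellsNum_iff hdig l).1 h3
    have h6 : M.run ∅ [] (List.replicate m true) (c * E + c) =
        M.run ∅ [] (List.replicate m true) s := by
      rcases le_total s (c * E + c) with h | h
      · exact OracleTM.run_eq_of_halted h hv
      · exact (OracleTM.run_eq_of_halted h h2).symm
    rw [h6] at h5
    rw [h5.unique hsp, lenBase_eq (wordNum_pos _), log_wordNum, wordNum_eq_add, bitsVal_bits,
      pow_succ, Nat.mul_div_cancel _ two_pos, Nat.add_sub_cancel] at h4
    exact h4
  · intro hE
    have hle : s ≤ c * E + c := hs.trans (by gcongr)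
    have h6 := OracleTM.run_eq_of_halted hle hv
    refine ⟨?_, wordNum (Nat.bits (t m)), ?_, wordNum_pos _, (spellsNum_iff hdig _).2 ?_, ?_⟩
    · unfold OracleTM.verdictAt at hv ⊢
      rwa [h6]
    · have h7 : 2 ^ (Nat.bits (t m)).length ≤ 2 * t m + 1 := by
        rw [Nat.size_eq_bits_len]
        rcases Nat.eq_zero_or_pos (t m) with h0 | h0
        · simp [h0]
        · have h8 : Nat.size (t m) - 1 < Nat.size (t m) := by
            have := Nat.size_pos.2 h0
            omega
          have h9 := Nat.lt_size.1 h8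
          have h10 : Nat.size (t m) = Nat.size (t m) - 1 + 1 := by omega
          rw [h10, pow_succ]
          omega
      rw [wordNum_eq_add, bitsVal_bits]
      omega
    · rw [h6]; exact hsp
    · rw [lenBase_eq (wordNum_pos _), log_wordNum, wordNum_eq_add, bitsVal_bits,
        pow_succ, Nat.mul_div_cancel _ two_pos, Nat.add_sub_cancel]
      exact hE

/-! ### The oracle is computable in small space -/

section Computability

variable {U M : OracleTM} {t : ℕ → ℕ} {c : ℕ}

/-- The stages before `(N + 1) ^ 2` involve only lengths and sizes up to `N`. This fixes the number
of entries and the base of the table. -/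
theorem stage_bound {N j k : ℕ} (hj : j ≤ (N + 1) ^ 2) (h : stage U t j k ≠ 0) :
    k < N + 1 ∧ stage U t j k < 2 ^ ((N + 1) * (N + 1)) := by
  obtain ⟨N', h1, h2, h3⟩ := stage_ne_zero h
  have h4 := Nat.max_sq_add_min_le_pair k N'
  have h5 : (max k N') ^ 2 < (N + 1) ^ 2 := by omega
  have h6 := lt_of_pow_lt_pow_left₀ 2 (by omega) h5
  refine ⟨by omega, h3.trans_le ?_⟩
  rw [← pow_mul]
  exact Nat.pow_le_pow_right (by omega) (Nat.mul_le_mul (by omega) (by omega))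

/-- For such `K`, `q` and `q'`, no truncation is effective and all simulations run long enough. Each
numerical stage therefore repeats the stage of the construction. -/
theorem stagesNum_eq {K q q' N j : ℕ} (hq : N ^ 3 ≤ q) (hq' : c * N ^ 6 + c ≤ q')
    (hK : (2 ^ ((N + 1) * (N + 1))) ^ (N + 1) ≤ K)
    (hM : ∀ n : ℕ, ∃ s : ℕ, s ≤ c * t n + c ∧
      M.verdictAt ∅ [] (List.replicate n true) s ≠ none ∧
      OracleTM.Spells ((M.run ∅ [] (List.replicate n true) s).cells .output) (Nat.bits (t n)))
    (hj : j ≤ (N + 1) ^ 2) :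
    stagesNum U M c K (symBase U.Aux ^ q) (symBase M.Aux ^ q') (2 ^ ((N + 1) * (N + 1))) j =
      tableNum (2 ^ ((N + 1) * (N + 1))) (N + 1) (stage U t j) := by
  set b := 2 ^ ((N + 1) * (N + 1)) with hb
  have hb1 : 1 ≤ b := Nat.one_le_two_pow
  have hbK : b ≤ K := (Nat.le_self_pow (by omega) b).trans hK
  have hlt : ∀ j ≤ (N + 1) ^ 2, ∀ k, stage U t j k < b := fun j hj k => by
    by_cases h : stage U t j k = 0
    · rw [h]; exact hb1
    · exact (stage_bound hj h).2
  have hzero : ∀ j ≤ (N + 1) ^ 2, ∀ k, N + 1 ≤ k → stage U t j k = 0 := fun j hj k hk => by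
    by_contra h
    exact absurd (stage_bound hj h).1 (not_lt.2 hk)
  induction j with
  | zero => simp [stagesNum, stage, tableNum]
  | succ j ih =>
    have hj' : j ≤ (N + 1) ^ 2 := by omega
    have ih := ih hj'
    change stepNum U M c K _ _ b j (stagesNum U M c K _ _ b j) = _
    rw [ih]
    obtain ⟨m, N', rfl⟩ : ∃ m N', j = Nat.pair m N' := ⟨_, _, (Nat.pair_unpair j).symm⟩
    have hmax := Nat.max_sq_add_min_le_pair m N'
    have hmax' := lt_of_pow_lt_pow_left₀ 2 (by omega)
      (show (max m N') ^ 2 < (N + 1) ^ 2 by omega)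
    have hmN : m ≤ N := by omega
    have hN' : N' ≤ N := by omega
    have hB : minPow K 2 (m + 1) = 2 ^ (m + 1) := by
      refine min_eq_right (le_trans ?_ hbK)
      exact Nat.pow_le_pow_right (by omega) (by nlinarith)
    have hh : minPow K b m = b ^ m :=
      min_eq_right (le_trans (Nat.pow_le_pow_right hb1 (by omega)) hK)
    have hreach : ∀ N'' ≤ N, ReachesNum M c (symBase M.Aux ^ q') (2 ^ (m + 1)) N'' ↔
        Reaches t m N'' := by
      intro N'' hN''
      unfold ReachesNum Reaches
      rw [outputLeNum_iff (le_trans (by gcongr) hq') (hM m), pow_succ' 2 m,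
        Nat.mul_le_mul_left_iff two_pos]
    have hactive : (Nat.pair m N').unpair.1 < (Nat.pair m N').unpair.2 ∧
        ReachesNum M c (symBase M.Aux ^ q') (minPow K 2 ((Nat.pair m N').unpair.1 + 1))
          (Nat.pair m N').unpair.2 ∧
        ¬ ReachesNum M c (symBase M.Aux ^ q') (minPow K 2 ((Nat.pair m N').unpair.1 + 1))
          ((Nat.pair m N').unpair.2 - 1) ↔ Active t m N' := by
      rw [Nat.unpair_pair, hB, hreach N' hN', hreach (N' - 1) (by omega)]
      rfl
    unfold stepNum
    by_cases hA : Active t m N'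
    · have hW : tableSet b (tableNum b (N + 1) (stage U t (Nat.pair m N'))) =
          codedSet (stage U t (Nat.pair m N')) :=
        tableSet_tableNum (hlt _ hj') (hzero _ hj')
      have hupd : ∀ d, tableNum b (N + 1) (stage U t (Nat.pair m N')) + b ^ m * d =
          tableNum b (N + 1) (Function.update (stage U t (Nat.pair m N')) m d) := fun d =>
        (tableNum_update (by omega) (stage_pair_self hA) d).symm
      have hdb : ∀ d, d < (2 ^ (m + 1)) ^ N' → d < b := fun d hd => by
        refine hd.trans_le ?_
        rw [← pow_mul]
        exact Nat.pow_le_pow_right (by omega) (Nat.mul_le_mul (by omega) (by omega))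
      -- Good codes are below `b ≤ K`, so the bounded search has the same minimum as the unbounded
      -- one, including the value 0 if there is no good code.
      have hset : {d | d < K + 1 ∧ GoodNum U (symBase U.Aux ^ q) b
          (tableNum b (N + 1) (stage U t (Nat.pair m N')))
          (tableNum b (N + 1) (stage U t (Nat.pair m N')) + b ^ m * d) (2 ^ (m + 1)) N' d} =
          {d | GoodCode U (codedSet (stage U t (Nat.pair m N'))) m N' d} := by
        ext d
        have hgood := goodNum_iff (U := U) (q := q) (b := b)
          (W := tableNum b (N + 1) (stage U t (Nat.pair m N')))
          (W' := tableNum b (N + 1) (stage U t (Nat.pair m N')) + b ^ m * d) (m := m) (N := N')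
          (d := d) ((Nat.pow_le_pow_left hN' 3).trans hq) (fun hd => by
            rw [hupd, hW, ← codedSet_update (stage_pair_self hA)]
            refine tableSet_tableNum (fun k => ?_) fun k hk => ?_
            · by_cases hkm : k = m
              · rw [hkm, Function.update_self]; exact hdb d hd
              · rw [Function.update_of_ne hkm]; exact hlt _ hj' k
            · rw [Function.update_of_ne (by omega)]; exact hzero _ hj' k hk)
        rw [hW] at hgood
        change d < K + 1 ∧ GoodNum U _ b _ _ _ N' d ↔ GoodCode U _ m N' d
        rw [hgood]
        refine ⟨fun h => h.2, fun h => ⟨?_, h⟩⟩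
        have := hdb d h.1.lt
        omega
      rw [if_pos (hactive.2 hA)]
      simp only [Nat.unpair_pair]
      rw [hB, hh, hset, hupd, stage_succ_of_active hA, min_eq_right]
      rw [← stage_succ_of_active hA]
      exact (tableNum_lt (hlt _ hj)).le.trans hK
    · rw [if_neg (mt hactive.1 hA), stage_succ_of_not_active]
      rwa [Nat.unpair_pair]

/-- The least size for which the slice of the words of length `n` is determined. -/
theorem exists_size (t : ℕ → ℕ) (n : ℕ) : ∃ N, n < N ∧ Reaches t n N :=
  ⟨t n + n + 1, by omega, Or.inl ((Nat.le_self_pow (by omega) _).trans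
    (Nat.pow_le_pow_left (by omega) 6))⟩

open Classical in
/-- The least `N > n` that is large enough for the words of length `n`. -/
noncomputable def sliceSize (t : ℕ → ℕ) (n : ℕ) : ℕ := Nat.find (exists_size t n)

theorem Active.eq_sliceSize {n N : ℕ} (h : Active t n N) : N = sliceSize t n := by
  classical
  have h1 : sliceSize t n ≤ N := Nat.find_min' _ ⟨h.1, h.2.1⟩
  by_contra hne
  exact h.2.2 ((Nat.find_spec (exists_size t n)).2.mono
    (by unfold sliceSize at h1 hne; omega))

/-- An active size of the length of `x` can only be `sliceSize`, and its slice is final after its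
stage. If there is none, both sides are false. -/
theorem mem_oracle_iff (x : List Bool) : x ∈ oracle U t ↔
    x ∈ codedSet (stage U t (Nat.pair x.length (sliceSize t x.length) + 1)) := by
  refine ⟨fun h => ?_, fun h => Set.mem_iUnion.2 ⟨_, h⟩⟩
  obtain ⟨j, hj⟩ := Set.mem_iUnion.1 h
  obtain ⟨N, hA, hlt, -⟩ := stage_ne_zero (mem_codedSet_stage hj)
  rw [← hA.eq_sliceSize]
  change x ∈ codeSet x.length (stage U t _ x.length)
  rw [← stage_eq_of_lt hA hlt]
  exact hj

/-- Either minimality gives `(N - 1) ^ 6 < t n` for `N = sliceSize t n`, where the factor `64 = 2 ^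
6` comes from `N ≤ 2 * (N - 1)`. Or `N ≤ n + 1`, and then `t n > n ^ 7` suffices for large `n`,
while `e` takes care of small `n`. -/
theorem exists_sliceSize_le (ht : Superpolynomial t) :
    ∃ e, ∀ n, sliceSize t n ^ 6 ≤ 64 * t n + e := by
  classical
  obtain ⟨n₀, hn₀⟩ := eventually_atTop.1 (ht 7)
  refine ⟨(n₀ + 65) ^ 6, fun n => ?_⟩
  have hspec := Nat.find_spec (exists_size t n)
  rcases Nat.lt_or_ge (n + 1) (sliceSize t n) with h | h
  · have h1 := Nat.find_min (exists_size t n) (m := sliceSize t n - 1)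
      (by unfold sliceSize at h ⊢; omega)
    have h2 : ¬ t n ≤ (sliceSize t n - 1) ^ 6 := fun h' => h1 ⟨by omega, Or.inl h'⟩
    obtain ⟨a, ha⟩ : ∃ a, sliceSize t n = a + 2 := ⟨sliceSize t n - 2, by omega⟩
    rw [ha] at h2 ⊢
    have h3 : (a + 2) ^ 6 ≤ (2 * (a + 2 - 1)) ^ 6 := Nat.pow_le_pow_left (by omega) 6
    rw [mul_pow] at h3
    omega
  · have h1 : sliceSize t n ^ 6 ≤ (n + 1) ^ 6 := Nat.pow_le_pow_left h 6
    rcases Nat.lt_or_ge n (n₀ + 64) with h2 | h2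
    · have := Nat.pow_le_pow_left (show n + 1 ≤ n₀ + 65 by omega) 6
      omega
    · have h3 := hn₀ n (by omega)
      have h4 : (n + 1) ^ 6 ≤ (2 * n) ^ 6 := Nat.pow_le_pow_left (by omega) 6
      have h5 : (2 * n) ^ 6 ≤ n ^ 7 := by
        rw [mul_pow, pow_succ n 6, mul_comm]
        exact Nat.mul_le_mul_left _ (by omega)
      omega

/-- The numbers `K = 2 ^ (C * (N ^ 6 + 1))`, which bound the whole computation for the size `N`. -/
def IsScale (C K N : ℕ) : Prop := minPow (K + 1) 2 (C * (N ^ 6 + 1)) = K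

/-- Truncation at `K + 1` rather than `K` detects equality: a power that is too large gives `K + 1`.
-/
theorem isScale_iff {C K N : ℕ} : IsScale C K N ↔ K = 2 ^ (C * (N ^ 6 + 1)) := by
  unfold IsScale minPow
  constructor
  · intro h; omega
  · intro h; rw [← h]; omega

@[fun_prop] theorem LSP.isScale (C : ℕ) {K N : α → ℕ} (hK : LS K) (hN : LS N) :
    LSP (fun a => IsScale C (K a) (N a)) := by
  unfold IsScale
  fun_prop

theorem IsScale.unique {C K N N' : ℕ} (hC : 0 < C) (h : IsScale C K N) (h' : IsScale C K N') :
    N = N' := by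
  rw [isScale_iff] at h h'
  have h1 := Nat.pow_right_injective le_rfl (h.symm.trans h')
  have h2 := Nat.eq_of_mul_eq_mul_left hC h1
  exact Nat.pow_left_injective (n := 6) (by omega) (by simpa using h2)

theorem le_two_pow_scale {C N B e : ℕ} (h : B * e ≤ C * (N ^ 6 + 1)) :
    B ^ e ≤ 2 ^ (C * (N ^ 6 + 1)) :=
  calc B ^ e ≤ (2 ^ B) ^ e := Nat.pow_le_pow_left Nat.lt_two_pow_self.le e
    _ = 2 ^ (B * e) := (pow_mul _ _ _).symm
    _ ≤ _ := Nat.pow_le_pow_right (by omega) h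

/-- The search looks for the least scale `K` whose size is sufficient for the input length. From `K`
the size is recovered, the stages are replayed, and the input is looked up in the resulting table.
-/
theorem computableInSpace_oracle (U : OracleTM) (ht : Superpolynomial t)
    (htc : TimeConstructible t) : ComputableInSpace (oracle U t) t := by
  classical
  obtain ⟨M, c, hM⟩ := htc
  obtain ⟨e, he⟩ := exists_sliceSize_le ht
  -- The three summands make `K` exceed the powers for the tapes of `U` over `N ^ 3` steps, those
  -- for the tapes of `M` over `c * N ^ 6 + c` steps, and the table, as `(N + 1) ^ 3 ≤ 8 * (N ^ 6 +
  -- 1)`.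
  set C := symBase U.Aux + c * symBase M.Aux + 8 with hC
  let D : ℕ × ℕ → Prop := fun a => ∃ N < a.2 + 1, IsScale C a.2 N ∧ Nat.log 2 a.1 < N ∧
    ReachesNum M c (minPow a.2 (symBase M.Aux) (c * N ^ 6 + c))
      (minPow a.2 2 (Nat.log 2 a.1 + 1)) N
  let size : ℕ × ℕ → ℕ := fun a => sInf {N | N < a.2 + 1 ∧ IsScale C a.2 N}
  -- The number of stages, `N * N + n + 1`, is `Nat.pair n N + 1` because `n < N`.
  let R : ℕ × ℕ → Prop := fun a =>
    TableMem (minPow a.2 2 ((size a + 1) * (size a + 1)))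
      (stagesNum U M c a.2 (minPow a.2 (symBase U.Aux) (size a ^ 3))
        (minPow a.2 (symBase M.Aux) (c * size a ^ 6 + c))
        (minPow a.2 2 ((size a + 1) * (size a + 1))) (size a * size a + Nat.log 2 a.1 + 1)) a.1
  have hD : LSP D := by
    simp only [D]
    fun_prop
  have hsize : LS size := LS.sInf_lt (P := fun (a : ℕ × ℕ) N => IsScale C a.2 N) (by fun_prop)
    (by fun_prop)
  have hR : LSP R := by
    simp only [R]
    fun_prop
  have hNC : ∀ N, N + 1 ≤ C * (N ^ 6 + 1) := fun N =>
    (Nat.succ_le_succ (Nat.le_self_pow (by omega) N)).trans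
      (Nat.le_mul_of_pos_left _ (by omega))
  have hNK : ∀ N, N < 2 ^ (C * (N ^ 6 + 1)) + 1 := fun N => by
    have h1 : N < 2 ^ N := Nat.lt_two_pow_self
    have h2 : 2 ^ N ≤ 2 ^ (C * (N ^ 6 + 1)) :=
      Nat.pow_le_pow_right (by omega) ((Nat.le_succ N).trans (hNC N))
    omega
  have hQM : ∀ N, symBase M.Aux ^ (c * N ^ 6 + c) ≤ 2 ^ (C * (N ^ 6 + 1)) := fun N =>
    le_two_pow_scale (by
      have : symBase M.Aux * (c * N ^ 6 + c) = c * symBase M.Aux * (N ^ 6 + 1) := by ring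
      rw [this]
      exact Nat.mul_le_mul_right _ (by omega))
  have h36 : ∀ N : ℕ, N ^ 3 ≤ N ^ 6 := fun N => by
    rcases Nat.eq_zero_or_pos N with rfl | h
    · simp
    · exact Nat.pow_le_pow_right h (by omega)
  have hQU : ∀ N, symBase U.Aux ^ (N ^ 3) ≤ 2 ^ (C * (N ^ 6 + 1)) := fun N =>
    le_two_pow_scale (Nat.mul_le_mul (by omega) ((h36 N).trans (by omega)))
  have hb : ∀ N, (2 ^ ((N + 1) * (N + 1))) ^ (N + 1) ≤ 2 ^ (C * (N ^ 6 + 1)) := fun N => by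
    rw [← pow_mul]
    refine Nat.pow_le_pow_right (by omega) ?_
    have h1 : (N + 1) * (N + 1) * (N + 1) ≤ 8 * (N ^ 6 + 1) := by
      rcases Nat.eq_zero_or_pos N with rfl | h
      · simp
      · calc (N + 1) * (N + 1) * (N + 1) ≤ (2 * N) * (2 * N) * (2 * N) := by gcongr <;> omega
          _ = 8 * N ^ 3 := by ring
          _ ≤ 8 * (N ^ 6 + 1) := by have := h36 N; omega
    exact h1.trans (Nat.mul_le_mul_right _ (by omega))
  have hDiff : ∀ (x : List Bool) (K : ℕ), D (wordNum x, K) ↔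
      ∃ N, K = 2 ^ (C * (N ^ 6 + 1)) ∧ x.length < N ∧ Reaches t x.length N := by
    intro x K
    have key : ∀ N, (IsScale C K N ∧ x.length < N ∧
        ReachesNum M c (minPow K (symBase M.Aux) (c * N ^ 6 + c)) (minPow K 2 (x.length + 1)) N) ↔
        K = 2 ^ (C * (N ^ 6 + 1)) ∧ x.length < N ∧ Reaches t x.length N := by
      intro N
      rw [isScale_iff]
      refine and_congr_right fun hK => and_congr_right fun hx => ?_
      have h1 : minPow K (symBase M.Aux) (c * N ^ 6 + c) = symBase M.Aux ^ (c * N ^ 6 + c) :=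
        min_eq_right (hK ▸ hQM N)
      have h2 : minPow K 2 (x.length + 1) = 2 ^ (x.length + 1) := by
        refine min_eq_right (hK ▸ Nat.pow_le_pow_right (by omega) ?_)
        have := hNC N
        omega
      rw [h1, h2]
      unfold ReachesNum Reaches
      rw [outputLeNum_iff le_rfl (hM x.length), pow_succ' 2 x.length,
        Nat.mul_le_mul_left_iff two_pos]
    simp only [D, log_wordNum]
    constructor
    · rintro ⟨N, -, h⟩
      exact ⟨N, (key N).1 h⟩
    · rintro ⟨N, h⟩
      exact ⟨N, by rw [h.1]; exact hNK N, (key N).2 h⟩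
  refine computableInSpace_of_search hD hR
    (fun x => 2 ^ (C * (sliceSize t x.length ^ 6 + 1))) (64 * C + (C * (e + 1) + 1))
    (fun x => ?_) (fun x k hk hDk => ?_) (fun x => ?_) fun x => ?_
  · exact (hDiff _ _).2 ⟨_, rfl, Nat.find_spec (exists_size t x.length)⟩
  · obtain ⟨N, rfl, hN⟩ := (hDiff _ _).1 hDk
    refine absurd hk (not_lt.2 (Nat.pow_le_pow_right (by omega) ?_))
    have : sliceSize t x.length ≤ N := Nat.find_min' _ hN
    gcongr
  · set N := sliceSize t x.length with hN
    set K := 2 ^ (C * (N ^ 6 + 1)) with hK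
    have hs : size (wordNum x, K) = N := by
      have hmem : size (wordNum x, K) ∈ {N | N < K + 1 ∧ IsScale C K N} :=
        Nat.sInf_mem ⟨N, hNK N, isScale_iff.2 rfl⟩
      exact hmem.2.unique (by omega) (isScale_iff.2 rfl)
    have hlt : x.length < N := (Nat.find_spec (exists_size t x.length)).1
    have h1 : minPow K (symBase M.Aux) (c * N ^ 6 + c) = symBase M.Aux ^ (c * N ^ 6 + c) :=
      min_eq_right (hQM N)
    have h2 : minPow K (symBase U.Aux) (N ^ 3) = symBase U.Aux ^ (N ^ 3) :=
      min_eq_right (hQU N)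
    have h3 : minPow K 2 ((N + 1) * (N + 1)) = 2 ^ ((N + 1) * (N + 1)) :=
      min_eq_right ((Nat.le_self_pow (by omega) _).trans (hb N))
    have h4 : N * N + x.length + 1 = Nat.pair x.length N + 1 := by
      rw [Nat.pair, if_pos hlt]
    have h5 : Nat.pair x.length N + 1 ≤ (N + 1) ^ 2 := by
      rw [← h4]; nlinarith
    simp only [R, hs, log_wordNum]
    rw [h1, h2, h3, h4, stagesNum_eq le_rfl le_rfl (hb N) hM h5, mem_oracle_iff, ← hN]
    have hset := tableSet_tableNum (b := 2 ^ ((N + 1) * (N + 1))) (n := N + 1)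
      (D := stage U t (Nat.pair x.length N + 1))
      (fun k => by
        by_cases h : stage U t (Nat.pair x.length N + 1) k = 0
        · rw [h]; positivity
        · exact (stage_bound h5 h).2)
      (fun k hk => by
        by_contra h
        exact absurd (stage_bound h5 h).1 (not_lt.2 hk))
    rw [← hset]
    rfl
  · have hlt : x.length < sliceSize t x.length := (Nat.find_spec (exists_size t x.length)).1
    have h1 := he x.length
    set N := sliceSize t x.length with hN
    have h2 : max (wordNum x) (2 ^ (C * (N ^ 6 + 1))) ≤ 2 ^ (C * (N ^ 6 + 1)) := by
      refine max_le ((wordNum_lt x).le.trans (Nat.pow_le_pow_right (by omega) ?_)) le_rfl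
      have := hNC N
      omega
    -- The largest number has `C * (N ^ 6 + 1) + 1` bits, which is linear in `t n` by
    -- `exists_sliceSize_le`.
    refine (Nat.size_le_size h2).trans ?_
    rw [Nat.size_pow]
    have h3 := Nat.mul_le_mul_left C (show N ^ 6 + 1 ≤ 64 * t x.length + e + 1 by omega)
    have h4 : (C * (e + 1) + 1) * t x.length ≥ 0 := Nat.zero_le _
    nlinarith

end Computability
end

theorem theorem3 (U : OracleTM) (t : ℕ → ℕ) (ht : Superpolynomial t)
    (htc : TimeConstructible t) :
    ∃ A : Set (List Bool), ComputableInSpace A t ∧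
      ∃ c : ℝ, ∀ᶠ n : ℕ in atTop, ∃ x ∈ slice A n,
        (∀ T : ℕ → ℝ,
          T n ≤ min ((t n : ℝ) ^ (1 / 2 : ℝ)) ((2 : ℝ) ^ ((n : ℝ) / 8)) →
          ((2 * Real.logb 2 ((slice A n).ncard : ℝ) - c : ℝ) : EReal) ≤
            ((distComplexity U T A x : ENNReal) : EReal)) ∧
        min ((t n : ℝ) ^ (1 / 6 : ℝ)) ((2 : ℝ) ^ ((n : ℝ) / 24)) ≤ ((slice A n).ncard : ℝ) :=
  ⟨oracle U t, computableInSpace_oracle U ht htc, oracle_hard ht⟩
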